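/- Let $p\ge 0$, let $0<\beta_0<\pi/3$, let $0=d_1<d_2<\dots<d_{p+1}$ be real numbers and let $\theta^\star\in\mathbb R^{p+1}$. For a locally finite set $\varphi\subset\mathbb R^2$, a Delaunay triangle of $\varphi$ is a set of three points of $\varphi$ that lie on a circle whose closed disc contains no other point of $\varphi$. The $\beta$-Delaunay graph $Del_{2,\beta}^{\beta_0}(\varphi)$ has as edges the pairs of vertices of the Delaunay triangles of $\varphi$ whose smallest angle is larger than $\beta_0$. For finite $\varphi$ put $u_1(\varphi)=|\varphi|$ and, for $2\le k\le p+1$, let $u_k(\varphi)$ be the number of edges of $Del_{2,\beta}^{\beta_0}(\varphi)$ with length in $]d_{k-1},d_k]$. For finite $\psi$ put $\mathbf u(\psi|\varphi)=\mathbf u(\psi\cup\varphi)-\mathbf u(\varphi)$; for infinite locally finite $\varphi$ this is the number of points (resp. edges of the given length class) that appear minus the number of those that disappear when $\psi$ is added to $\varphi$. The local energy is $V(\psi|\varphi;\theta)=\theta^T\mathbf u(\psi|\varphi)$. Let $P_{\theta^\star}$ be a stationary Gibbs measure for $V(\cdot|\cdot;\theta^\star)$, i.e. a translation invariant probability measure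 on the locally finite subsets of $\mathbb R^2$ (with the $\sigma$-field spanned by the counts on bounded Borel sets) such that for all bounded Borel sets $\Lambda$ and all events $Y$, almost surely, $$P_{\theta^\star}(Y|\mathcal F_{\Lambda^c})(\varphi)=\frac{\mathbf 1_{\{0<Z_\Lambda(\varphi)<\infty\}}}{Z_\Lambda(\varphi)}\int e^{-V(\psi|\varphi_{\Lambda^c};\theta^\star)}\mathbf 1_Y(\psi\cup\varphi_{\Lambda^c})\,Q_\Lambda(d\psi),\qquad Z_\Lambda(\varphi)=\int e^{-V(\psi|\varphi_{\Lambda^c};\theta^\star)}\,Q_\Lambda(d\psi),$$ where $Q_\Lambda$ is the law of the Poisson process of intensity $1$ on $\Lambda$ and $\mathcal F_{\Lambda^c}$ is the $\sigma$-field spanned by the counts on bounded Borel subsets of $\Lambda^c$. Call $D>0$ a range of the model if $V(0|\varphi;\theta)=V(0|\varphi\cap\mathcal B(0,D);\theta)$ for all $\theta\in\mathbb R^{p+1}$ and all locally finite $\varphi$, where $\mathcal B(0,D)$ is the closed ball. For $\widetilde D>0$ and $i\in\mathbb Z^2$ let $\Lambda_i=\{z:\widetilde D(i_j-\tfrac12)\le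 z_j\le\widetilde D(i_j+\tfrac12),\ j=1,2\}$, let $|i|=\max(|i_1|,|i_2|)$, and define the contribution of $\Lambda_i$ to the pseudo-score as the vector $\mathbf L_i(\varphi)$ with the coordinates $$(\mathbf L_i(\varphi))_k=\int_{\Lambda_i}u_k(x|\varphi)\,e^{-V(x|\varphi;\theta^\star)}\,dx-\sum_{x\in\varphi\cap\Lambda_i}u_k(x|\varphi\setminus x),\qquad k=1,\dots,p+1 .$$ Then the model has a range, and for every range $D>0$ and every $\widetilde D>0$ the integrals in the $\mathbf L_i(\varphi)$ converge for all $\varphi$, the entries of the matrices $\mathbf L_0\mathbf L_i^T$ are $P_{\theta^\star}$-integrable, and the matrix $$\Sigma(\widetilde D,\theta^\star)=\widetilde D^{-2}\sum_{|i|\le[D/\widetilde D]+1}\mathbb E_{P_{\theta^\star}}\big(\mathbf L_0(\Phi)\,\mathbf L_i(\Phi)^T\big)$$ is symmetric and positive definite. -/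

import Mathlib

open MeasureTheory

noncomputable section

namespace BetaDelaunay

/-! ### Configurations of points in the plane -/

/-- The Euclidean plane. -/
abbrev Plane := EuclideanSpace ℝ (Fin 2)

/-- The space of locally finite subsets of the plane. -/
def Config : Type :=
  {φ : Set Plane // ∀ K : Set Plane, Bornology.IsBounded K → (φ ∩ K).Finite}

/-- The σ-field spanned by the counts `φ ↦ φ(B)` with `B` a bounded Borel subset of `S`. -/
@[reducible] def countField (S : Set Plane) : MeasurableSpace Config :=
  ⨆ (B : Set Plane) (_ : MeasurableSet B ∧ Bornology.IsBounded B ∧ B ⊆ S),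
    MeasurableSpace.comap (fun φ : Config => (φ.1 ∩ B).ncard) ⊤

/-- The σ-field on configurations spanned by the counts on all bounded Borel sets. -/
instance instMeasurableSpaceConfig : MeasurableSpace Config := countField Set.univ

theorem countField_le (S : Set Plane) : countField S ≤ instMeasurableSpaceConfig :=
  iSup_mono fun _ => iSup_mono' fun h => ⟨⟨h.1, h.2.1, Set.subset_univ _⟩, le_rfl⟩

/-- The part `φ_S` of a configuration that lies in `S`. -/
def Config.restrict (φ : Config) (S : Set Plane) : Config :=
  ⟨φ.1 ∩ S, fun K hK => (φ.2 K hK).subset fun _ hx => ⟨hx.1.1, hx.2⟩⟩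

/-- The superposition `φ ∪ ψ`. -/
def Config.union (φ ψ : Config) : Config :=
  ⟨φ.1 ∪ ψ.1, fun K hK => by
    rw [Set.union_inter_distrib_right]
    exact (φ.2 K hK).union (ψ.2 K hK)⟩

/-- The configuration translated by `v`. -/
def Config.translate (v : Plane) (φ : Config) : Config :=
  ⟨(fun x => x + v) '' φ.1, fun K hK => by
    have hb : Bornology.IsBounded ((fun x : Plane => x + -v) '' K) :=
      (LipschitzWith.id.add (LipschitzWith.const (-v))).isBounded_image hK
    refine ((φ.2 _ hb).image (fun x => x + v)).subset ?_
    rintro _ ⟨⟨x, hx, rfl⟩, hK'⟩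
    exact ⟨x, ⟨hx, ⟨x + v, hK', by simp⟩⟩, rfl⟩⟩

/-- The finite configuration `{x₁, …, xₙ}`. -/
def Config.ofTuple {n : ℕ} (x : Fin n → Plane) : Config :=
  ⟨Set.range x, fun _ _ => (Set.finite_range x).subset Set.inter_subset_left⟩

theorem measurable_ofTuple (n : ℕ) :
    Measurable (Config.ofTuple : (Fin n → Plane) → Config) := by
  classical
  refine Measurable.of_le_map (iSup₂_le fun B hB => ?_)
  rw [MeasurableSpace.comap_le_iff_le_map]
  suffices h : Measurable fun x : Fin n → Plane => (Set.range x ∩ B).ncard by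
    exact fun s _ => h (show MeasurableSet s from trivial)
  have key : (fun x : Fin n → Plane => (Set.range x ∩ B).ncard) = fun x =>
      ∑ i : Fin n, if x i ∈ B ∧ ∀ j : Fin n, j < i → x j ≠ x i then 1 else 0 := by
    funext x
    rw [Finset.sum_boole, Nat.cast_id]
    have himg : Set.range x ∩ B =
        ((Finset.univ.filter fun i : Fin n => x i ∈ B ∧ ∀ j : Fin n, j < i → x j ≠ x i).image x :
          Finset Plane) := by
      ext z
      simp only [Set.mem_inter_iff, Set.mem_range, Finset.coe_image, Finset.coe_filter,
        Finset.mem_univ, true_and, Set.mem_image, Set.mem_ofPred_eq]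
      constructor
      · rintro ⟨⟨i, hi⟩, hz⟩
        obtain ⟨k, hk, hmin⟩ := WellFounded.has_min (wellFounded_lt (α := Fin n))
          {k | x k = z} ⟨i, hi⟩
        simp only [Set.mem_ofPred_eq] at hk hmin
        exact ⟨k, ⟨hk ▸ hz, fun j hj he => hmin j (he.trans hk) hj⟩, hk⟩
      · rintro ⟨i, ⟨hB, -⟩, rfl⟩
        exact ⟨⟨i, rfl⟩, hB⟩
    rw [himg, Set.ncard_coe_finset, Finset.card_image_of_injOn]
    intro i hi j hj hij
    simp only [Finset.coe_filter, Finset.mem_univ, true_and, Set.mem_ofPred_eq] at hi hj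
    rcases lt_trichotomy i j with h | h | h
    · exact absurd hij (hj.2 i h)
    · exact h
    · exact absurd hij.symm (hi.2 j h)
  rw [key]
  refine Finset.measurable_sum _ fun i _ => Measurable.ite ?_ measurable_const measurable_const
  refine MeasurableSet.inter (measurable_pi_apply i hB.1) ?_
  have hset : {x : Fin n → Plane | ∀ j : Fin n, j < i → x j ≠ x i} =
      ⋂ (j : Fin n) (_ : j < i), {x : Fin n → Plane | x j = x i}ᶜ := by
    ext x
    simp
  change MeasurableSet {x : Fin n → Plane | ∀ j : Fin n, j < i → x j ≠ x i}
  rw [hset]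
  refine MeasurableSet.iInter fun j => MeasurableSet.iInter fun _ => ?_
  exact (measurableSet_eq_fun (measurable_pi_apply j) (measurable_pi_apply i)).compl

/-- The law `Q_Λ` of the Poisson process of intensity `1` on a bounded Borel set `Λ`. -/
def poisson (Λ : Set Plane) : Measure Config :=
  ENNReal.ofReal (Real.exp (-volume.real Λ)) •
    Measure.sum fun n : ℕ => ((n.factorial : ENNReal)⁻¹) •
      Measure.map Config.ofTuple (Measure.pi fun _ : Fin n => volume.restrict Λ)

/-! ### The `β`-Delaunay graph -/

/-- Delaunay triangles of `φ`: three points of `φ` whose circumscribed closed disc contains no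
other point of `φ`.  (Three distinct points of a circle are never collinear.) -/
def del3 (φ : Set Plane) : Set (Finset Plane) :=
  {ψ | ψ.card = 3 ∧ ∃ (c : Plane) (r : ℝ),
    (∀ x ∈ ψ, dist x c = r) ∧ φ ∩ Metric.closedBall c r = (ψ : Set Plane)}

/-- Delaunay triangles all of whose angles are larger than `β₀`. -/
def betaDel3 (β₀ : ℝ) (φ : Set Plane) : Set (Finset Plane) :=
  {ψ ∈ del3 φ | ∀ a ∈ ψ, ∀ b ∈ ψ, ∀ c ∈ ψ, a ≠ b → b ≠ c → a ≠ c →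
    β₀ < EuclideanGeometry.angle a b c}

/-- Edges of the `β`-Delaunay graph of order `β₀`: the pairs of vertices of triangles of
`betaDel3 β₀ φ`. -/
def betaDel2 (β₀ : ℝ) (φ : Set Plane) : Set (Finset Plane) :=
  {ξ | ξ.card = 2 ∧ ∃ ψ ∈ betaDel3 β₀ φ, ξ ⊆ ψ}

/-- Edges of the `β`-Delaunay graph with length in `]s, t]` (the length of the edge `{a, b}` is
its diameter). -/
def edgesIoc (β₀ s t : ℝ) (φ : Set Plane) : Set (Finset Plane) :=
  {ξ ∈ betaDel2 β₀ φ | Metric.diam (ξ : Set Plane) ∈ Set.Ioc s t}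

/-! ### The multi-Strauss energy

The parameter has `p + 1` coordinates, numbered from `0` to `p` instead of from `1` to `p + 1`. -/

/-- The increment `u(ψ | φ) = u(ψ ∪ φ) - u(φ)` for a finite set `ψ`: the first coordinate of `u`
is the number of points, the next ones are the numbers of `β`-Delaunay edges with length in
`]d_{k-1}, d_k]`.  For an infinite locally finite `φ` the difference is the number of cliques
that appear minus the number of cliques that disappear. -/
def u {p : ℕ} (β₀ : ℝ) (d : Fin (p + 1) → ℝ) (ψ φ : Set Plane) : Fin (p + 1) → ℝ :=
  Fin.cons ((ψ \ φ).ncard : ℝ) fun k : Fin p =>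
    ((edgesIoc β₀ (d k.castSucc) (d k.succ) (ψ ∪ φ) \
        edgesIoc β₀ (d k.castSucc) (d k.succ) φ).ncard : ℝ) -
      ((edgesIoc β₀ (d k.castSucc) (d k.succ) φ \
        edgesIoc β₀ (d k.castSucc) (d k.succ) (ψ ∪ φ)).ncard : ℝ)

/-- The local energy `V(ψ | φ; θ) = θᵀ u(ψ | φ)`. -/
def V {p : ℕ} (β₀ : ℝ) (d θ : Fin (p + 1) → ℝ) (ψ φ : Set Plane) : ℝ :=
  ∑ k, θ k * u β₀ d ψ φ k

/-- `D` is a range of the local energy: `V(0 | φ; θ)` depends, for every `θ`, only on the points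
of `φ` at distance at most `D` from the origin. -/
def IsRange {p : ℕ} (β₀ : ℝ) (d : Fin (p + 1) → ℝ) (D : ℝ) : Prop :=
  ∀ (θ : Fin (p + 1) → ℝ) (φ : Config),
    V β₀ d θ {0} φ.1 = V β₀ d θ {0} (φ.1 ∩ Metric.closedBall 0 D)

/-! ### Gibbs measures -/

/-- The integral `∫ exp(-V(ψ | φ_{Λᶜ})) 1_Y(ψ ∪ φ_{Λᶜ}) Q_Λ(dψ)`. -/
def weight {p : ℕ} (β₀ : ℝ) (d θ : Fin (p + 1) → ℝ) (Λ : Set Plane) (φ : Config)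
    (Y : Set Config) : ENNReal :=
  ∫⁻ ψ, ENNReal.ofReal (Real.exp (-V β₀ d θ ψ.1 (φ.restrict Λᶜ).1)) *
    Y.indicator 1 (ψ.union (φ.restrict Λᶜ)) ∂poisson Λ

/-- The partition function `Z_Λ(φ)`. -/
def partitionFunction {p : ℕ} (β₀ : ℝ) (d θ : Fin (p + 1) → ℝ) (Λ : Set Plane) (φ : Config) :
    ENNReal :=
  weight β₀ d θ Λ φ Set.univ

open Classical in
/-- The local specification `Π_Λ(φ, Y)`. -/
def specification {p : ℕ} (β₀ : ℝ) (d θ : Fin (p + 1) → ℝ) (Λ : Set Plane) (φ : Config)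
    (Y : Set Config) : ENNReal :=
  if 0 < partitionFunction β₀ d θ Λ φ ∧ partitionFunction β₀ d θ Λ φ < ⊤ then
    (partitionFunction β₀ d θ Λ φ)⁻¹ * weight β₀ d θ Λ φ Y
  else 0

/-- The Dobrushin-Lanford-Ruelle equations: `P(Y | F_{Λᶜ}) = Π_Λ(·, Y)` almost surely, for every
bounded Borel set `Λ` and every event `Y`. -/
def IsGibbs {p : ℕ} (β₀ : ℝ) (d θ : Fin (p + 1) → ℝ) (P : Measure Config) : Prop :=
  ∀ Λ : Set Plane, MeasurableSet Λ → Bornology.IsBounded Λ → ∀ Y : Set Config, MeasurableSet Y →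
    condExp (countField Λᶜ) P (Y.indicator fun _ => (1 : ℝ)) =ᵐ[P]
      fun φ => (specification β₀ d θ Λ φ Y).toReal

/-- Invariance under all translations. -/
def IsStationary (P : Measure Config) : Prop :=
  ∀ v : Plane, MeasurePreserving (Config.translate v) P P

/-! ### The pseudo-score and its asymptotic covariance matrix -/

/-- The closed square with side `Dt` centred at `Dt • i`. -/
def cell (Dt : ℝ) (i : Fin 2 → ℤ) : Set Plane :=
  {z | ∀ j, Dt * ((i j : ℝ) - 1 / 2) ≤ z j ∧ z j ≤ Dt * ((i j : ℝ) + 1 / 2)}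

/-- The integrand `x ↦ u_k(x | φ) exp(-V(x | φ; θ))` of the pseudo-score. -/
def scoreIntegrand {p : ℕ} (β₀ : ℝ) (d θ : Fin (p + 1) → ℝ) (φ : Config) (k : Fin (p + 1))
    (x : Plane) : ℝ :=
  u β₀ d {x} φ.1 k * Real.exp (-V β₀ d θ {x} φ.1)

/-- The `k`-th coordinate of the contribution of the cell `i` to the pseudo-score, that is
`∫_{Λ_i} u_k(x | φ) exp(-V(x | φ; θ)) dx - ∑_{x ∈ φ ∩ Λ_i} u_k(x | φ \ x)`; here `u_k` is the
partial derivative of `V` in `θ_k`. -/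
def score {p : ℕ} (β₀ : ℝ) (d θ : Fin (p + 1) → ℝ) (Dt : ℝ) (i : Fin 2 → ℤ) (φ : Config)
    (k : Fin (p + 1)) : ℝ :=
  (∫ x in cell Dt i, scoreIntegrand β₀ d θ φ k x) -
    ∑ᶠ x ∈ φ.1 ∩ cell Dt i, u β₀ d {x} (φ.1 \ {x}) k

/-- The matrix `Σ(Dt, θ) = Dt⁻² ∑_{|i| ≤ [D / Dt] + 1} E(L_0 L_iᵀ)` where `L_i` is the score of
the cell `i`, `|i| = max(|i₁|, |i₂|)`, and `E` is the expectation under `P`. -/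
def covMatrix {p : ℕ} (β₀ : ℝ) (d θ : Fin (p + 1) → ℝ) (P : Measure Config) (D Dt : ℝ) :
    Matrix (Fin (p + 1)) (Fin (p + 1)) ℝ :=
  Matrix.of fun k l => (Dt ^ 2)⁻¹ *
    ∑ i ∈ Finset.Icc (fun _ : Fin 2 => -(⌊D / Dt⌋ + 1)) (fun _ : Fin 2 => ⌊D / Dt⌋ + 1),
      ∫ φ, score β₀ d θ Dt 0 φ k * score β₀ d θ Dt i φ l ∂P

end BetaDelaunay

end

noncomputable section

open MeasureTheory ProbabilityTheory Function Set

namespace BetaDelaunay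

/-! ### Configurations as random measures -/

/-! The score of a cell is an innovation. For a local function `F` of a point and a configuration,
`innov lam F C φ` is the integral of `F * lam` over `C` minus the sum of `F x (φ \ x)` over the
points of `φ` in `C`, where `lam = exp(-V(x | φ))` is the conditional intensity. The
Georgii-Nguyen-Zessin formula (`IsGibbs.gnz`) comes from the DLR equations, the Mecke formula and
the additivity of the energy. It makes the innovation the adjoint of a difference operator
(`innov_duality`): the expectation of `innov lam g C * T` is that of the integral of `g * lam * (T φ
- T (φ ∪ x))` over `x ∈ C`.

With another innovation as `T`, this shows that covariances vanish beyond the range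
(`innovCov_eq_zero`). By stationarity, the sum over the cells is then a symmetric positive
semidefinite form `B` on local functions, an asymptotic variance per cell
(`sum_innovCov_self_nonneg`). The quadratic form of the matrix at `y` is a positive multiple of `B h
h` with `h = ∑ y_k u_k`. If `B h h = 0`, Cauchy-Schwarz gives `B g h = 0` for every local `g`, of
any range. By duality, the change of the total innovation of `h` under insertion of `x` is then
orthogonal to every local function (`integral_difference_eq_zero`). It remains to find, for `y ≠ 0`,
a local event of positive probability on which this change has a constant strict sign.

If `y 0 ≠ 0`, the event is that no point is near `x`: two points carry no triangle, so only the
count of the point `x` itself changes. If `y 0 = 0`, let `]s, t]` be the longest length class with a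
nonzero coefficient. The event is that `x` has exactly one neighbour `a`, placed so that all
admissible triangles on the base `x a` have sides longer than `s`, while an open set of apexes
yields a side of length at most `t` (`exists_base`). Then only this class contributes, and with one
sign. Positivity of the intensity gives these events positive probability (`void_pos`,
`single_pos`).

Throughout, the increments must be bounded and of finite range. An edge of length at most `L` bounds
the circumradius by `L / (2 sin β₀)`, whence the range (`exists_range`). One new point affects
boundedly many triangles (`exists_bound_vertex`, `exists_bound_disc`): the difference of the powers
with respect to two empty circles is affine, which forces fat triangles seen in nearby directions to
coincide. -/

theorem Config.ext {φ ψ : Config} (h : φ.1 = ψ.1) : φ = ψ := Subtype.ext h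

theorem Config.countable (φ : Config) : φ.1.Countable := by
  have h : φ.1 = ⋃ n : ℕ, φ.1 ∩ Metric.closedBall 0 n := by
    rw [← inter_iUnion, Metric.iUnion_closedBall_nat, inter_univ]
  rw [h]
  exact countable_iUnion fun n => (φ.2 _ Metric.isBounded_closedBall).countable

/-- The counting measure of a configuration. -/
def pts (φ : Config) : Measure Plane := Measure.sum fun a : φ.1 => Measure.dirac (a : Plane)

theorem lintegral_pts (φ : Config) (f : Plane → ENNReal) :
    ∫⁻ z, f z ∂pts φ = ∑' a : φ.1, f a := by
  simp [pts, lintegral_sum_measure]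

theorem pts_apply (φ : Config) (B : Set Plane) : pts φ B = (φ.1 ∩ B).encard := by
  have := φ.countable.to_subtype
  rw [pts, Measure.sum_apply_of_countable]
  simp only [Measure.dirac_apply]
  have h := ENNReal.tsum_set_one (φ.1 ∩ B)
  rw [← h, tsum_subtype φ.1 (fun a => B.indicator (1 : Plane → ENNReal) a),
    tsum_subtype (φ.1 ∩ B) (fun _ => (1 : ENNReal))]
  congr 1
  ext a
  by_cases ha : a ∈ φ.1 <;> by_cases hb : a ∈ B <;> simp [ha, hb]

theorem pts_apply_of_bounded (φ : Config) {B : Set Plane} (hB : Bornology.IsBounded B) :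
    pts φ B = ((φ.1 ∩ B).ncard : ENNReal) := by
  rw [pts_apply, ← (φ.2 B hB).cast_ncard_eq]
  simp

theorem pts_lt_top (φ : Config) {B : Set Plane} (hB : Bornology.IsBounded B) : pts φ B < ⊤ := by
  rw [pts_apply_of_bounded φ hB]; exact ENNReal.natCast_lt_top _

theorem measurable_ncard_inter {B : Set Plane} (hB : MeasurableSet B)
    (hb : Bornology.IsBounded B) : Measurable fun φ : Config => (φ.1 ∩ B).ncard := by
  intro s _
  have h : MeasurableSpace.comap (fun φ : Config => (φ.1 ∩ B).ncard) ⊤ ≤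
      instMeasurableSpaceConfig :=
    le_iSup₂_of_le B ⟨hB, hb, subset_univ _⟩ le_rfl
  exact h _ ⟨s, trivial, rfl⟩

theorem measurable_pts_apply {B : Set Plane} (hB : MeasurableSet B) :
    Measurable fun φ : Config => pts φ B := by
  have h : ∀ φ : Config, pts φ B = ⨆ n : ℕ, ((φ.1 ∩ (B ∩ Metric.closedBall 0 n)).ncard : ENNReal) := by
    intro φ
    have hB' : B = ⋃ n : ℕ, B ∩ Metric.closedBall 0 n := by
      rw [← inter_iUnion, Metric.iUnion_closedBall_nat, inter_univ]
    conv_lhs => rw [hB']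
    rw [Monotone.measure_iUnion]
    · congr 1
      ext n
      exact pts_apply_of_bounded φ (Metric.isBounded_closedBall.subset inter_subset_right)
    · intro m n hmn
      exact inter_subset_inter_right _ (Metric.closedBall_subset_closedBall (by exact_mod_cast hmn))
  simp_rw [h]
  refine Measurable.iSup fun n => ?_
  exact (measurable_from_top (f := fun n : ℕ => (n : ENNReal))).comp
    (measurable_ncard_inter (hB.inter Metric.isClosed_closedBall.measurableSet)
      (Metric.isBounded_closedBall.subset inter_subset_right))

/-- A map into the space of configurations is measurable as soon as all counts are. -/
theorem measurable_config_of_pts {Ω : Type*} [MeasurableSpace Ω] {f : Ω → Config}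
    (h : ∀ B : Set Plane, MeasurableSet B → Bornology.IsBounded B →
      Measurable fun ω => pts (f ω) B) : Measurable f := by
  refine Measurable.of_le_map (iSup₂_le fun B hB => ?_)
  rw [MeasurableSpace.comap_le_iff_le_map]
  have h1 : Measurable fun ω => ((f ω).1 ∩ B).ncard := by
    have h2 : (fun ω => ((f ω).1 ∩ B).ncard) = fun ω => ⌊(pts (f ω) B).toReal⌋₊ := by
      ext ω
      rw [pts_apply_of_bounded _ hB.2.1]
      simp
    rw [h2]
    exact Nat.measurable_floor.comp (h B hB.1 hB.2.1).ennreal_toReal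
  exact fun s _ => h1 (show MeasurableSet s from trivial)

/-- The counting measure as a kernel. -/
def ptsKernel : Kernel Config Plane where
  toFun := pts
  measurable' := Measure.measurable_of_measurable_coe _ fun _ hB => measurable_pts_apply hB

theorem ptsKernel_apply (φ : Config) : ptsKernel φ = pts φ := rfl

-- The pieces must have uniformly bounded mass, whereas the counts are merely finite. The kernel is
-- cut along disjoint annuli and, in each annulus, along the value of the count, which then bounds
-- the piece.
open Classical in
instance : IsSFiniteKernel ptsKernel := by
  set A : ℕ → Set Plane := disjointed fun n : ℕ => Metric.closedBall (0 : Plane) n with hA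
  have hAm : ∀ n, MeasurableSet (A n) := fun n =>
    MeasurableSet.disjointed (fun n => Metric.isClosed_closedBall.measurableSet) n
  have hAb : ∀ n, Bornology.IsBounded (A n) := fun n =>
    Metric.isBounded_closedBall.subset (disjointed_subset _ n)
  have hs : ∀ n m : ℕ, MeasurableSet {φ : Config | (φ.1 ∩ A n).ncard = m} := fun n m =>
    measurable_ncard_inter (hAm n) (hAb n) (measurableSet_singleton m)
  let κ : ℕ × ℕ → Kernel Config Plane := fun q =>
    Kernel.piecewise (hs q.1 q.2) (ptsKernel.restrict (hAm q.1)) 0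
  have hκ : ∀ q, IsFiniteKernel (κ q) := by
    intro q
    refine ⟨⟨q.2, ENNReal.natCast_lt_top _, fun φ => ?_⟩⟩
    simp only [κ, Kernel.piecewise_apply]
    split_ifs with hφ
    · rw [Kernel.restrict_apply, Measure.restrict_apply_univ, ptsKernel_apply,
        pts_apply_of_bounded _ (hAb _), hφ]
    · simp
  have hsum : ptsKernel = Kernel.sum κ := by
    ext φ B hB
    rw [Kernel.sum_apply' _ _ hB, ENNReal.summable.tsum_prod' (fun _ => ENNReal.summable)]
    have h1 : ∀ n, ∑' m, κ (n, m) φ B = pts φ (B ∩ A n) := by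
      intro n
      rw [tsum_eq_single (φ.1 ∩ A n).ncard]
      · simp only [κ, Kernel.piecewise_apply]
        rw [if_pos (show φ ∈ {χ : Config | (χ.1 ∩ A n).ncard = (φ.1 ∩ A n).ncard} from rfl),
          Kernel.restrict_apply, Measure.restrict_apply hB, ptsKernel_apply]
      · intro m hm
        simp only [κ, Kernel.piecewise_apply]
        rw [if_neg (show φ ∉ {χ : Config | (χ.1 ∩ A n).ncard = m} from fun h => hm h.symm)]
        simp
    simp_rw [h1]
    rw [← measure_iUnion, ← inter_iUnion, hA, iUnion_disjointed, Metric.iUnion_closedBall_nat,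
      inter_univ, ptsKernel_apply]
    · exact fun i j hij => ((disjoint_disjointed _ hij).mono inter_subset_right inter_subset_right)
    · exact fun n => hB.inter (hAm n)
  rw [hsum]
  infer_instance

/-- Sums over the points of a configuration depend measurably on parameters. -/
theorem measurable_lintegral_pts {Ω : Type*} [MeasurableSpace Ω] {c : Ω → Config}
    (hc : Measurable c) {f : Ω → Plane → ENNReal} (hf : Measurable (uncurry f)) :
    Measurable fun ω => ∫⁻ z, f ω z ∂pts (c ω) :=
  Measurable.lintegral_kernel_prod_right (κ := ptsKernel.comap c hc) hf

theorem stronglyMeasurable_integral_pts {Ω : Type*} [MeasurableSpace Ω] {c : Ω → Config}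
    (hc : Measurable c) {f : Ω → Plane → ℝ} (hf : Measurable (uncurry f)) :
    StronglyMeasurable fun ω => ∫ z, f ω z ∂pts (c ω) :=
  StronglyMeasurable.integral_kernel_prod_right (κ := ptsKernel.comap c hc) hf.stronglyMeasurable

theorem measurable_pts_preimage {Ω : Type*} [MeasurableSpace Ω] {c : Ω → Config}
    (hc : Measurable c) {s : Set (Ω × Plane)} (hs : MeasurableSet s) :
    Measurable fun ω => pts (c ω) {z | (ω, z) ∈ s} :=
  Kernel.measurable_kernel_prodMk_left (κ := ptsKernel.comap c hc) hs

theorem pts_eq_zero_iff (φ : Config) (B : Set Plane) : pts φ B = 0 ↔ ∀ z ∈ φ.1, z ∉ B := by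
  rw [pts_apply]
  simp only [ENat.toENNReal_eq_zero, encard_eq_zero, Set.eq_empty_iff_forall_notMem, mem_inter_iff,
    not_and]

/-- A quantifier over the points of a random configuration says that a section of `s` has nonzero
count, and such counts are measurable. All Delaunay conditions are reduced to quantifiers of this
kind. -/
theorem measurableSet_exists_mem {Ω : Type*} [MeasurableSpace Ω] {c : Ω → Config}
    (hc : Measurable c) {s : Set (Ω × Plane)} (hs : MeasurableSet s) :
    MeasurableSet {ω | ∃ z ∈ (c ω).1, (ω, z) ∈ s} := by
  have h : {ω | ∃ z ∈ (c ω).1, (ω, z) ∈ s} = {ω | pts (c ω) {z | (ω, z) ∈ s} = 0}ᶜ := by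
    ext ω
    simp only [mem_ofPred_eq, mem_compl_iff, pts_eq_zero_iff]
    push Not
    rfl
  rw [h]
  exact (measurableSet_eq_fun (measurable_pts_preimage hc hs) measurable_const).compl

theorem measurableSet_forall_mem {Ω : Type*} [MeasurableSpace Ω] {c : Ω → Config}
    (hc : Measurable c) {s : Set (Ω × Plane)} (hs : MeasurableSet s) :
    MeasurableSet {ω | ∀ z ∈ (c ω).1, (ω, z) ∈ s} := by
  have h := (measurableSet_exists_mem hc hs.compl).compl
  convert h using 1
  ext ω
  simp

theorem measurableSet_mem {Ω : Type*} [MeasurableSpace Ω] {c : Ω → Config}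
    (hc : Measurable c) {x : Ω → Plane} (hx : Measurable x) :
    MeasurableSet {ω | x ω ∈ (c ω).1} := by
  have h := measurableSet_exists_mem hc
    (s := {q : Ω × Plane | q.2 = x q.1}) (measurableSet_eq_fun measurable_snd (hx.comp measurable_fst))
  convert h using 1
  ext ω
  simp

/-! ### Operations on configurations -/

/-- The configuration with a single point. -/
def Config.single (x : Plane) : Config := ⟨{x}, fun _ _ => (finite_singleton x).inter_of_left _⟩

/-- The configuration `φ ∪ {x}`. -/
def Config.insert (x : Plane) (φ : Config) : Config := (Config.single x).union φ

/-- The configuration `φ \ {x}`. -/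
def Config.erase (x : Plane) (φ : Config) : Config := φ.restrict {x}ᶜ

@[simp] theorem Config.coe_single (x : Plane) : (Config.single x).1 = {x} := rfl
@[simp] theorem Config.coe_union (φ ψ : Config) : (φ.union ψ).1 = φ.1 ∪ ψ.1 := rfl
@[simp] theorem Config.coe_insert (x : Plane) (φ : Config) : (φ.insert x).1 = {x} ∪ φ.1 := rfl
@[simp] theorem Config.coe_restrict (φ : Config) (S : Set Plane) : (φ.restrict S).1 = φ.1 ∩ S := rfl
@[simp] theorem Config.coe_erase (x : Plane) (φ : Config) : (φ.erase x).1 = φ.1 \ {x} := rfl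
@[simp] theorem Config.coe_translate (v : Plane) (φ : Config) :
    (φ.translate v).1 = (fun x => x + v) '' φ.1 := rfl

theorem measurable_single : Measurable Config.single :=
  measurable_config_of_pts fun B hB _ => by
    have h : ∀ x, pts (Config.single x) B = B.indicator 1 x := by
      intro x
      rw [pts_apply]
      by_cases hx : x ∈ B <;> simp [hx]
    simp_rw [h]
    exact measurable_one.indicator hB

theorem pts_restrict (φ : Config) (S : Set Plane) {B : Set Plane} :
    pts (φ.restrict S) B = pts φ (B ∩ S) := by
  rw [pts_apply, pts_apply, Config.coe_restrict, inter_assoc, inter_comm S B]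

/-- Restriction of configurations to a measurably varying set. -/
theorem measurable_restrict' {Ω : Type*} [MeasurableSpace Ω] {c : Ω → Config} (hc : Measurable c)
    {s : Set (Ω × Plane)} (hs : MeasurableSet s) :
    Measurable fun ω => (c ω).restrict {z | (ω, z) ∈ s} :=
  measurable_config_of_pts fun B hB _ => by
    simp_rw [pts_restrict]
    exact measurable_pts_preimage hc
      (s := {q : Ω × Plane | q.2 ∈ B ∧ q ∈ s}) ((measurable_snd hB).inter hs)

theorem measurable_restrict {S : Set Plane} (hS : MeasurableSet S) :
    Measurable fun φ : Config => φ.restrict S :=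
  measurable_restrict' measurable_id (s := {q : Config × Plane | q.2 ∈ S}) (measurable_snd hS)

theorem pts_union (φ ψ : Config) (B : Set Plane) :
    pts (φ.union ψ) B = pts φ B + pts (ψ.restrict φ.1ᶜ) B := by
  simp only [pts_apply, Config.coe_union, Config.coe_restrict]
  rw [show (φ.1 ∪ ψ.1) ∩ B = (φ.1 ∩ B) ∪ (ψ.1 ∩ φ.1ᶜ ∩ B) by ext z; simp; tauto,
    encard_union_eq, ENat.toENNReal_add]
  rw [disjoint_left]
  rintro z ⟨hz, -⟩ ⟨⟨-, hz'⟩, -⟩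
  exact hz' hz

theorem measurable_union {Ω : Type*} [MeasurableSpace Ω] {c e : Ω → Config} (hc : Measurable c)
    (he : Measurable e) : Measurable fun ω => (c ω).union (e ω) :=
  measurable_config_of_pts fun B hB _ => by
    simp_rw [pts_union]
    refine ((measurable_pts_apply hB).comp hc).add ((measurable_pts_apply hB).comp ?_)
    exact measurable_restrict' he (s := {q : Ω × Plane | q.2 ∈ (c q.1).1ᶜ})
      (measurableSet_mem (hc.comp measurable_fst) measurable_snd).compl

theorem measurable_insert {Ω : Type*} [MeasurableSpace Ω] {x : Ω → Plane} {c : Ω → Config}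
    (hx : Measurable x) (hc : Measurable c) : Measurable fun ω => (c ω).insert (x ω) :=
  measurable_union (measurable_single.comp hx) hc

theorem measurable_erase {Ω : Type*} [MeasurableSpace Ω] {x : Ω → Plane} {c : Ω → Config}
    (hx : Measurable x) (hc : Measurable c) : Measurable fun ω => (c ω).erase (x ω) :=
  measurable_restrict' hc (s := {q : Ω × Plane | q.2 ∈ ({x q.1}ᶜ : Set Plane)})
    (measurableSet_eq_fun measurable_snd (hx.comp measurable_fst)).compl

theorem Config.insert_erase {x : Plane} {φ : Config} (h : x ∈ φ.1) :
    (φ.erase x).insert x = φ :=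
  Config.ext (by ext z; by_cases hz : z = x <;> simp [hz, h])

theorem Config.erase_insert {x : Plane} {φ : Config} (h : x ∉ φ.1) :
    (φ.insert x).erase x = φ :=
  Config.ext (by
    ext z
    by_cases hz : z = x
    · subst hz; simp [h]
    · simp [hz])

/-! ### Plane geometry in coordinates -/

/-- The determinant of two plane vectors. -/
def det (a b : Plane) : ℝ := a 0 * b 1 - a 1 * b 0

/-- The scalar product of two plane vectors in coordinates. -/
def dot (a b : Plane) : ℝ := a 0 * b 0 + a 1 * b 1

/-- Twice the signed area of a triangle. -/
def orient (a b c : Plane) : ℝ := det (b - a) (c - a)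

theorem dot_self (a : Plane) : dot a a = ‖a‖ ^ 2 := by
  rw [EuclideanSpace.norm_sq_eq, Fin.sum_univ_two]
  simp only [dot, Real.norm_eq_abs, sq_abs]
  ring

theorem dist_sq (a b : Plane) : dist a b ^ 2 = dot (a - b) (a - b) := by
  rw [dot_self, dist_eq_norm]

theorem inner_eq_dot (a b : Plane) : inner ℝ a b = dot a b := by
  rw [PiLp.inner_apply, Fin.sum_univ_two]
  simp [dot, mul_comm]

theorem det_sq_add_dot_sq (a b : Plane) : det a b ^ 2 + dot a b ^ 2 = (‖a‖ * ‖b‖) ^ 2 := by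
  rw [mul_pow, ← dot_self, ← dot_self]
  simp only [det, dot]
  ring

theorem abs_det_le (a b : Plane) : |det a b| ≤ ‖a‖ * ‖b‖ := by
  apply abs_le_of_sq_le_sq _ (by positivity)
  nlinarith [det_sq_add_dot_sq a b, sq_nonneg (dot a b)]

theorem orient_rotate (a b c : Plane) : orient b c a = orient a b c := by
  simp only [orient, det, PiLp.sub_apply]; ring

theorem orient_swap (a b c : Plane) : orient a c b = -orient a b c := by
  simp only [orient, det, PiLp.sub_apply]; ring

theorem dot_eq_cos (a b c : Plane) :
    dot (b - a) (c - a) = dist b a * dist c a * Real.cos (EuclideanGeometry.angle b a c) := by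
  rw [EuclideanGeometry.angle, ← inner_eq_dot, dist_eq_norm, dist_eq_norm]
  have := InnerProductGeometry.cos_angle_mul_norm_mul_norm (b - a) (c - a)
  simp only [vsub_eq_sub]
  rw [← this]; ring

theorem orient_sq (a b c : Plane) :
    orient a b c ^ 2 = (dist b a * dist c a * Real.sin (EuclideanGeometry.angle b a c)) ^ 2 := by
  have h := det_sq_add_dot_sq (b - a) (c - a)
  rw [dot_eq_cos] at h
  rw [orient, dist_eq_norm, dist_eq_norm] at *
  have h2 := Real.sin_sq_add_cos_sq (EuclideanGeometry.angle b a c)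
  linear_combination h - (‖b - a‖ * ‖c - a‖) ^ 2 * h2

/-- A positively oriented triangle whose angles have sine at least `s` and cotangent at most `κ`. -/
structure IsFat (s κ : ℝ) (a b c : Plane) : Prop where
  pos : 0 < orient a b c
  sa : s * (dist b a * dist c a) ≤ orient a b c
  sb : s * (dist c b * dist a b) ≤ orient a b c
  sc : s * (dist a c * dist b c) ≤ orient a b c
  ka : dot (b - a) (c - a) ≤ κ * orient a b c
  kb : dot (c - b) (a - b) ≤ κ * orient a b c
  kc : dot (a - c) (b - c) ≤ κ * orient a b c

theorem IsFat.rotate {s κ : ℝ} {a b c : Plane} (h : IsFat s κ a b c) : IsFat s κ b c a := by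
  have e := orient_rotate a b c
  constructor <;> rw [e]
  exacts [h.pos, h.sb, h.sc, h.sa, h.kb, h.kc, h.ka]

/-- All angles of the triangle `a b c` are larger than `β₀`. -/
def AnglesGT (β₀ : ℝ) (a b c : Plane) : Prop :=
  β₀ < EuclideanGeometry.angle b a c ∧ β₀ < EuclideanGeometry.angle c b a ∧
    β₀ < EuclideanGeometry.angle a c b

/-- On `[β₀, π - β₀]` the sine is smallest at the ends, and `cot α ≤ cot β₀` amounts to `sin (α -
β₀) ≥ 0`. -/
theorem fat_corner {β₀ : ℝ} (h0 : 0 < β₀) {a b c : Plane} (hab : a ≠ b)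
    (hac : a ≠ c) (h1 : β₀ < EuclideanGeometry.angle b a c)
    (h2 : EuclideanGeometry.angle b a c < Real.pi - β₀) :
    orient a b c ≠ 0 ∧ (0 < orient a b c → Real.sin β₀ * (dist b a * dist c a) ≤ orient a b c ∧
      dot (b - a) (c - a) ≤ Real.cos β₀ / Real.sin β₀ * orient a b c) := by
  set α := EuclideanGeometry.angle b a c
  have hpi := Real.pi_pos
  have hs : 0 < Real.sin α := Real.sin_pos_of_pos_of_lt_pi (by linarith) (by linarith)
  have hs0 : 0 < Real.sin β₀ := Real.sin_pos_of_pos_of_lt_pi h0 (by linarith)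
  have hp : 0 < dist b a * dist c a := mul_pos (dist_pos.2 hab.symm) (dist_pos.2 hac.symm)
  have hsq := orient_sq a b c
  have hsin : Real.sin β₀ ≤ Real.sin α := by
    rcases le_or_gt α (Real.pi / 2) with h | h
    · exact Real.sin_le_sin_of_le_of_le_pi_div_two (by linarith) h h1.le
    · rw [← Real.sin_pi_sub α]
      exact Real.sin_le_sin_of_le_of_le_pi_div_two (by linarith) (by linarith) (by linarith)
  refine ⟨fun h => ?_, fun h => ?_⟩
  · rw [h] at hsq
    have : 0 < (dist b a * dist c a * Real.sin α) ^ 2 := by positivity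
    linarith
  · have ho : orient a b c = dist b a * dist c a * Real.sin α :=
      (sq_eq_sq₀ h.le (by positivity)).1 hsq
    refine ⟨?_, ?_⟩
    · rw [ho]; nlinarith
    · rw [ho, dot_eq_cos, div_mul_eq_mul_div, le_div_iff₀ hs0]
      have h3 : 0 ≤ Real.sin (α - β₀) :=
        Real.sin_nonneg_of_nonneg_of_le_pi (by linarith) (by linarith)
      rw [Real.sin_sub] at h3
      change _ * Real.cos α * _ ≤ _
      nlinarith

theorem AnglesGT.lt_pi_sub {β₀ : ℝ} {a b c : Plane} (hab : a ≠ b)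
    (h : AnglesGT β₀ a b c) : EuclideanGeometry.angle b a c < Real.pi - 2 * β₀ := by
  have := EuclideanGeometry.angle_add_angle_add_angle_eq_pi c hab.symm
  have h2 := h.2.1
  have h3 := h.2.2
  have e1 := EuclideanGeometry.angle_comm b a c
  have e2 := EuclideanGeometry.angle_comm c b a
  have e3 := EuclideanGeometry.angle_comm a c b
  linarith

theorem AnglesGT.rotate {β₀ : ℝ} {a b c : Plane} (h : AnglesGT β₀ a b c) : AnglesGT β₀ b c a :=
  ⟨h.2.1, h.2.2, h.1⟩

theorem AnglesGT.swap {β₀ : ℝ} {a b c : Plane} (h : AnglesGT β₀ a b c) : AnglesGT β₀ a c b := by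
  unfold AnglesGT at *
  rw [EuclideanGeometry.angle_comm c a b, EuclideanGeometry.angle_comm b c a,
    EuclideanGeometry.angle_comm a b c]
  exact ⟨h.1, h.2.2, h.2.1⟩

theorem AnglesGT.orient_ne {β₀ : ℝ} (h0 : 0 < β₀) {a b c : Plane} (hab : a ≠ b)
    (hac : a ≠ c) (h : AnglesGT β₀ a b c) : orient a b c ≠ 0 :=
  (fat_corner h0 hab hac h.1 (by linarith [h.lt_pi_sub hab])).1

theorem AnglesGT.isFat {β₀ : ℝ} (h0 : 0 < β₀) {a b c : Plane} (hab : a ≠ b)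
    (hac : a ≠ c) (hbc : b ≠ c) (h : AnglesGT β₀ a b c) (hpos : 0 < orient a b c) :
    IsFat (Real.sin β₀) (Real.cos β₀ / Real.sin β₀) a b c := by
  have e1 := orient_rotate a b c
  have e2 := orient_rotate b c a
  have r1 := (fat_corner h0 hab hac h.1 (by linarith [h.lt_pi_sub hab])).2 hpos
  have r2 := (fat_corner h0 hbc hab.symm h.2.1 (by linarith [h.rotate.lt_pi_sub hbc])).2
    (by rwa [e1])
  have r3 := (fat_corner h0 hac.symm hbc.symm h.2.2
    (by linarith [h.rotate.rotate.lt_pi_sub hac.symm])).2 (by rwa [e2, e1])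
  rw [e1] at r2
  rw [e2, e1] at r3
  exact ⟨hpos, r1.1, r2.1, r3.1, r1.2, r2.2, r3.2⟩

/-! ### The power of a point with respect to a circle -/

/-- The power of the point `z` with respect to the circle with centre `o` and radius `r`. -/
def power (o : Plane) (r : ℝ) (z : Plane) : ℝ := dist z o ^ 2 - r ^ 2

/-- The closed disc with centre `o` and radius `r` is the circumscribed disc of `ψ ⊆ φ` and
contains no other point of `φ`. -/
structure IsEmptyDisc (φ : Set Plane) (ψ : Finset Plane) (o : Plane) (r : ℝ) : Prop where
  circle : ∀ x ∈ ψ, dist x o = r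
  inter : φ ∩ Metric.closedBall o r = (ψ : Set Plane)

theorem IsEmptyDisc.power_eq_zero {φ : Set Plane} {ψ : Finset Plane} {o : Plane} {r : ℝ}
    (h : IsEmptyDisc φ ψ o r) {z : Plane} (hz : z ∈ ψ) : power o r z = 0 := by
  rw [power, h.circle z hz, sub_self]

theorem IsEmptyDisc.subset {φ : Set Plane} {ψ : Finset Plane} {o : Plane} {r : ℝ}
    (h : IsEmptyDisc φ ψ o r) {z : Plane} (hz : z ∈ ψ) : z ∈ φ := by
  have : z ∈ φ ∩ Metric.closedBall o r := by rw [h.inter]; exact hz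
  exact this.1

theorem IsEmptyDisc.mem_of_power_nonpos {φ : Set Plane} {ψ : Finset Plane} {o : Plane} {r : ℝ}
    (h : IsEmptyDisc φ ψ o r) (hr : 0 ≤ r) {z : Plane} (hz : z ∈ φ) (hp : power o r z ≤ 0) :
    z ∈ ψ := by
  have : z ∈ φ ∩ Metric.closedBall o r :=
    ⟨hz, Metric.mem_closedBall.2 (abs_le_of_sq_le_sq' (by unfold power at hp; linarith) hr).2⟩
  rw [h.inter] at this
  exact this

theorem IsEmptyDisc.power_nonneg {φ : Set Plane} {ψ : Finset Plane} {o : Plane} {r : ℝ}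
    (h : IsEmptyDisc φ ψ o r) (hr : 0 ≤ r) {z : Plane} (hz : z ∈ φ) : 0 ≤ power o r z := by
  by_contra hlt
  have := h.power_eq_zero (h.mem_of_power_nonpos hr hz (not_le.1 hlt).le)
  exact hlt this.ge

theorem power_nonpos {o : Plane} {r : ℝ} {z : Plane}
    (hz : z ∈ Metric.closedBall o r) : power o r z ≤ 0 := by
  have := pow_le_pow_left₀ dist_nonneg (Metric.mem_closedBall.1 hz) 2
  unfold power; linarith

/-- Differences of powers are affine. -/
theorem power_sub_power (o o' : Plane) (r r' : ℝ) (x z : Plane) :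
    power o r z - power o' r' z =
      power o r x - power o' r' x + dot (z - x) ((2 : ℝ) • (o' - o)) := by
  simp only [power, dist_sq, dot, PiLp.sub_apply, PiLp.smul_apply, smul_eq_mul]
  ring

/-- The power is the squared norm plus an affine function, so the last three terms are its exact
convexity defect for the barycentric weights `1 - s - t`, `s`, `t`. -/
theorem power_convex (o : Plane) (r : ℝ) {x b c a : Plane} {s t : ℝ}
    (h : a - x = s • (b - x) + t • (c - x)) :
    power o r a = (1 - s - t) * power o r x + s * power o r b + t * power o r c
      - (1 - s - t) * s * dist b x ^ 2 - (1 - s - t) * t * dist c x ^ 2 - s * t * dist b c ^ 2 := by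
  have h0 : a 0 = x 0 + s * (b 0 - x 0) + t * (c 0 - x 0) := by
    have := congrArg (fun v : Plane => v 0) h
    simp only [PiLp.sub_apply, PiLp.add_apply, PiLp.smul_apply, smul_eq_mul] at this
    linarith
  have h1 : a 1 = x 1 + s * (b 1 - x 1) + t * (c 1 - x 1) := by
    have := congrArg (fun v : Plane => v 1) h
    simp only [PiLp.sub_apply, PiLp.add_apply, PiLp.smul_apply, smul_eq_mul] at this
    linarith
  simp only [power, dist_sq, dot, PiLp.sub_apply, h0, h1]
  ring

/-- The power minus the squared distance to `x` is affine, and the three determinants are the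
barycentric coordinates of `x` scaled by `orient a b c`; the affine function is evaluated at `x`
through its values at the vertices. -/
theorem orient_mul_power {o : Plane} {r : ℝ} {a b c : Plane} (ha : power o r a = 0)
    (hb : power o r b = 0) (hc : power o r c = 0) (x : Plane) :
    orient a b c * power o r x = -(det (b - x) (c - x) * dist a x ^ 2 +
      det (c - x) (a - x) * dist b x ^ 2 + det (a - x) (b - x) * dist c x ^ 2) := by
  have e : orient a b c * power o r x = -(det (b - x) (c - x) * dist a x ^ 2 +
      det (c - x) (a - x) * dist b x ^ 2 + det (a - x) (b - x) * dist c x ^ 2) +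
      det (b - x) (c - x) * power o r a + det (c - x) (a - x) * power o r b +
      det (a - x) (b - x) * power o r c := by
    simp only [power, orient, det, dist_sq, dot, PiLp.sub_apply]
    ring
  rw [e, ha, hb, hc]; ring

/-- In the cone spanned by two positively oriented vectors. -/
theorem eq_cone {p q v : Plane} (h : det p q ≠ 0) :
    v = (det v q / det p q) • p + (det p v / det p q) • q := by
  ext i
  simp only [PiLp.add_apply, PiLp.smul_apply, smul_eq_mul]
  rw [div_mul_eq_mul_div, div_mul_eq_mul_div, ← add_div, eq_div_iff h]
  fin_cases i <;> simp only [det, Fin.zero_eta, Fin.mk_one] <;> ring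

/-- Two Delaunay triangles of the same configuration with a common vertex and a common interior
direction at that vertex coincide. -/
theorem eq_of_common_direction {φ : Set Plane} {ψ₁ ψ₂ : Finset Plane} {o₁ o₂ : Plane} {r₁ r₂ : ℝ}
    (h₁ : IsEmptyDisc φ ψ₁ o₁ r₁) (h₂ : IsEmptyDisc φ ψ₂ o₂ r₂) (hcard : ψ₁.card = ψ₂.card)
    {x a₁ b₁ a₂ b₂ : Plane} (e₁ : ψ₁ = {x, a₁, b₁}) (e₂ : ψ₂ = {x, a₂, b₂})
    {α₁ γ₁ α₂ γ₂ : ℝ} (hα₁ : 0 < α₁) (hγ₁ : 0 < γ₁) (hα₂ : 0 < α₂) (hγ₂ : 0 < γ₂)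
    (hv : α₁ • (a₁ - x) + γ₁ • (b₁ - x) = α₂ • (a₂ - x) + γ₂ • (b₂ - x)) : ψ₁ = ψ₂ := by
  have x₁ : x ∈ ψ₁ := by simp [e₁]
  have x₂ : x ∈ ψ₂ := by simp [e₂]
  have ha₁ : a₁ ∈ ψ₁ := by simp [e₁]
  have hb₁ : b₁ ∈ ψ₁ := by simp [e₁]
  have ha₂ : a₂ ∈ ψ₂ := by simp [e₂]
  have hb₂ : b₂ ∈ ψ₂ := by simp [e₂]
  have hr₁ : 0 ≤ r₁ := by rw [← h₁.circle x x₁]; exact dist_nonneg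
  have hr₂ : 0 ≤ r₂ := by rw [← h₂.circle x x₂]; exact dist_nonneg
  set w := (2 : ℝ) • (o₂ - o₁) with hw
  -- This linear form of `z - x` is nonpositive at `a₁`, `b₁` and nonnegative at `a₂`, `b₂`, because
  -- the discs are empty. Both signs meet in the common direction, so it vanishes at all four
  -- vertices: `a₁` and `b₁` lie on the second circle.
  have key : ∀ z, power o₁ r₁ z - power o₂ r₂ z = dot (z - x) w := by
    intro z
    rw [power_sub_power o₁ o₂ r₁ r₂ x z, h₁.power_eq_zero x₁, h₂.power_eq_zero x₂]
    ring
  have k1 := key a₁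
  have k2 := key b₁
  have k3 := key a₂
  have k4 := key b₂
  rw [h₁.power_eq_zero ha₁] at k1
  rw [h₁.power_eq_zero hb₁] at k2
  rw [h₂.power_eq_zero ha₂] at k3
  rw [h₂.power_eq_zero hb₂] at k4
  have n1 := h₂.power_nonneg hr₂ (h₁.subset ha₁)
  have n2 := h₂.power_nonneg hr₂ (h₁.subset hb₁)
  have n3 := h₁.power_nonneg hr₁ (h₂.subset ha₂)
  have n4 := h₁.power_nonneg hr₁ (h₂.subset hb₂)
  have hd := congrArg (fun v => dot v w) hv
  have hlin : ∀ (s t : ℝ) (p q : Plane), dot (s • p + t • q) w = s * dot p w + t * dot q w := by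
    intro s t p q
    simp only [dot, PiLp.add_apply, PiLp.smul_apply, smul_eq_mul]; ring
  simp only [hlin] at hd
  have p1 : power o₂ r₂ a₁ = 0 := by
    have t1 := mul_nonneg hα₁.le n1
    have t2 := mul_nonneg hγ₁.le n2
    have t3 := mul_nonneg hα₂.le n3
    have t4 := mul_nonneg hγ₂.le n4
    rw [← k1, ← k2, ← k3, ← k4] at hd
    have : α₁ * power o₂ r₂ a₁ = 0 := by nlinarith
    exact (mul_eq_zero.1 this).resolve_left hα₁.ne'
  have p2 : power o₂ r₂ b₁ = 0 := by
    have t1 := mul_nonneg hα₁.le n1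
    have t2 := mul_nonneg hγ₁.le n2
    have t3 := mul_nonneg hα₂.le n3
    have t4 := mul_nonneg hγ₂.le n4
    rw [← k1, ← k2, ← k3, ← k4] at hd
    have : γ₁ * power o₂ r₂ b₁ = 0 := by nlinarith
    exact (mul_eq_zero.1 this).resolve_left hγ₁.ne'
  refine Finset.eq_of_subset_of_card_le ?_ hcard.ge
  intro z hz
  rw [e₁] at hz
  simp only [Finset.mem_insert, Finset.mem_singleton] at hz
  rcases hz with rfl | rfl | rfl
  · exact x₂
  · exact h₂.mem_of_power_nonpos hr₂ (h₁.subset ha₁) p1.le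
  · exact h₂.mem_of_power_nonpos hr₂ (h₁.subset hb₁) p2.le

/-- Two Delaunay triangles whose circumscribed discs contain `x`, seen from `x` behind the edges
`b c`, coincide if each apex is seen from `x` through the edge of the other one. -/
theorem eq_of_mutual_shadow {φ : Set Plane} {ψ₁ ψ₂ : Finset Plane} {o₁ o₂ : Plane} {r₁ r₂ : ℝ}
    (h₁ : IsEmptyDisc φ ψ₁ o₁ r₁) (h₂ : IsEmptyDisc φ ψ₂ o₂ r₂) (hcard : ψ₁.card = ψ₂.card)
    {x a₁ b₁ c₁ a₂ b₂ c₂ : Plane} (e₁ : ψ₁ = {a₁, b₁, c₁}) (e₂ : ψ₂ = {a₂, b₂, c₂})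
    (hx₂ : power o₂ r₂ x ≤ 0) (hbc₂ : b₂ ≠ c₂)
    (hle : power o₁ r₁ x ≤ power o₂ r₂ x)
    {s t s' t' : ℝ} (hs : 0 < s) (ht : 0 < t)
    (hv : a₁ - x = s • (b₂ - x) + t • (c₂ - x))
    (hv' : a₂ - x = s' • (b₂ - x) + t' • (c₂ - x)) : ψ₁ = ψ₂ := by
  have ha₁ : a₁ ∈ ψ₁ := by simp [e₁]
  have ha₂ : a₂ ∈ ψ₂ := by simp [e₂]
  have hb₂ : b₂ ∈ ψ₂ := by simp [e₂]
  have hc₂ : c₂ ∈ ψ₂ := by simp [e₂]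
  have hr₁ : 0 ≤ r₁ := by rw [← h₁.circle a₁ ha₁]; exact dist_nonneg
  have hr₂ : 0 ≤ r₂ := by rw [← h₂.circle a₂ ha₂]; exact dist_nonneg
  have n1 := h₂.power_nonneg hr₂ (h₁.subset ha₁)
  -- For `s + t ≤ 1`, `a₁` is a point of the triangle `x b₂ c₂` and strict convexity puts it
  -- strictly inside the second disc, which is empty. For `s + t > 1`, the affine power difference,
  -- nonpositive at `x`, gives a vanishing sum of nonnegative terms, so `b₂`, `c₂` and then `a₂` lie
  -- on the first circle.
  rcases le_or_gt (s + t) 1 with hst | hst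
  · exfalso
    have hp := power_convex o₂ r₂ hv
    rw [h₂.power_eq_zero hb₂, h₂.power_eq_zero hc₂] at hp
    have hd : 0 < dist b₂ c₂ := dist_pos.2 hbc₂
    have q1 : 0 < s * t * dist b₂ c₂ ^ 2 := by positivity
    have q0 : 0 ≤ 1 - s - t := by linarith
    have q2 : 0 ≤ (1 - s - t) * s * dist b₂ x ^ 2 := by positivity
    have q3 : 0 ≤ (1 - s - t) * t * dist c₂ x ^ 2 := by positivity
    have q4 : (1 - s - t) * power o₂ r₂ x ≤ 0 := mul_nonpos_of_nonneg_of_nonpos q0 hx₂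
    linarith
  · set w := (2 : ℝ) • (o₂ - o₁) with hw
    set m := power o₁ r₁ x - power o₂ r₂ x with hm
    have key : ∀ z, power o₁ r₁ z - power o₂ r₂ z = m + dot (z - x) w :=
      fun z => power_sub_power o₁ o₂ r₁ r₂ x z
    have hlin : ∀ (s t : ℝ) (p q : Plane), dot (s • p + t • q) w = s * dot p w + t * dot q w := by
      intro s t p q
      simp only [dot, PiLp.add_apply, PiLp.smul_apply, smul_eq_mul]; ring
    have k1 := key a₁
    have k2 := key a₂
    have k3 := key b₂
    have k4 := key c₂
    rw [hv, hlin, h₁.power_eq_zero ha₁] at k1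
    rw [hv', hlin, h₂.power_eq_zero ha₂] at k2
    rw [h₂.power_eq_zero hb₂] at k3
    rw [h₂.power_eq_zero hc₂] at k4
    have n3 := h₁.power_nonneg hr₁ (h₂.subset hb₂)
    have n4 := h₁.power_nonneg hr₁ (h₂.subset hc₂)
    have hm0 : m ≤ 0 := by linarith
    have t3 := mul_nonneg hs.le n3
    have t4 := mul_nonneg ht.le n4
    have t5 : 0 ≤ (1 - s - t) * m := mul_nonneg_of_nonpos_of_nonpos (by linarith) hm0
    have e : s * power o₁ r₁ b₂ + t * power o₁ r₁ c₂ + (1 - s - t) * m + power o₂ r₂ a₁ = 0 := by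
      linear_combination s * k3 + t * k4 - k1
    have z3 : power o₁ r₁ b₂ = 0 := by
      have : s * power o₁ r₁ b₂ = 0 := by linarith
      exact (mul_eq_zero.1 this).resolve_left hs.ne'
    have z4 : power o₁ r₁ c₂ = 0 := by
      have : t * power o₁ r₁ c₂ = 0 := by linarith
      exact (mul_eq_zero.1 this).resolve_left ht.ne'
    have z5 : m = 0 := by
      have : (1 - s - t) * m = 0 := by linarith
      exact (mul_eq_zero.1 this).resolve_left (by linarith)
    have z2 : power o₁ r₁ a₂ = 0 := by
      rw [z3, z5] at k3
      rw [z4, z5] at k4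
      rw [z5] at k2
      have d3 : dot (b₂ - x) w = 0 := by linarith
      have d4 : dot (c₂ - x) w = 0 := by linarith
      rw [d3, d4] at k2
      linarith
    refine (Finset.eq_of_subset_of_card_le ?_ hcard.le).symm
    intro z hz
    have hz' := h₂.subset hz
    rw [e₂] at hz
    simp only [Finset.mem_insert, Finset.mem_singleton] at hz
    rcases hz with rfl | rfl | rfl
    · exact h₁.mem_of_power_nonpos hr₁ hz' z2.le
    · exact h₁.mem_of_power_nonpos hr₁ hz' z3.le
    · exact h₁.mem_of_power_nonpos hr₁ hz' z4.le

/-! ### Uniform bounds on the number of triangles -/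

/-- There is a bound on the size of separated families of unit vectors. -/
theorem exists_card_bound {ε : ℝ} (hε : 0 < ε) : ∃ N : ℕ, ∀ (S : Set (Finset Plane))
    (f : Finset Plane → Plane), (∀ s ∈ S, ‖f s‖ = 1) →
    (∀ s ∈ S, ∀ t ∈ S, ‖f s - f t‖ < ε → s = t) → S.Finite ∧ S.ncard ≤ N := by
  obtain ⟨t, -, htf, hcov⟩ := (isCompact_sphere (0 : Plane) 1).finite_cover_balls (half_pos hε)
  refine ⟨t.ncard, fun S f hf hsep => ?_⟩
  have hex : ∀ s, ∃ y, s ∈ S → y ∈ t ∧ dist (f s) y < ε / 2 := by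
    intro s
    by_cases hs : s ∈ S
    · have h1 : f s ∈ Metric.sphere (0 : Plane) 1 := by simp [hf s hs]
      obtain ⟨y, hy, hy'⟩ := mem_iUnion₂.1 (hcov h1)
      exact ⟨y, fun _ => ⟨hy, hy'⟩⟩
    · exact ⟨0, fun h => absurd h hs⟩
  choose g hg using hex
  have hmaps : MapsTo g S t := fun s hs => (hg s hs).1
  have hinj : InjOn g S := by
    intro s hs s' hs' h
    apply hsep s hs s' hs'
    rw [← dist_eq_norm]
    have h1 := (hg s hs).2
    have h2 := (hg s' hs').2
    rw [← h] at h2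
    linarith [dist_triangle_right (f s) (f s') (g s)]
  exact ⟨htf.of_injOn hmaps hinj, ncard_le_ncard_of_injOn g hmaps hinj htf⟩

/-- The unit vector from `x` to `a`. -/
def dir (x a : Plane) : Plane := ‖a - x‖⁻¹ • (a - x)

theorem norm_dir {x a : Plane} (h : a ≠ x) : ‖dir x a‖ = 1 := by
  rw [dir, norm_smul, norm_inv, norm_norm, inv_mul_cancel₀ (norm_ne_zero_iff.2 (sub_ne_zero.2 h))]

theorem det_dir (x a b : Plane) :
    det (dir x a) (dir x b) = ‖a - x‖⁻¹ * ‖b - x‖⁻¹ * det (a - x) (b - x) := by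
  simp only [det, dir, PiLp.smul_apply, smul_eq_mul]; ring

theorem dot_dir (x a b : Plane) :
    dot (dir x a) (dir x b) = ‖a - x‖⁻¹ * ‖b - x‖⁻¹ * dot (a - x) (b - x) := by
  simp only [dot, dir, PiLp.smul_apply, smul_eq_mul]; ring

theorem det_sub_left (p q v : Plane) : det (p - q) v = det p v - det q v := by
  simp only [det, PiLp.sub_apply]; ring

theorem det_sub_right (p q v : Plane) : det v (p - q) = det v p - det v q := by
  simp only [det, PiLp.sub_apply]; ring

/-- Two wide cones with close first edges have a common interior direction. -/
theorem exists_common_direction {s : ℝ} {p₁ q₁ p₂ q₂ : Plane} (hs : 0 < s)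
    (hq₁ : ‖q₁‖ = 1) (hq₂ : ‖q₂‖ = 1) (h₁ : s ≤ det p₁ q₁) (h₂ : s ≤ det p₂ q₂)
    (hp : ‖p₁ - p₂‖ < s) (h : 0 ≤ det p₁ p₂) :
    ∃ α₁ γ₁ α₂ γ₂ : ℝ, 0 < α₁ ∧ 0 < γ₁ ∧ 0 < α₂ ∧ 0 < γ₂ ∧
      α₁ • p₁ + γ₁ • q₁ = α₂ • p₂ + γ₂ • q₂ := by
  have b1 := abs_le.1 (abs_det_le (p₁ - p₂) q₁)
  have b2 := abs_le.1 (abs_det_le (p₁ - p₂) q₂)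
  have b3 := abs_le.1 (abs_det_le q₂ q₁)
  rw [hq₁, det_sub_left] at b1
  rw [hq₂, det_sub_left] at b2
  rw [hq₁, hq₂] at b3
  have e1 : 0 < det p₂ q₁ := by linarith
  have e2 : 0 < det p₁ q₂ := by linarith
  -- Since `|det q₂ q₁| ≤ 1`, the factor one half keeps `p₂ + t q₂` on the inner side of `q₁`.
  set t := det p₂ q₁ / 2 with ht
  set v := p₂ + t • q₂ with hv
  have v1 : det v q₁ = det p₂ q₁ + t * det q₂ q₁ := by
    simp only [hv, det, PiLp.add_apply, PiLp.smul_apply, smul_eq_mul]; ring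
  have v2 : det p₁ v = det p₁ p₂ + t * det p₁ q₂ := by
    simp only [hv, det, PiLp.add_apply, PiLp.smul_apply, smul_eq_mul]; ring
  have ht0 : 0 < t := by positivity
  have hd : 0 < det p₁ q₁ := by linarith
  refine ⟨det v q₁ / det p₁ q₁, det p₁ v / det p₁ q₁, 1, t, ?_, ?_, one_pos, ht0, ?_⟩
  · apply div_pos _ hd
    rw [v1]; nlinarith
  · apply div_pos _ hd
    rw [v2]; nlinarith [mul_pos ht0 e2]
  · rw [one_smul, ← eq_cone hd.ne']

theorem IsFat.ne {s κ : ℝ} {a b c : Plane} (h : IsFat s κ a b c) : a ≠ b ∧ a ≠ c ∧ b ≠ c := by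
  have := h.pos
  refine ⟨?_, ?_, ?_⟩ <;> rintro rfl <;> simp only [orient, det, PiLp.sub_apply] at this <;>
    ring_nf at this <;> exact lt_irrefl _ this

/-- The triangles of the `β`-Delaunay graph in coordinates. -/
theorem exists_of_mem_betaDel3 {β₀ : ℝ} (h0 : 0 < β₀) {φ : Set Plane} {ψ : Finset Plane}
    (h : ψ ∈ betaDel3 β₀ φ) : ∃ a b c : Plane, ∃ o : Plane, ∃ r : ℝ, ψ = {a, b, c} ∧
      IsFat (Real.sin β₀) (Real.cos β₀ / Real.sin β₀) a b c ∧ IsEmptyDisc φ ψ o r := by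
  obtain ⟨⟨hcard, o, r, hcirc, hinter⟩, hang⟩ := h
  obtain ⟨a, b, c, hab, hac, hbc, rfl⟩ := Finset.card_eq_three.1 hcard
  have hA : AnglesGT β₀ a b c := by
    refine ⟨hang b (by simp) a (by simp) c (by simp) hab.symm hac hbc,
      hang c (by simp) b (by simp) a (by simp) hbc.symm hab.symm hac.symm,
      hang a (by simp) c (by simp) b (by simp) hac hbc.symm hab⟩
  rcases lt_or_gt_of_ne (hA.orient_ne h0 hab hac) with hlt | hgt
  · have e := orient_swap a b c
    refine ⟨a, c, b, o, r, ?_, hA.swap.isFat h0 hac hab hbc.symm (by linarith), hcirc, hinter⟩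
    rw [Finset.pair_comm]
  · exact ⟨a, b, c, o, r, rfl, hA.isFat h0 hab hac hbc hgt, hcirc, hinter⟩

theorem exists_of_mem_betaDel3_of_mem {β₀ : ℝ} (h0 : 0 < β₀) {φ : Set Plane} {ψ : Finset Plane}
    (h : ψ ∈ betaDel3 β₀ φ) {x : Plane} (hx : x ∈ ψ) :
    ∃ a b : Plane, ∃ o : Plane, ∃ r : ℝ, ψ = {x, a, b} ∧
      IsFat (Real.sin β₀) (Real.cos β₀ / Real.sin β₀) x a b ∧ IsEmptyDisc φ ψ o r := by
  obtain ⟨a, b, c, o, r, e, hf, hd⟩ := exists_of_mem_betaDel3 h0 h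
  rw [e] at hx
  simp only [Finset.mem_insert, Finset.mem_singleton] at hx
  rcases hx with rfl | rfl | rfl
  · exact ⟨b, c, o, r, e, hf, hd⟩
  · exact ⟨c, a, o, r, by rw [e]; ext z; simp; tauto, hf.rotate, hd⟩
  · exact ⟨a, b, o, r, by rw [e]; ext z; simp; tauto, hf.rotate.rotate, hd⟩

theorem sin_pos_of_lt {β₀ : ℝ} (h0 : 0 < β₀) (h1 : β₀ < Real.pi / 3) : 0 < Real.sin β₀ :=
  Real.sin_pos_of_pos_of_lt_pi h0 (by linarith [Real.pi_pos])

/-- The number of triangles of the `β`-Delaunay graph with a given vertex is bounded. -/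
theorem exists_bound_vertex {β₀ : ℝ} (h0 : 0 < β₀) (h1 : β₀ < Real.pi / 3) :
    ∃ N : ℕ, ∀ (φ : Set Plane) (x : Plane),
      {ψ ∈ betaDel3 β₀ φ | x ∈ ψ}.Finite ∧ {ψ ∈ betaDel3 β₀ φ | x ∈ ψ}.ncard ≤ N := by
  have hs := sin_pos_of_lt h0 h1
  obtain ⟨N, hN⟩ := exists_card_bound hs
  refine ⟨N, fun φ x => ?_⟩
  have hex : ∀ ψ : Finset Plane, ∃ a b o : Plane, ∃ r : ℝ, ψ ∈ {ψ ∈ betaDel3 β₀ φ | x ∈ ψ} →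
      ψ = {x, a, b} ∧ IsFat (Real.sin β₀) (Real.cos β₀ / Real.sin β₀) x a b ∧
        IsEmptyDisc φ ψ o r := by
    intro ψ
    by_cases h : ψ ∈ {ψ ∈ betaDel3 β₀ φ | x ∈ ψ}
    · obtain ⟨a, b, o, r, h'⟩ := exists_of_mem_betaDel3_of_mem h0 h.1 h.2
      exact ⟨a, b, o, r, fun _ => h'⟩
    · exact ⟨0, 0, 0, 0, fun h' => absurd h' h⟩
  choose a b o r hab using hex
  -- First edges closer than `sin β₀` force the cones of two fat triangles at `x` to overlap. The
  -- first edges of distinct triangles are therefore separated on the unit circle.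
  have key : ∀ ψ₁ ∈ {ψ ∈ betaDel3 β₀ φ | x ∈ ψ}, ∀ ψ₂ ∈ {ψ ∈ betaDel3 β₀ φ | x ∈ ψ},
      ‖dir x (a ψ₁) - dir x (a ψ₂)‖ < Real.sin β₀ →
      0 ≤ det (dir x (a ψ₁)) (dir x (a ψ₂)) → ψ₁ = ψ₂ := by
    intro ψ₁ m₁ ψ₂ m₂ hlt hdet
    obtain ⟨e₁, f₁, d₁⟩ := hab ψ₁ m₁
    obtain ⟨e₂, f₂, d₂⟩ := hab ψ₂ m₂
    have na₁ := f₁.ne.1.symm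
    have nb₁ := f₁.ne.2.1.symm
    have na₂ := f₂.ne.1.symm
    have nb₂ := f₂.ne.2.1.symm
    have hwide : ∀ {a b : Plane}, IsFat (Real.sin β₀) (Real.cos β₀ / Real.sin β₀) x a b →
        Real.sin β₀ ≤ det (dir x a) (dir x b) := by
      intro a b hf
      have pa : 0 < ‖a - x‖ := norm_pos_iff.2 (sub_ne_zero.2 hf.ne.1.symm)
      have pb : 0 < ‖b - x‖ := norm_pos_iff.2 (sub_ne_zero.2 hf.ne.2.1.symm)
      have h := hf.sa
      rw [dist_eq_norm, dist_eq_norm, orient] at h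
      rw [det_dir, ← mul_inv, inv_mul_eq_div, le_div_iff₀ (mul_pos pa pb)]
      exact h
    obtain ⟨α₁, γ₁, α₂, γ₂, p1, p2, p3, p4, hv⟩ := exists_common_direction hs (norm_dir nb₁)
      (norm_dir nb₂) (hwide f₁) (hwide f₂) hlt hdet
    have pos : ∀ {a : Plane}, a ≠ x → 0 < ‖a - x‖⁻¹ := fun h =>
      inv_pos.2 (norm_pos_iff.2 (sub_ne_zero.2 h))
    refine eq_of_common_direction d₁ d₂ (m₁.1.1.1.trans m₂.1.1.1.symm) e₁ e₂
      (mul_pos p1 (pos na₁)) (mul_pos p2 (pos nb₁)) (mul_pos p3 (pos na₂))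
      (mul_pos p4 (pos nb₂)) ?_
    simpa only [dir, smul_smul] using hv
  refine hN _ (fun ψ => dir x (a ψ)) (fun ψ hψ => norm_dir (hab ψ hψ).2.1.ne.1.symm) ?_
  intro ψ₁ m₁ ψ₂ m₂ hlt
  rcases le_total 0 (det (dir x (a ψ₁)) (dir x (a ψ₂))) with h | h
  · exact key ψ₁ m₁ ψ₂ m₂ hlt h
  · refine (key ψ₂ m₂ ψ₁ m₁ (by rwa [norm_sub_rev]) ?_).symm
    have : det (dir x (a ψ₂)) (dir x (a ψ₁)) = -det (dir x (a ψ₁)) (dir x (a ψ₂)) := by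
      simp only [det]; ring
    linarith

/-! ### Triangles whose circumscribed disc contains a new point. -/

/-- A fat triangle whose circumscribed disc contains `x` beyond the edge `b c`: the apex `a` is
seen from `x` in the middle of the edge `b c`. -/
structure IsShadow (s : ℝ) (x a b c : Plane) : Prop where
  na : a ≠ x
  nb : b ≠ x
  nc : c ≠ x
  cone : 0 < det (c - x) (b - x)
  left : s ≤ det (dir x c) (dir x a)
  right : s ≤ det (dir x a) (dir x b)

theorem IsShadow.exists_cone {s : ℝ} {x a b c p : Plane} (h : IsShadow s x a b c)
    (hp : p ≠ x) (hlt : ‖dir x p - dir x a‖ < s) :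
    ∃ t u : ℝ, 0 < t ∧ 0 < u ∧ p - x = t • (b - x) + u • (c - x) := by
  have b1 := abs_le.1 (abs_det_le (dir x c) (dir x p - dir x a))
  have b2 := abs_le.1 (abs_det_le (dir x p - dir x a) (dir x b))
  rw [det_sub_right, norm_dir h.nc] at b1
  rw [det_sub_left, norm_dir h.nb] at b2
  have l1 := h.left
  have l2 := h.right
  have e1 : 0 < det (dir x c) (dir x p) := by linarith
  have e2 : 0 < det (dir x p) (dir x b) := by linarith
  have pp : 0 < ‖p - x‖ := norm_pos_iff.2 (sub_ne_zero.2 hp)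
  have pb : 0 < ‖b - x‖ := norm_pos_iff.2 (sub_ne_zero.2 h.nb)
  have pc : 0 < ‖c - x‖ := norm_pos_iff.2 (sub_ne_zero.2 h.nc)
  rw [det_dir] at e1 e2
  have f1 : 0 < det (c - x) (p - x) := pos_of_mul_pos_right e1 (by positivity)
  have f2 : 0 < det (p - x) (b - x) := pos_of_mul_pos_right e2 (by positivity)
  refine ⟨_, _, div_pos f1 h.cone, div_pos f2 h.cone, ?_⟩
  rw [add_comm]
  exact eq_cone h.cone.ne'

/-- With `D` a sine and `E` a cosine, `|cot| ≤ κ` means `sin² ≥ 1 / (1 + κ²)`. -/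
theorem sin_bound_of_cot {κ s : ℝ} (hs : s ^ 2 * (1 + κ ^ 2) ≤ 1) {D E : ℝ} (hD : 0 < D)
    (h : D ^ 2 + E ^ 2 = 1) (h1 : E ≤ κ * D) (h2 : -(κ * D) ≤ E) : s ≤ D := by
  have : E ^ 2 ≤ (κ * D) ^ 2 := sq_le_sq' h2 h1
  have h3 : 1 ≤ D ^ 2 * (1 + κ ^ 2) := by nlinarith
  apply le_of_sq_le_sq _ hD.le
  have : 0 < 1 + κ ^ 2 := by positivity
  nlinarith

/-- The letters stand for scalar products of plane vectors with `w C = u A + v B`. Convexity of the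
squared norm gives `w² |C|² ≤ (u + v) (u |A|² + v |B|²)`, and `u + v < w` makes this incompatible
with the last hypothesis. -/
theorem weights_contradiction {u v w AA BB CC AB : ℝ} (hu : 0 < u) (hv : 0 ≤ v) (hw : u + v < w)
    (hA : 0 < AA) (hB : 0 ≤ BB) (hAB : 2 * AB ≤ AA + BB)
    (e : w ^ 2 * CC = u ^ 2 * AA + v ^ 2 * BB + 2 * u * v * AB)
    (h : u * AA + v * BB ≤ w * CC) : False := by
  have h1 : 0 ≤ w * (w * CC - (u * AA + v * BB)) := mul_nonneg (by linarith) (by linarith)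
  have h2 : 0 < (w - u - v) * (u * AA + v * BB) :=
    mul_pos (by linarith) (by linarith [mul_pos hu hA, mul_nonneg hv hB])
  have h3 : 0 ≤ u * v * (AA + BB - 2 * AB) := mul_nonneg (mul_nonneg hu.le hv) (by linarith)
  nlinarith

/-- A fat triangle whose circumscribed disc contains `x`, with `x` strictly on the other side of
the edge `b c`. -/
theorem IsFat.isShadow {s κ : ℝ} (hs : s ^ 2 * (1 + κ ^ 2) ≤ 1)
    {a b c x o : Plane} {r : ℝ} (hf : IsFat s κ a b c)
    (ha : power o r a = 0) (hb : power o r b = 0) (hc : power o r c = 0)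
    (hx : power o r x ≤ 0) (na : a ≠ x) (nb : b ≠ x) (nc : c ≠ x)
    (hneg : det (b - x) (c - x) < 0) : IsShadow s x a b c := by
  set A := a - x with hA
  set B := b - x with hB
  set C := c - x with hC
  have pA : 0 < ‖A‖ := norm_pos_iff.2 (sub_ne_zero.2 na)
  have pB : 0 < ‖B‖ := norm_pos_iff.2 (sub_ne_zero.2 nb)
  have pC : 0 < ‖C‖ := norm_pos_iff.2 (sub_ne_zero.2 nc)
  have hpos := hf.pos
  have hsum : det B C + det C A + det A B = orient a b c := by
    simp only [hA, hB, hC, orient, det, PiLp.sub_apply]; ring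
  have hpow := orient_mul_power ha hb hc x
  rw [dist_eq_norm, dist_eq_norm, dist_eq_norm, ← hA, ← hB, ← hC] at hpow
  have hle : orient a b c * power o r x ≤ 0 := mul_nonpos_of_nonneg_of_nonpos hpos.le hx
  rw [← dot_self, ← dot_self, ← dot_self] at hpow
  -- Inscribed angles: the cotangent of the angle under which `x` sees `c a` is the cotangent at `b`
  -- plus the power of `x` divided by `det C A`. Inside the disc the angle can only be larger.
  have hC1 : dot A C * orient a b c = orient a b c * power o r x +
      dot (c - b) (a - b) * det C A := by
    rw [hpow]
    simp only [hA, hB, hC, orient, det, dot, PiLp.sub_apply]; ring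
  have hB1 : dot A B * orient a b c = orient a b c * power o r x +
      dot (a - c) (b - c) * det A B := by
    rw [hpow]
    simp only [hA, hB, hC, orient, det, dot, PiLp.sub_apply]; ring
  have sA : 0 < dot A A := by rw [dot_self]; positivity
  have sB : 0 < dot B B := by rw [dot_self]; positivity
  have sC : 0 < dot C C := by rw [dot_self]; positivity
  -- If one sign were wrong, `c` or `b` would lie in the triangle formed by `x` and the two other
  -- vertices, off the side opposite to `x`, hence strictly inside the circle that carries it.
  have hCA : 0 < det C A ∧ 0 < det A B := by
    have hsumnn : 0 ≤ det B C * dot A A + det C A * dot B B + det A B * dot C C := by linarith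
    constructor
    · by_contra hcon
      refine weights_contradiction (u := -det B C) (v := -det C A) (w := det A B) (by linarith)
        (by linarith) (by linarith) sA sB.le (AB := dot A B) ?_ (CC := dot C C) ?_ (by linarith)
      · have h2 : 0 ≤ dot (A - B) (A - B) := by rw [dot_self]; positivity
        have e : dot (A - B) (A - B) = dot A A + dot B B - 2 * dot A B := by
          simp only [dot, PiLp.sub_apply]; ring
        linarith
      · simp only [dot, det]; ring
    · by_contra hcon
      refine weights_contradiction (u := -det B C) (v := -det A B) (w := det C A) (by linarith)
        (by linarith) (by linarith) sA sC.le (AB := dot A C) ?_ (CC := dot B B) ?_ (by linarith)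
      · have h2 : 0 ≤ dot (A - C) (A - C) := by rw [dot_self]; positivity
        have e : dot (A - C) (A - C) = dot A A + dot C C - 2 * dot A C := by
          simp only [dot, PiLp.sub_apply]; ring
        linarith
      · simp only [dot, det]; ring
  obtain ⟨hCA, hAB⟩ := hCA
  have hcone : 0 < det C B := by
    have : det C B = -det B C := by simp only [det]; ring
    linarith
  have kc : dot A C ≤ κ * det C A := by
    have h := mul_le_mul_of_nonneg_right hf.kb hCA.le
    refine le_of_mul_le_mul_right ?_ hpos
    linarith
  have kb : dot A B ≤ κ * det A B := by
    have h := mul_le_mul_of_nonneg_right hf.kc hAB.le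
    refine le_of_mul_le_mul_right ?_ hpos
    linarith
  -- Sine of a sum: as `det C B > 0`, the cotangents of the two angles at `x` have a positive sum,
  -- so the upper bound `κ` for one is the lower bound `-κ` for the other.
  have hadd : det C B * dot A A = det C A * dot A B + dot A C * det A B := by
    simp only [dot, det]; ring
  have hadd' := mul_pos hcone sA
  have mc : -(κ * det C A) ≤ dot A C := by
    by_contra hlt
    linarith [mul_le_mul_of_nonneg_left kb hCA.le, mul_lt_mul_of_pos_right (not_le.1 hlt) hAB]
  have mb : -(κ * det A B) ≤ dot A B := by
    by_contra hlt
    linarith [mul_le_mul_of_nonneg_right kc hAB.le, mul_lt_mul_of_pos_left (not_le.1 hlt) hCA]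
  have sinb : ∀ {p q : Plane}, p ≠ x → q ≠ x → 0 < det (p - x) (q - x) →
      dot (p - x) (q - x) ≤ κ * det (p - x) (q - x) →
      -(κ * det (p - x) (q - x)) ≤ dot (p - x) (q - x) → s ≤ det (dir x p) (dir x q) := by
    intro p q hp hq h1 h2 h3
    have np : 0 < ‖p - x‖ := norm_pos_iff.2 (sub_ne_zero.2 hp)
    have nq : 0 < ‖q - x‖ := norm_pos_iff.2 (sub_ne_zero.2 hq)
    have hn : 0 < ‖p - x‖⁻¹ * ‖q - x‖⁻¹ := by positivity
    refine sin_bound_of_cot hs (D := det (dir x p) (dir x q)) (E := dot (dir x p) (dir x q))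
      ?_ ?_ ?_ ?_
    · rw [det_dir]; positivity
    · rw [det_sq_add_dot_sq, norm_dir hp, norm_dir hq]; norm_num
    · rw [det_dir, dot_dir, mul_left_comm]
      exact mul_le_mul_of_nonneg_left h2 hn.le
    · rw [det_dir, dot_dir, mul_left_comm, ← mul_neg]
      exact mul_le_mul_of_nonneg_left h3 hn.le
  have comm : ∀ p q : Plane, dot p q = dot q p := fun p q => by simp only [dot]; ring
  refine ⟨na, nb, nc, hcone, sinb nc na hCA ?_ ?_, sinb na nb hAB kb mb⟩
  · rw [comm]; exact kc
  · rw [comm]; exact mc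

theorem barycentric_power (o o' : Plane) (r r' : ℝ) (a b c x : Plane) :
    det (b - x) (c - x) * (power o r a - power o' r' a) +
      det (c - x) (a - x) * (power o r b - power o' r' b) +
      det (a - x) (b - x) * (power o r c - power o' r' c) =
      orient a b c * (power o r x - power o' r' x) := by
  simp only [power, orient, det, dist_sq, dot, PiLp.sub_apply]
  ring

/-- Triangles of the `β`-Delaunay graph whose circumscribed disc contains `x`. -/
def discTriangles (β₀ : ℝ) (φ : Set Plane) (x : Plane) : Set (Finset Plane) :=
  {ψ ∈ betaDel3 β₀ φ | ∃ o r, IsEmptyDisc φ ψ o r ∧ x ∈ Metric.closedBall o r}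

/-- The three determinants add up to `orient a b c > 0`. After a cyclic renaming, either the first
one is negative, or all are nonnegative and the first is positive. -/
theorem exists_of_mem_discTriangles {β₀ : ℝ} (h0 : 0 < β₀) {φ : Set Plane} {x : Plane}
    {ψ : Finset Plane} (h : ψ ∈ discTriangles β₀ φ x) :
    ∃ a b c : Plane, ∃ o : Plane, ∃ r : ℝ, ψ = {a, b, c} ∧
      IsFat (Real.sin β₀) (Real.cos β₀ / Real.sin β₀) a b c ∧ IsEmptyDisc φ ψ o r ∧
      x ∈ Metric.closedBall o r ∧ (det (b - x) (c - x) < 0 ∨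
        (0 < det (b - x) (c - x) ∧ 0 ≤ det (c - x) (a - x) ∧ 0 ≤ det (a - x) (b - x))) := by
  obtain ⟨h3, o, r, hd, hx⟩ := h
  obtain ⟨a, b, c, -, -, e, hf, -⟩ := exists_of_mem_betaDel3 h0 h3
  have hpos := hf.pos
  have hsum : det (b - x) (c - x) + det (c - x) (a - x) + det (a - x) (b - x) = orient a b c := by
    simp only [orient, det, PiLp.sub_apply]; ring
  have e2 : ψ = {b, c, a} := by rw [e]; ext z; simp; tauto
  have e3 : ψ = {c, a, b} := by rw [e]; ext z; simp; tauto
  rcases lt_or_ge (det (b - x) (c - x)) 0 with h1 | h1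
  · exact ⟨a, b, c, o, r, e, hf, hd, hx, Or.inl h1⟩
  rcases lt_or_ge (det (c - x) (a - x)) 0 with h2 | h2
  · exact ⟨b, c, a, o, r, e2, hf.rotate, hd, hx, Or.inl h2⟩
  rcases lt_or_ge (det (a - x) (b - x)) 0 with h3 | h3
  · exact ⟨c, a, b, o, r, e3, hf.rotate.rotate, hd, hx, Or.inl h3⟩
  rcases h1.lt_or_eq with h1' | h1'
  · exact ⟨a, b, c, o, r, e, hf, hd, hx, Or.inr ⟨h1', h2, h3⟩⟩
  rcases h2.lt_or_eq with h2' | h2'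
  · exact ⟨b, c, a, o, r, e2, hf.rotate, hd, hx, Or.inr ⟨h2', h3, h1⟩⟩
  · exact ⟨c, a, b, o, r, e3, hf.rotate.rotate, hd, hx, Or.inr ⟨by linarith, h1, h2⟩⟩

/-- The number of triangles of the `β`-Delaunay graph whose circumscribed disc contains a given
point is bounded. -/
theorem exists_bound_disc {β₀ : ℝ} (h0 : 0 < β₀) (h1 : β₀ < Real.pi / 3) :
    ∃ N : ℕ, ∀ (φ : Set Plane) (x : Plane), x ∉ φ →
      (discTriangles β₀ φ x).Finite ∧ (discTriangles β₀ φ x).ncard ≤ N := by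
  have hs := sin_pos_of_lt h0 h1
  obtain ⟨N₁, hN₁⟩ := exists_bound_vertex h0 h1
  obtain ⟨N₂, hN₂⟩ := exists_card_bound hs
  refine ⟨N₁ + N₂, fun φ x hx => ?_⟩
  set K₁ : Set (Finset Plane) := {ψ ∈ betaDel3 β₀ φ | ∃ a b c o : Plane, ∃ r : ℝ,
    ψ = {a, b, c} ∧ IsFat (Real.sin β₀) (Real.cos β₀ / Real.sin β₀) a b c ∧
    IsEmptyDisc φ ψ o r ∧
    0 < det (b - x) (c - x) ∧ 0 ≤ det (c - x) (a - x) ∧ 0 ≤ det (a - x) (b - x)} with hK₁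
  set K₂ : Set (Finset Plane) := {ψ ∈ betaDel3 β₀ φ | ∃ a b c o : Plane, ∃ r : ℝ,
    ψ = {a, b, c} ∧ IsFat (Real.sin β₀) (Real.cos β₀ / Real.sin β₀) a b c ∧
    IsEmptyDisc φ ψ o r ∧ x ∈ Metric.closedBall o r ∧ det (b - x) (c - x) < 0} with hK₂
  have hsub : discTriangles β₀ φ x ⊆ K₁ ∪ K₂ := by
    intro ψ hψ
    obtain ⟨a, b, c, o, r, e, hf, hd, hxo, h | h⟩ := exists_of_mem_discTriangles h0 hψ
    · exact Or.inr ⟨hψ.1, a, b, c, o, r, e, hf, hd, hxo, h⟩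
    · exact Or.inl ⟨hψ.1, a, b, c, o, r, e, hf, hd, h⟩
  have f₁ : K₁.Finite ∧ K₁.ncard ≤ N₁ := by
    rcases K₁.eq_empty_or_nonempty with h | ⟨ψ₁, hψ₁⟩
    · rw [h]; simp
    obtain ⟨h3, a, b, c, o, r, e, hf, hd, p1, p2, p3⟩ := hψ₁
    -- The power difference at `x` is a barycentric average over the vertices of either triangle:
    -- nonpositive for one, nonnegative for the other. So all terms vanish, and the positive weight
    -- at `a` puts `a` on the second circle.
    have hK : K₁ ⊆ {ψ ∈ betaDel3 β₀ φ | a ∈ ψ} := by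
      rintro ψ₂ ⟨h3', a', b', c', o', r', e', hf', hd', p1', p2', p3'⟩
      refine ⟨h3', ?_⟩
      have ha : a ∈ ψ₁ := by simp [e]
      have hb : b ∈ ψ₁ := by simp [e]
      have hc : c ∈ ψ₁ := by simp [e]
      have ha' : a' ∈ ψ₂ := by simp [e']
      have hb' : b' ∈ ψ₂ := by simp [e']
      have hc' : c' ∈ ψ₂ := by simp [e']
      have hr : 0 ≤ r := by rw [← hd.circle a ha]; exact dist_nonneg
      have hr' : 0 ≤ r' := by rw [← hd'.circle a' ha']; exact dist_nonneg
      have q := barycentric_power o o' r r' a b c x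
      have q' := barycentric_power o o' r r' a' b' c' x
      rw [hd.power_eq_zero ha, hd.power_eq_zero hb, hd.power_eq_zero hc] at q
      rw [hd'.power_eq_zero ha', hd'.power_eq_zero hb', hd'.power_eq_zero hc'] at q'
      have na := hd'.power_nonneg hr' (hd.subset ha)
      have nb := hd'.power_nonneg hr' (hd.subset hb)
      have nc := hd'.power_nonneg hr' (hd.subset hc)
      have na' := hd.power_nonneg hr (hd'.subset ha')
      have nb' := hd.power_nonneg hr (hd'.subset hb')
      have nc' := hd.power_nonneg hr (hd'.subset hc')
      have m1 := mul_nonneg p1.le na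
      have m2 := mul_nonneg p2 nb
      have m3 := mul_nonneg p3 nc
      have m1' := mul_nonneg p1'.le na'
      have m2' := mul_nonneg p2' nb'
      have m3' := mul_nonneg p3' nc'
      have hfx : 0 ≤ power o r x - power o' r' x := by
        refine nonneg_of_mul_nonneg_right (a := orient a' b' c') ?_ hf'.pos
        linarith
      have hfx' := mul_nonneg hf.pos.le hfx
      have hz : det (b - x) (c - x) * power o' r' a = 0 := by linarith
      exact hd'.mem_of_power_nonpos hr' (hd.subset ha)
        ((mul_eq_zero.1 hz).resolve_left p1.ne').le
    exact ⟨(hN₁ φ a).1.subset hK, (ncard_le_ncard hK (hN₁ φ a).1).trans (hN₁ φ a).2⟩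
  have f₂ : K₂.Finite ∧ K₂.ncard ≤ N₂ := by
    have hcot : Real.sin β₀ ^ 2 * (1 + (Real.cos β₀ / Real.sin β₀) ^ 2) ≤ 1 := by
      have := Real.sin_sq_add_cos_sq β₀
      rw [div_pow, mul_add, mul_div_cancel₀ _ (by positivity)]
      linarith
    have hex : ∀ ψ : Finset Plane, ∃ a b c o : Plane, ∃ r : ℝ, ψ ∈ K₂ →
        ψ = {a, b, c} ∧ IsEmptyDisc φ ψ o r ∧ x ∈ Metric.closedBall o r ∧
          IsShadow (Real.sin β₀) x a b c ∧ b ≠ c := by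
      intro ψ
      by_cases h : ψ ∈ K₂
      · obtain ⟨h3, a, b, c, o, r, e, hf, hd, hxo, hneg⟩ := h
        have ha : a ∈ ψ := by simp [e]
        have hb : b ∈ ψ := by simp [e]
        have hc : c ∈ ψ := by simp [e]
        refine ⟨a, b, c, o, r, fun _ => ⟨e, hd, hxo, ?_, hf.ne.2.2⟩⟩
        exact hf.isShadow hcot (hd.power_eq_zero ha) (hd.power_eq_zero hb) (hd.power_eq_zero hc)
          (power_nonpos hxo) (fun h => hx (h ▸ hd.subset ha)) (fun h => hx (h ▸ hd.subset hb))
          (fun h => hx (h ▸ hd.subset hc)) hneg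
      · exact ⟨0, 0, 0, 0, 0, fun h' => absurd h' h⟩
    choose a b c o r hab using hex
    -- In each pair, the triangle whose circle gives `x` the smaller power plays the first role in
    -- `eq_of_mutual_shadow`.
    have key : ∀ ψ₁ ∈ K₂, ∀ ψ₂ ∈ K₂, ‖dir x (a ψ₁) - dir x (a ψ₂)‖ < Real.sin β₀ →
        power (o ψ₁) (r ψ₁) x ≤ power (o ψ₂) (r ψ₂) x → ψ₁ = ψ₂ := by
      intro ψ₁ m₁ ψ₂ m₂ hlt hle
      obtain ⟨e₁, d₁, -, s₁, -⟩ := hab ψ₁ m₁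
      obtain ⟨e₂, d₂, x₂, s₂, n₂⟩ := hab ψ₂ m₂
      obtain ⟨s, t, hs', ht, hv⟩ := s₂.exists_cone s₁.na hlt
      obtain ⟨s', t', -, -, hv'⟩ := s₂.exists_cone s₂.na (by simpa using hs)
      exact eq_of_mutual_shadow d₁ d₂ (m₁.1.1.1.trans m₂.1.1.1.symm) e₁ e₂ (power_nonpos x₂)
        n₂ hle hs' ht hv hv'
    refine hN₂ _ (fun ψ => dir x (a ψ)) (fun ψ hψ => norm_dir (hab ψ hψ).2.2.2.1.na) ?_
    intro ψ₁ m₁ ψ₂ m₂ hlt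
    rcases le_total (power (o ψ₁) (r ψ₁) x) (power (o ψ₂) (r ψ₂) x) with h | h
    · exact key ψ₁ m₁ ψ₂ m₂ hlt h
    · exact (key ψ₂ m₂ ψ₁ m₁ (by rwa [norm_sub_rev]) h).symm
  refine ⟨(f₁.1.union f₂.1).subset hsub, ?_⟩
  calc (discTriangles β₀ φ x).ncard ≤ (K₁ ∪ K₂).ncard := ncard_le_ncard hsub (f₁.1.union f₂.1)
    _ ≤ K₁.ncard + K₂.ncard := ncard_union_le _ _
    _ ≤ N₁ + N₂ := add_le_add f₁.2 f₂.2

/-! ### Edges that appear or disappear with a new point -/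

/-- The empty disc of a triangle without the vertex `x` cannot contain `x`, so removing `x` does not
affect it. -/
theorem betaDel3_of_insert {β₀ : ℝ} {φ : Set Plane} {x : Plane} {ψ : Finset Plane}
    (h : ψ ∈ betaDel3 β₀ ({x} ∪ φ)) (hx : x ∉ ψ) : ψ ∈ betaDel3 β₀ φ := by
  obtain ⟨⟨hcard, o, r, hc, hi⟩, hang⟩ := h
  refine ⟨⟨hcard, o, r, hc, ?_⟩, hang⟩
  rw [← hi]
  apply Subset.antisymm (inter_subset_inter_left _ subset_union_right)
  rintro z ⟨hz | hz, hz'⟩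
  · exfalso
    rw [mem_singleton_iff] at hz
    have : z ∈ ({x} ∪ φ) ∩ Metric.closedBall o r := ⟨Or.inl hz, hz'⟩
    rw [hi, hz] at this
    exact hx this
  · exact ⟨hz, hz'⟩

theorem mem_discTriangles_of_notMem {β₀ : ℝ} {φ : Set Plane} {x : Plane} {ψ : Finset Plane}
    (h : ψ ∈ betaDel3 β₀ φ) (h' : ψ ∉ betaDel3 β₀ ({x} ∪ φ)) : ψ ∈ discTriangles β₀ φ x := by
  obtain ⟨⟨hcard, o, r, hc, hi⟩, hang⟩ := h
  refine ⟨⟨⟨hcard, o, r, hc, hi⟩, hang⟩, o, r, ⟨hc, hi⟩, ?_⟩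
  by_contra hx
  apply h'
  refine ⟨⟨hcard, o, r, hc, ?_⟩, hang⟩
  rw [← hi, union_inter_distrib_right, singleton_inter_eq_empty.2 hx, empty_union]

/-- Pairs of vertices of a family of triangles. -/
def pairsOf (S : Set (Finset Plane)) : Set (Finset Plane) := {ξ | ∃ ψ ∈ S, ξ ⊆ ψ}

theorem pairsOf_bound {S : Set (Finset Plane)} (hS : S.Finite) (h3 : ∀ ψ ∈ S, ψ.card = 3) :
    (pairsOf S).Finite ∧ (pairsOf S).ncard ≤ 8 * S.ncard := by
  classical
  set F := hS.toFinset
  have e : pairsOf S = (F.biUnion Finset.powerset : Finset (Finset Plane)) := by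
    ext ξ; simp [pairsOf, F]
  rw [e, ncard_coe_finset, ncard_eq_toFinset_card S hS]
  refine ⟨Finset.finite_toSet _, ?_⟩
  rw [mul_comm]
  refine Finset.card_biUnion_le_card_mul _ _ _ fun ψ hψ => ?_
  rw [Finset.card_powerset, h3 ψ (by simpa [F] using hψ)]
  norm_num

theorem edges_appear_subset {β₀ s t : ℝ} {φ : Set Plane} {x : Plane} :
    edgesIoc β₀ s t ({x} ∪ φ) \ edgesIoc β₀ s t φ ⊆
      pairsOf {ψ ∈ betaDel3 β₀ ({x} ∪ φ) | x ∈ ψ} := by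
  rintro ξ ⟨⟨⟨hc, ψ, hψ, hsub⟩, hl⟩, hn⟩
  refine ⟨ψ, ⟨hψ, ?_⟩, hsub⟩
  by_contra hx
  exact hn ⟨⟨hc, ψ, betaDel3_of_insert hψ hx, hsub⟩, hl⟩

theorem edges_disappear_subset {β₀ s t : ℝ} {φ : Set Plane} {x : Plane} :
    edgesIoc β₀ s t φ \ edgesIoc β₀ s t ({x} ∪ φ) ⊆ pairsOf (discTriangles β₀ φ x) := by
  rintro ξ ⟨⟨⟨hc, ψ, hψ, hsub⟩, hl⟩, hn⟩
  refine ⟨ψ, mem_discTriangles_of_notMem hψ fun h => ?_, hsub⟩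
  exact hn ⟨⟨hc, ψ, h, hsub⟩, hl⟩

/-- Adding one point changes a bounded number of edges. -/
theorem exists_bound_edges {β₀ : ℝ} (h0 : 0 < β₀) (h1 : β₀ < Real.pi / 3) :
    ∃ N : ℕ, ∀ (φ : Set Plane) (x : Plane) (s t : ℝ),
      ((edgesIoc β₀ s t ({x} ∪ φ) \ edgesIoc β₀ s t φ).Finite ∧
        (edgesIoc β₀ s t ({x} ∪ φ) \ edgesIoc β₀ s t φ).ncard ≤ N) ∧
      ((edgesIoc β₀ s t φ \ edgesIoc β₀ s t ({x} ∪ φ)).Finite ∧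
        (edgesIoc β₀ s t φ \ edgesIoc β₀ s t ({x} ∪ φ)).ncard ≤ N) := by
  obtain ⟨N₁, hN₁⟩ := exists_bound_vertex h0 h1
  obtain ⟨N₂, hN₂⟩ := exists_bound_disc h0 h1
  refine ⟨8 * (N₁ + N₂), fun φ x s t => ?_⟩
  by_cases hx : x ∈ φ
  · rw [union_eq_self_of_subset_left (singleton_subset_iff.2 hx)]
    simp
  have v := hN₁ ({x} ∪ φ) x
  have w := hN₂ φ x hx
  have pv := pairsOf_bound v.1 fun ψ hψ => hψ.1.1.1
  have pw := pairsOf_bound w.1 fun ψ hψ => hψ.1.1.1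
  refine ⟨⟨pv.1.subset edges_appear_subset, ?_⟩, ⟨pw.1.subset edges_disappear_subset, ?_⟩⟩
  · have := ncard_le_ncard (edges_appear_subset (β₀ := β₀) (s := s) (t := t) (φ := φ) (x := x)) pv.1
    omega
  · have := ncard_le_ncard (edges_disappear_subset (β₀ := β₀) (s := s) (t := t) (φ := φ) (x := x))
      pw.1
    omega

/-! ### Additivity of the increments -/

/-- The sets themselves may be infinite. On a finite set containing both differences, the signed
count becomes a difference of two cardinals, and such differences telescope. -/
theorem ncard_diff_sub_of_finite {α : Type*} {A B F : Set α} (hF : F.Finite) (h1 : A \ B ⊆ F)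
    (h2 : B \ A ⊆ F) : ((A \ B).ncard : ℝ) - (B \ A).ncard = (A ∩ F).ncard - (B ∩ F).ncard := by
  have e1 : A \ B = (A ∩ F) \ (B ∩ F) := by
    ext z
    have := @h1 z
    simp only [mem_sdiff, mem_inter_iff] at *
    tauto
  have e2 : B \ A = (B ∩ F) \ (A ∩ F) := by
    ext z
    have := @h2 z
    simp only [mem_sdiff, mem_inter_iff] at *
    tauto
  have fA : (A ∩ F).Finite := hF.inter_of_right A
  have fB : (B ∩ F).Finite := hF.inter_of_right B
  have q1 := ncard_inter_add_ncard_sdiff_eq_ncard (A ∩ F) (B ∩ F) fA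
  have q2 := ncard_inter_add_ncard_sdiff_eq_ncard (B ∩ F) (A ∩ F) fB
  rw [inter_comm (B ∩ F)] at q2
  rw [e1, e2, ← q1, ← q2]
  push_cast
  ring

theorem ncard_diff_sub_cocycle {α : Type*} {A B C : Set α} (h1 : (A \ B).Finite)
    (h2 : (B \ A).Finite) (h3 : (B \ C).Finite) (h4 : (C \ B).Finite) :
    ((A \ C).ncard : ℝ) - (C \ A).ncard =
      (((B \ C).ncard : ℝ) - (C \ B).ncard) + (((A \ B).ncard : ℝ) - (B \ A).ncard) := by
  set F := (A \ B) ∪ (B \ A) ∪ ((B \ C) ∪ (C \ B)) with hF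
  have fin : F.Finite := (h1.union h2).union (h3.union h4)
  rw [ncard_diff_sub_of_finite fin (A := A) (B := C), ncard_diff_sub_of_finite fin (A := B) (B := C),
    ncard_diff_sub_of_finite fin (A := A) (B := B)]
  · ring
  all_goals
    intro z hz
    simp only [hF, mem_union, mem_sdiff] at *
    tauto

section Energy

variable {β₀ : ℝ} (h0 : 0 < β₀) (h1 : β₀ < Real.pi / 3)
include h0 h1

theorem edges_diff_finite {s t : ℝ} {ψ : Set Plane} (hψ : ψ.Finite) (φ : Set Plane) :
    (edgesIoc β₀ s t (ψ ∪ φ) \ edgesIoc β₀ s t φ).Finite ∧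
      (edgesIoc β₀ s t φ \ edgesIoc β₀ s t (ψ ∪ φ)).Finite := by
  obtain ⟨N, hN⟩ := exists_bound_edges h0 h1
  induction ψ, hψ using Set.Finite.induction_on with
  | empty => simp
  | @insert a ψ ha hψ ih =>
    have h := hN (ψ ∪ φ) a s t
    rw [insert_eq, union_assoc]
    refine ⟨(h.1.1.union ih.1).subset ?_, (h.2.1.union ih.2).subset ?_⟩
    · intro ξ hξ
      simp only [mem_union, mem_sdiff] at *
      tauto
    · intro ξ hξ
      simp only [mem_union, mem_sdiff] at *
      tauto

variable {p : ℕ} (d θ : Fin (p + 1) → ℝ)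

/-- Points can be added one at a time. Finiteness of all edge differences is essential here, since
`ncard` is `0` on infinite sets. The resulting additivity of the energy gives both the stability
bound and the factorization in the Georgii-Nguyen-Zessin formula. -/
theorem u_insert {ψ : Set Plane} (hψ : ψ.Finite) (φ : Set Plane) (x : Plane) (k : Fin (p + 1)) :
    u β₀ d ({x} ∪ ψ) φ k = u β₀ d ψ φ k + u β₀ d {x} (ψ ∪ φ) k := by
  refine Fin.cases ?_ (fun k => ?_) k
  · simp only [u, Fin.cons_zero]
    have e : ({x} ∪ ψ) \ φ = (ψ \ φ) ∪ ({x} \ (ψ ∪ φ)) := by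
      ext z; simp only [mem_sdiff, mem_union, mem_singleton_iff]; tauto
    rw [e, ncard_union_eq _ (hψ.subset sdiff_subset) ((finite_singleton x).subset sdiff_subset)]
    · push_cast; ring
    · rw [disjoint_left]
      rintro z ⟨hz, -⟩ ⟨-, hz'⟩
      exact hz' (Or.inl hz)
  · simp only [u, Fin.cons_succ]
    rw [union_assoc]
    have a := edges_diff_finite h0 h1 (s := d k.castSucc) (t := d k.succ) hψ φ
    have b := edges_diff_finite h0 h1 (s := d k.castSucc) (t := d k.succ) (finite_singleton x) (ψ ∪ φ)
    exact ncard_diff_sub_cocycle b.1 b.2 a.1 a.2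

theorem V_insert {ψ : Set Plane} (hψ : ψ.Finite) (φ : Set Plane) (x : Plane) :
    V β₀ d θ ({x} ∪ ψ) φ = V β₀ d θ ψ φ + V β₀ d θ {x} (ψ ∪ φ) := by
  simp only [V, ← Finset.sum_add_distrib, ← mul_add]
  refine Finset.sum_congr rfl fun k _ => ?_
  rw [u_insert h0 h1 d hψ]

theorem exists_bound_u : ∃ K : ℝ, 0 < K ∧ ∀ (x : Plane) (φ : Set Plane) (k : Fin (p + 1)),
    |u β₀ d {x} φ k| ≤ K := by
  obtain ⟨N, hN⟩ := exists_bound_edges h0 h1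
  refine ⟨N + 1, by positivity, fun x φ k => ?_⟩
  refine Fin.cases ?_ (fun k => ?_) k
  · simp only [u, Fin.cons_zero]
    have : ({x} \ φ).ncard ≤ 1 := by
      have := ncard_le_ncard (sdiff_subset : {x} \ φ ⊆ {x})
      simpa using this
    have h2 : (({x} \ φ).ncard : ℝ) ≤ 1 := by exact_mod_cast this
    rw [abs_of_nonneg (by positivity)]
    have : (0 : ℝ) ≤ N := by positivity
    linarith
  · simp only [u, Fin.cons_succ]
    have h := hN φ x (d k.castSucc) (d k.succ)
    have a : ((edgesIoc β₀ (d k.castSucc) (d k.succ) ({x} ∪ φ) \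
        edgesIoc β₀ (d k.castSucc) (d k.succ) φ).ncard : ℝ) ≤ N := by exact_mod_cast h.1.2
    have b : ((edgesIoc β₀ (d k.castSucc) (d k.succ) φ \
        edgesIoc β₀ (d k.castSucc) (d k.succ) ({x} ∪ φ)).ncard : ℝ) ≤ N := by exact_mod_cast h.2.2
    have c : (0 : ℝ) ≤ (edgesIoc β₀ (d k.castSucc) (d k.succ) ({x} ∪ φ) \
        edgesIoc β₀ (d k.castSucc) (d k.succ) φ).ncard := by positivity
    have e : (0 : ℝ) ≤ (edgesIoc β₀ (d k.castSucc) (d k.succ) φ \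
        edgesIoc β₀ (d k.castSucc) (d k.succ) ({x} ∪ φ)).ncard := by positivity
    rw [abs_le]
    constructor <;> linarith

theorem exists_bound_V : ∃ K : ℝ, 0 < K ∧ ∀ (x : Plane) (φ : Set Plane),
    |V β₀ d θ {x} φ| ≤ K := by
  obtain ⟨K, hK, hb⟩ := exists_bound_u h0 h1 d
  refine ⟨∑ k, |θ k| * K + 1, by positivity, fun x φ => ?_⟩
  calc |V β₀ d θ {x} φ| ≤ ∑ k, |θ k * u β₀ d {x} φ k| := Finset.abs_sum_le_sum_abs _ _
    _ ≤ ∑ k, |θ k| * K := Finset.sum_le_sum fun k _ => by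
      rw [abs_mul]; exact mul_le_mul_of_nonneg_left (hb x φ k) (abs_nonneg _)
    _ ≤ _ := by linarith

omit h0 h1 in
theorem V_empty (φ : Set Plane) : V β₀ d θ ∅ φ = 0 := by
  refine Finset.sum_eq_zero fun k _ => ?_
  have : u β₀ d ∅ φ k = 0 := by
    refine Fin.cases ?_ (fun k => ?_) k <;> simp [u]
  rw [this, mul_zero]

/-- Each added point changes the energy by a bounded amount. This linear bound makes the partition
function finite. -/
theorem exists_stability : ∃ K : ℝ, 0 < K ∧ ∀ (ψ φ : Set Plane), ψ.Finite →
    |V β₀ d θ ψ φ| ≤ K * ψ.ncard := by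
  obtain ⟨K, hK, hb⟩ := exists_bound_V h0 h1 d θ
  refine ⟨K, hK, fun ψ φ hψ => ?_⟩
  induction ψ, hψ using Set.Finite.induction_on with
  | empty => simp [V_empty]
  | @insert a ψ ha hψ ih =>
    rw [insert_eq, V_insert h0 h1 d θ hψ, ← insert_eq, ncard_insert_of_notMem ha hψ]
    refine (abs_add_le _ _).trans ?_
    push_cast
    linarith [hb a (ψ ∪ φ)]

end Energy

/-! ### Translation invariance of the increments -/

/-- Translation by `v` as an equivalence. -/
abbrev shift (v : Plane) : Plane ≃ Plane := Equiv.addRight v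

theorem shift_mem_edges {β₀ s t : ℝ} {φ : Set Plane} {ξ : Finset Plane} (v : Plane)
    (h : ξ ∈ edgesIoc β₀ s t φ) :
    ξ.map (shift v).toEmbedding ∈ edgesIoc β₀ s t ((fun x => x + v) '' φ) := by
  obtain ⟨⟨hc, ψ, ⟨⟨h3, o, r, hcirc, hi⟩, hang⟩, hsub⟩, hl⟩ := h
  have hball : Metric.closedBall (o + v) r = (fun x => x + v) '' Metric.closedBall o r := by
    ext z
    simp only [Metric.mem_closedBall, mem_image]
    constructor
    · intro hz
      exact ⟨z - v, by rwa [← dist_add_right _ _ v, sub_add_cancel], by simp⟩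
    · rintro ⟨w, hw, rfl⟩
      rwa [dist_add_right]
  refine ⟨⟨by simpa using hc, ψ.map (shift v).toEmbedding,
    ⟨⟨by simpa using h3, o + v, r, ?_, ?_⟩, ?_⟩, Finset.map_subset_map.2 hsub⟩, ?_⟩
  · intro x hx
    obtain ⟨y, hy, rfl⟩ := Finset.mem_map.1 hx
    simpa using hcirc y hy
  · rw [hball, ← image_inter (add_left_injective v), hi, Finset.coe_map]
    rfl
  · intro a ha b hb c hc' hab hbc hac
    obtain ⟨a', ha', rfl⟩ := Finset.mem_map.1 ha
    obtain ⟨b', hb', rfl⟩ := Finset.mem_map.1 hb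
    obtain ⟨c', hc'', rfl⟩ := Finset.mem_map.1 hc'
    have := hang a' ha' b' hb' c' hc'' (fun h => hab (h ▸ rfl)) (fun h => hbc (h ▸ rfl))
      (fun h => hac (h ▸ rfl))
    simpa [EuclideanGeometry.angle] using this
  · have : Metric.diam ((ξ.map (shift v).toEmbedding : Finset Plane) : Set Plane) =
        Metric.diam (ξ : Set Plane) := by
      rw [Finset.coe_map]
      exact (isometry_add_right v).diam_image _
    rwa [this]

theorem edges_shift (β₀ s t : ℝ) (φ : Set Plane) (v : Plane) :
    edgesIoc β₀ s t ((fun x => x + v) '' φ) =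
      (Finset.map (shift v).toEmbedding) '' edgesIoc β₀ s t φ := by
  ext ξ
  constructor
  · intro h
    refine ⟨ξ.map (shift (-v)).toEmbedding, ?_, ?_⟩
    · have := shift_mem_edges (-v) h
      rw [image_image] at this
      simpa using this
    · rw [Finset.map_map]
      convert Finset.map_refl using 2
      ext z : 1
      simp
  · rintro ⟨η, h, rfl⟩
    exact shift_mem_edges v h

theorem u_shift {p : ℕ} (β₀ : ℝ) (d : Fin (p + 1) → ℝ) (ψ φ : Set Plane) (v : Plane) :
    u β₀ d ((fun x => x + v) '' ψ) ((fun x => x + v) '' φ) = u β₀ d ψ φ := by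
  have hinj := Finset.map_injective (shift v).toEmbedding
  funext k
  refine Fin.cases ?_ (fun k => ?_) k
  · simp only [u, Fin.cons_zero]
    rw [← image_sdiff (add_left_injective v), ncard_image_of_injective _ (add_left_injective v)]
  · simp only [u, Fin.cons_succ]
    rw [← image_union, edges_shift, edges_shift, ← image_sdiff hinj, ← image_sdiff hinj,
      ncard_image_of_injective _ hinj, ncard_image_of_injective _ hinj]

theorem u_shift_point {p : ℕ} (β₀ : ℝ) (d : Fin (p + 1) → ℝ) (x : Plane) (φ : Set Plane)
    (v : Plane) : u β₀ d {x + v} ((fun x => x + v) '' φ) = u β₀ d {x} φ := by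
  have := u_shift β₀ d {x} φ v
  rwa [image_singleton] at this

/-- A coordinate vector as parameter turns the range of `V` into a range of each `u_k`; translation
moves the origin to `x`. -/
theorem IsRange.u_eq {p : ℕ} {β₀ : ℝ} {d : Fin (p + 1) → ℝ} {D : ℝ} (h : IsRange β₀ d D)
    (x : Plane) (φ : Config) (k : Fin (p + 1)) :
    u β₀ d {x} φ.1 k = u β₀ d {x} (φ.1 ∩ Metric.closedBall x D) k := by
  have hk := h (Pi.single k 1) (φ.translate (-x))
  simp only [V, Pi.single_apply, ite_mul, one_mul, zero_mul, Finset.sum_ite_eq', Finset.mem_univ,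
    if_true, Config.coe_translate] at hk
  have e1 := u_shift_point β₀ d x φ.1 (-x)
  have e2 := u_shift_point β₀ d x (φ.1 ∩ Metric.closedBall x D) (-x)
  have hb : (fun z => z + -x) '' Metric.closedBall x D = Metric.closedBall 0 D := by
    ext z
    simp only [Metric.mem_closedBall, mem_image]
    constructor
    · rintro ⟨w, hw, rfl⟩
      simpa [dist_eq_norm, sub_eq_add_neg] using hw
    · intro hz
      exact ⟨z + x, by simpa [dist_eq_norm] using hz, by simp⟩
  rw [image_inter (add_left_injective (-x)), hb] at e2
  rw [add_neg_cancel] at e1 e2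
  rw [← e1, ← e2, hk]

/-! ### The range of the model -/

/-- The formula `4 · radius · area = product of the sides`, squared to avoid the sign of the
orientation. -/
theorem circumradius_sq {o a b c : Plane} {r : ℝ} (ha : power o r a = 0) (hb : power o r b = 0)
    (hc : power o r c = 0) :
    (2 * r * orient a b c) ^ 2 = (dist b c * (dist b a * dist c a)) ^ 2 := by
  set O := o - a
  set B := b - a
  set C := c - a
  have eb : 2 * dot O B = dot B B := by
    have : power o r b - power o r a = dot B B - 2 * dot O B := by
      simp only [power, dist_sq, dot, PiLp.sub_apply, O, B]; ring
    linarith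
  have ec : 2 * dot O C = dot C C := by
    have : power o r c - power o r a = dot C C - 2 * dot O C := by
      simp only [power, dist_sq, dot, PiLp.sub_apply, O, C]; ring
    linarith
  have er : r ^ 2 = dot O O := by
    have : power o r a = dot O O - r ^ 2 := by
      simp only [power, dist_sq, dot, PiLp.sub_apply, O]; ring
    linarith
  have e1 : (2 * r * orient a b c) ^ 2 = (2 * dot O B) ^ 2 * dot C C
      - 2 * (2 * dot O B) * (2 * dot O C) * dot B C + (2 * dot O C) ^ 2 * dot B B := by
    have : (2 * r * orient a b c) ^ 2 = 4 * r ^ 2 * orient a b c ^ 2 := by ring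
    rw [this, er]
    simp only [orient, det, dot, B, C]; ring
  rw [e1, eb, ec, mul_pow, mul_pow, dist_sq b c, dist_sq b a, dist_sq c a]
  simp only [dot, PiLp.sub_apply, B, C]; ring

/-- Law of sines: the side `b c` is `2 r` times the sine of the angle at `a`, which is at least `s`.
-/
theorem IsFat.radius_le {s κ : ℝ} {o a b c : Plane} {r : ℝ} (hr : 0 ≤ r)
    (hf : IsFat s κ a b c) (ha : power o r a = 0) (hb : power o r b = 0)
    (hc : power o r c = 0) : 2 * s * r ≤ dist b c := by
  have h := circumradius_sq ha hb hc
  have hpos := hf.pos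
  have h2 : 2 * r * orient a b c = dist b c * (dist b a * dist c a) :=
    (sq_eq_sq₀ (by positivity) (by positivity)).1 h
  have p1 : 0 < dist b a * dist c a :=
    mul_pos (dist_pos.2 hf.ne.1.symm) (dist_pos.2 hf.ne.2.1.symm)
  refine le_of_mul_le_mul_right ?_ p1
  rw [← h2]
  nlinarith [mul_le_mul_of_nonneg_left hf.sa hr]

theorem radius_le {β₀ : ℝ} (h0 : 0 < β₀) (h1 : β₀ < Real.pi / 3) {φ : Set Plane}
    {ψ ξ : Finset Plane} {o : Plane} {r L : ℝ} (hψ : ψ ∈ betaDel3 β₀ φ)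
    (hd : ∀ x ∈ ψ, dist x o = r) (hsub : ξ ⊆ ψ) (hcard : ξ.card = 2)
    (hL : Metric.diam (ξ : Set Plane) ≤ L) : r ≤ L / (2 * Real.sin β₀) := by
  have hs := sin_pos_of_lt h0 h1
  have key : ∃ a b c, ψ = {a, b, c} ∧
      IsFat (Real.sin β₀) (Real.cos β₀ / Real.sin β₀) a b c ∧ b ∈ ξ ∧ c ∈ ξ := by
    obtain ⟨a, b, c, -, -, e, hf, -⟩ := exists_of_mem_betaDel3 h0 hψ
    have e2 : ψ = {b, c, a} := by rw [e]; ext z; simp; tauto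
    have e3 : ψ = {c, a, b} := by rw [e]; ext z; simp; tauto
    obtain ⟨y, z, hyz, rfl⟩ := Finset.card_eq_two.1 hcard
    have hy : y ∈ ψ := hsub (by simp)
    have hz : z ∈ ψ := hsub (by simp)
    rw [e] at hy hz
    simp only [Finset.mem_insert, Finset.mem_singleton] at hy hz
    rcases hy with rfl | rfl | rfl <;> rcases hz with rfl | rfl | rfl <;>
      solve
      | exact absurd rfl hyz
      | (refine ⟨_, _, _, e, hf, ?_, ?_⟩ <;> simp)
      | (refine ⟨_, _, _, e2, hf.rotate, ?_, ?_⟩ <;> simp)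
      | (refine ⟨_, _, _, e3, hf.rotate.rotate, ?_, ?_⟩ <;> simp)
  obtain ⟨a, b, c, e, hf, hb, hc⟩ := key
  have hp : ∀ x ∈ ψ, power o r x = 0 := fun x hx => by rw [power, hd x hx, sub_self]
  have hr : 0 ≤ r := by rw [← hd a (by simp [e])]; exact dist_nonneg
  have hle := hf.radius_le hr (hp a (by simp [e])) (hp b (by simp [e])) (hp c (by simp [e]))
  have hdist : dist b c ≤ Metric.diam (ξ : Set Plane) :=
    Metric.dist_le_diam_of_mem ξ.finite_toSet.isBounded hb hc
  rw [le_div_iff₀ (by positivity)]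
  linarith

section Range

variable {β₀ : ℝ} (h0 : 0 < β₀) (h1 : β₀ < Real.pi / 3) {s t R : ℝ}
  (hR : t / (2 * Real.sin β₀) ≤ R)
include h0 h1 hR

/-- The circumscribed disc has radius at most `R` and `y` on its boundary, so it stays within `R + R
+ 2 R` of `x`; emptiness of the disc is decided inside `S`. -/
theorem mem_edges_restrict_iff {φ S : Set Plane} {x y : Plane} {ξ : Finset Plane} (hy : y ∈ ξ)
    (hyx : dist y x ≤ 2 * R) (hS : Metric.closedBall x (4 * R) ⊆ S) :
    ξ ∈ edgesIoc β₀ s t (φ ∩ S) ↔ ξ ∈ edgesIoc β₀ s t φ := by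
  have key : ∀ (χ : Set Plane) (ψ : Finset Plane) (o : Plane) (r : ℝ), ψ ∈ betaDel3 β₀ χ →
      (∀ z ∈ ψ, dist z o = r) → ξ ⊆ ψ → ξ.card = 2 → Metric.diam (ξ : Set Plane) ∈ Ioc s t →
      φ ∩ S ∩ Metric.closedBall o r = φ ∩ Metric.closedBall o r := by
    intro χ ψ o r hψ hd hsub hc hl
    have hr := (radius_le h0 h1 hψ hd hsub hc hl.2).trans hR
    rw [inter_assoc]
    refine congrArg _ (inter_eq_right.2 (Subset.trans (fun z hz => ?_) hS))
    rw [Metric.mem_closedBall] at *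
    have := hd y (hsub hy)
    have h4 := dist_triangle4 z o y x
    rw [dist_comm o y] at h4
    linarith
  constructor
  · rintro ⟨⟨hc, ψ, hψ, hsub⟩, hl⟩
    obtain ⟨⟨h3, o, r, hd, hi⟩, hang⟩ := id hψ
    exact ⟨⟨hc, ψ, ⟨⟨h3, o, r, hd, by rw [← key _ ψ o r hψ hd hsub hc hl, hi]⟩, hang⟩, hsub⟩, hl⟩
  · rintro ⟨⟨hc, ψ, hψ, hsub⟩, hl⟩
    obtain ⟨⟨h3, o, r, hd, hi⟩, hang⟩ := id hψ
    exact ⟨⟨hc, ψ, ⟨⟨h3, o, r, hd, by rw [key _ ψ o r hψ hd hsub hc hl, hi]⟩, hang⟩, hsub⟩, hl⟩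

/-- A triangle that appears or disappears has `x` in its circumscribed disc, so its vertices are
within a diameter of `x`. -/
theorem exists_near_of_change {φ : Set Plane} {x : Plane} {ξ : Finset Plane}
    (h : ξ ∈ edgesIoc β₀ s t ({x} ∪ φ) \ edgesIoc β₀ s t φ ∨
      ξ ∈ edgesIoc β₀ s t φ \ edgesIoc β₀ s t ({x} ∪ φ)) : ∃ y ∈ ξ, dist y x ≤ 2 * R := by
  have key : ∀ (χ : Set Plane) (ψ : Finset Plane) (o : Plane) (r : ℝ), ψ ∈ betaDel3 β₀ χ →
      (∀ z ∈ ψ, dist z o = r) → ξ ⊆ ψ → ξ.card = 2 → Metric.diam (ξ : Set Plane) ∈ Ioc s t →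
      x ∈ Metric.closedBall o r → ∃ y ∈ ξ, dist y x ≤ 2 * R := by
    intro χ ψ o r hψ hd hsub hc hl hx
    have hr := (radius_le h0 h1 hψ hd hsub hc hl.2).trans hR
    obtain ⟨y, hy⟩ := Finset.card_pos.1 (by omega : 0 < ξ.card)
    refine ⟨y, hy, ?_⟩
    have := hd y (hsub hy)
    rw [Metric.mem_closedBall] at hx
    linarith [dist_triangle_right y x o]
  rcases h with ⟨⟨⟨hc, ψ, hψ, hsub⟩, hl⟩, hn⟩ | ⟨⟨⟨hc, ψ, hψ, hsub⟩, hl⟩, hn⟩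
  · have hx : x ∈ ψ := by
      by_contra hx
      exact hn ⟨⟨hc, ψ, betaDel3_of_insert hψ hx, hsub⟩, hl⟩
    obtain ⟨⟨h3, o, r, hd, hi⟩, hang⟩ := id hψ
    exact key _ ψ o r hψ hd hsub hc hl (Metric.mem_closedBall.2 (hd x hx).le)
  · obtain ⟨-, o, r, hd, hx⟩ := mem_discTriangles_of_notMem (x := x) hψ fun h =>
      hn ⟨⟨hc, ψ, h, hsub⟩, hl⟩
    exact key _ ψ o r hψ hd.circle hsub hc hl hx

end Range

/-- The model has a finite range. -/
theorem exists_range {p : ℕ} {β₀ : ℝ} (h0 : 0 < β₀) (h1 : β₀ < Real.pi / 3)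
    (d : Fin (p + 1) → ℝ) (hd : StrictMono d) : ∃ D : ℝ, 0 < D ∧ IsRange β₀ d D := by
  have hs := sin_pos_of_lt h0 h1
  -- The `+ 1` keeps `R` positive even if the last threshold is `0`, as happens without edge
  -- classes.
  set R := (|d (Fin.last p)| + 1) / (2 * Real.sin β₀) with hRdef
  have hRpos : 0 < R := by positivity
  refine ⟨4 * R, by positivity, fun θ φ => ?_⟩
  have hx : (0 : Plane) ∈ Metric.closedBall (0 : Plane) (4 * R) := by
    simp [hRpos.le]
  refine Finset.sum_congr rfl fun k _ => congrArg _ ?_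
  have hun : ({0} ∪ φ.1) ∩ Metric.closedBall 0 (4 * R) =
      {0} ∪ φ.1 ∩ Metric.closedBall 0 (4 * R) := by
    rw [union_inter_distrib_right, inter_eq_left.2 (singleton_subset_iff.2 hx)]
  refine Fin.cases ?_ (fun k => ?_) k
  · simp only [u, Fin.cons_zero]
    congr 2
    ext z
    simp only [mem_sdiff, mem_singleton_iff, mem_inter_iff]
    constructor
    · rintro ⟨rfl, h⟩; exact ⟨rfl, fun h' => h h'.1⟩
    · rintro ⟨rfl, h⟩; exact ⟨rfl, fun h' => h ⟨h', hx⟩⟩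
  · simp only [u, Fin.cons_succ]
    have hR : d k.succ / (2 * Real.sin β₀) ≤ R := by
      rw [hRdef]
      gcongr
      have := hd.monotone (Fin.le_last k.succ)
      linarith [le_abs_self (d (Fin.last p))]
    set s := d k.castSucc
    set t := d k.succ
    have iff1 : ∀ (ξ : Finset Plane) (y : Plane), y ∈ ξ → dist y 0 ≤ 2 * R →
        (ξ ∈ edgesIoc β₀ s t (φ.1 ∩ Metric.closedBall 0 (4 * R)) ↔ ξ ∈ edgesIoc β₀ s t φ.1) :=
      fun ξ y hy hyx => mem_edges_restrict_iff h0 h1 hR hy hyx Subset.rfl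
    have iff2 : ∀ (ξ : Finset Plane) (y : Plane), y ∈ ξ → dist y 0 ≤ 2 * R →
        (ξ ∈ edgesIoc β₀ s t ({0} ∪ φ.1 ∩ Metric.closedBall 0 (4 * R)) ↔
          ξ ∈ edgesIoc β₀ s t ({0} ∪ φ.1)) := by
      intro ξ y hy hyx
      rw [← hun]
      exact mem_edges_restrict_iff h0 h1 hR hy hyx Subset.rfl
    have e1 : edgesIoc β₀ s t ({0} ∪ φ.1) \ edgesIoc β₀ s t φ.1 =
        edgesIoc β₀ s t ({0} ∪ φ.1 ∩ Metric.closedBall 0 (4 * R)) \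
          edgesIoc β₀ s t (φ.1 ∩ Metric.closedBall 0 (4 * R)) := by
      ext ξ
      constructor
      · intro h
        obtain ⟨y, hy, hyx⟩ := exists_near_of_change h0 h1 hR (Or.inl h)
        exact ⟨(iff2 ξ y hy hyx).2 h.1, fun h' => h.2 ((iff1 ξ y hy hyx).1 h')⟩
      · intro h
        obtain ⟨y, hy, hyx⟩ := exists_near_of_change h0 h1 hR (Or.inl h)
        exact ⟨(iff2 ξ y hy hyx).1 h.1, fun h' => h.2 ((iff1 ξ y hy hyx).2 h')⟩
    have e2 : edgesIoc β₀ s t φ.1 \ edgesIoc β₀ s t ({0} ∪ φ.1) =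
        edgesIoc β₀ s t (φ.1 ∩ Metric.closedBall 0 (4 * R)) \
          edgesIoc β₀ s t ({0} ∪ φ.1 ∩ Metric.closedBall 0 (4 * R)) := by
      ext ξ
      constructor
      · intro h
        obtain ⟨y, hy, hyx⟩ := exists_near_of_change h0 h1 hR (Or.inr h)
        exact ⟨(iff1 ξ y hy hyx).2 h.1, fun h' => h.2 ((iff2 ξ y hy hyx).1 h')⟩
      · intro h
        obtain ⟨y, hy, hyx⟩ := exists_near_of_change h0 h1 hR (Or.inr h)
        exact ⟨(iff1 ξ y hy hyx).1 h.1, fun h' => h.2 ((iff2 ξ y hy hyx).2 h')⟩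
    rw [e1, e2]

/-! ### Measurability of the increments -/

theorem exists_circumcentre {a b c : Plane} (h : orient a b c ≠ 0) :
    ∃ o : Plane, dist b o = dist a o ∧ dist c o = dist a o := by
  set B := b - a with hB
  set C := c - a with hC
  have hΔ : B 0 * C 1 - B 1 * C 0 ≠ 0 := h
  obtain ⟨p, q, hB', hC'⟩ : ∃ p q : ℝ, 2 * (p * B 0 + q * B 1) = dot B B ∧
      2 * (p * C 0 + q * C 1) = dot C C := by
    refine ⟨(C 1 * dot B B - B 1 * dot C C) / (2 * (B 0 * C 1 - B 1 * C 0)),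
      (B 0 * dot C C - C 0 * dot B B) / (2 * (B 0 * C 1 - B 1 * C 0)), ?_, ?_⟩
    all_goals
      generalize dot B B = u
      generalize dot C C = v
      rw [div_mul_eq_mul_div, div_mul_eq_mul_div, ← add_div, ← mul_div_assoc,
        div_eq_iff (mul_ne_zero two_ne_zero hΔ)]
      ring
  refine ⟨a + !₂[p, q], ?_, ?_⟩
  all_goals
    rw [← sq_eq_sq₀ dist_nonneg dist_nonneg, dist_sq, dist_sq]
    have b0 : b 0 = a 0 + B 0 := by simp [hB]
    have b1 : b 1 = a 1 + B 1 := by simp [hB]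
    have c0 : c 0 = a 0 + C 0 := by simp [hC]
    have c1 : c 1 = a 1 + C 1 := by simp [hC]
    simp only [dot, PiLp.sub_apply, PiLp.add_apply, b0, b1, c0, c1, Matrix.cons_val_zero,
      Matrix.cons_val_one] at hB' hC' ⊢
    first
    | linear_combination -hB'
    | linear_combination -hC'

/-- A polynomial that is nonnegative exactly when `z` lies in the circumscribed disc. -/
def discPoly (a b c z : Plane) : ℝ :=
  orient a b c * (det (b - z) (c - z) * dot (a - z) (a - z) +
    det (c - z) (a - z) * dot (b - z) (b - z) + det (a - z) (b - z) * dot (c - z) (c - z))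

theorem discPoly_nonneg_iff {a b c o : Plane} {r : ℝ} (hr : 0 ≤ r) (h : orient a b c ≠ 0)
    (ha : dist a o = r) (hb : dist b o = r) (hc : dist c o = r) (z : Plane) :
    0 ≤ discPoly a b c z ↔ z ∈ Metric.closedBall o r := by
  have hp : ∀ x, dist x o = r → power o r x = 0 := fun x hx => by rw [power, hx, sub_self]
  have e := orient_mul_power (hp a ha) (hp b hb) (hp c hc) z
  have e2 : discPoly a b c z = -(orient a b c ^ 2 * power o r z) := by
    rw [discPoly, ← dist_sq, ← dist_sq, ← dist_sq]
    linear_combination (orient a b c) * e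
  have hpos : 0 < orient a b c ^ 2 := by positivity
  rw [e2, neg_nonneg]
  constructor
  · intro h
    have h' : power o r z ≤ 0 := by
      by_contra hlt
      exact absurd h (not_le.2 (mul_pos hpos (not_le.1 hlt)))
    exact Metric.mem_closedBall.2 (abs_le_of_sq_le_sq' (by unfold power at h'; linarith) hr).2
  · exact fun hz => mul_nonpos_of_nonneg_of_nonpos hpos.le (power_nonpos hz)

theorem orient_ne_imp {a b c : Plane} (h : orient a b c ≠ 0) : a ≠ b ∧ a ≠ c ∧ b ≠ c := by
  refine ⟨?_, ?_, ?_⟩ <;> rintro rfl <;> apply h <;> simp only [orient, det, PiLp.sub_apply] <;> ring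

/-- The existential quantifier over centre and radius is eliminated: what remains are conditions on
the coordinates of the vertices and a quantifier over the points of `φ`, both measurable. -/
theorem mem_betaDel3_iff {β₀ : ℝ} (h0 : 0 < β₀) (φ : Set Plane) (a b c : Plane) :
    ({a, b, c} : Finset Plane) ∈ betaDel3 β₀ φ ↔ a ∈ φ ∧ b ∈ φ ∧ c ∈ φ ∧ orient a b c ≠ 0 ∧
      AnglesGT β₀ a b c ∧ ∀ z ∈ φ, 0 ≤ discPoly a b c z → z = a ∨ z = b ∨ z = c := by
  constructor
  · rintro ⟨⟨hcard, o, r, hcirc, hi⟩, hang⟩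
    have hab : a ≠ b ∧ a ≠ c ∧ b ≠ c := by
      refine ⟨?_, ?_, ?_⟩
      · rintro rfl
        rw [Finset.insert_eq_of_mem (by simp)] at hcard
        exact absurd hcard (by have := Finset.card_le_two (a := a) (b := c); omega)
      · rintro rfl
        rw [Finset.insert_eq_of_mem (by simp)] at hcard
        exact absurd hcard (by have := Finset.card_le_two (a := b) (b := a); omega)
      · rintro rfl
        rw [Finset.insert_eq_of_mem (Finset.mem_singleton_self b)] at hcard
        exact absurd hcard (by have := Finset.card_le_two (a := a) (b := b); omega)
    have hA : AnglesGT β₀ a b c :=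
      ⟨hang b (by simp) a (by simp) c (by simp) hab.1.symm hab.2.1 hab.2.2,
        hang c (by simp) b (by simp) a (by simp) hab.2.2.symm hab.1.symm hab.2.1.symm,
        hang a (by simp) c (by simp) b (by simp) hab.2.1 hab.2.2.symm hab.1⟩
    have hd : IsEmptyDisc φ {a, b, c} o r := ⟨hcirc, hi⟩
    have ho := hA.orient_ne h0 hab.1 hab.2.1
    have hr : 0 ≤ r := by rw [← hcirc a (by simp)]; exact dist_nonneg
    refine ⟨hd.subset (by simp), hd.subset (by simp), hd.subset (by simp), ho, hA, ?_⟩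
    intro z hz hp
    have hz' : z ∈ φ ∩ Metric.closedBall o r := ⟨hz, (discPoly_nonneg_iff hr ho
      (hcirc a (by simp)) (hcirc b (by simp)) (hcirc c (by simp)) z).1 hp⟩
    rw [hi] at hz'
    simpa using hz'
  · rintro ⟨ha, hb, hc, ho, hA, hz⟩
    obtain ⟨hab, hac, hbc⟩ := orient_ne_imp ho
    obtain ⟨o, e1, e2⟩ := exists_circumcentre ho
    have hcirc : ∀ x ∈ ({a, b, c} : Finset Plane), dist x o = dist a o := by
      intro x hx
      simp only [Finset.mem_insert, Finset.mem_singleton] at hx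
      rcases hx with rfl | rfl | rfl
      exacts [rfl, e1, e2]
    refine ⟨⟨Finset.card_eq_three.2 ⟨a, b, c, hab, hac, hbc, rfl⟩, o, dist a o, hcirc, ?_⟩, ?_⟩
    · ext z
      constructor
      · rintro ⟨hzφ, hzb⟩
        have := hz z hzφ ((discPoly_nonneg_iff dist_nonneg ho rfl e1 e2 z).2 hzb)
        simpa using this
      · intro h
        have h' : z ∈ ({a, b, c} : Finset Plane) := h
        refine ⟨?_, Metric.mem_closedBall.2 (hcirc z h').le⟩
        simp only [Finset.mem_insert, Finset.mem_singleton] at h'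
        rcases h' with rfl | rfl | rfl <;> assumption
    · obtain ⟨A1, A2, A3⟩ := hA
      have B1 := EuclideanGeometry.angle_comm b a c
      have B2 := EuclideanGeometry.angle_comm c b a
      have B3 := EuclideanGeometry.angle_comm a c b
      intro x hx y hy z hz' hxy hyz hxz
      simp only [Finset.mem_insert, Finset.mem_singleton] at hx hy hz'
      rcases hx with rfl | rfl | rfl <;> rcases hy with rfl | rfl | rfl <;>
        rcases hz' with rfl | rfl | rfl <;>
        first
        | exact absurd rfl hxy
        | exact absurd rfl hyz
        | exact absurd rfl hxz
        | linarith

theorem mem_edgesIoc_iff {β₀ s t : ℝ} (φ : Set Plane) (a b : Plane) :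
    ({a, b} : Finset Plane) ∈ edgesIoc β₀ s t φ ↔ a ≠ b ∧ dist a b ∈ Ioc s t ∧
      ∃ c ∈ φ, ({a, b, c} : Finset Plane) ∈ betaDel3 β₀ φ := by
  have hdiam : Metric.diam (({a, b} : Finset Plane) : Set Plane) = dist a b := by
    rw [Finset.coe_pair, Metric.diam_pair]
  constructor
  · rintro ⟨⟨hc, ψ, hψ, hsub⟩, hl⟩
    rw [hdiam] at hl
    have hab : a ≠ b := by
      rintro rfl
      simp at hc
    refine ⟨hab, hl, ?_⟩
    have h1 : (ψ \ {a, b}).card = 1 := by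
      rw [Finset.card_sdiff_of_subset hsub, hc, hψ.1.1]
    obtain ⟨c, hc'⟩ := Finset.card_eq_one.1 h1
    have e : ψ = {a, b, c} := by
      rw [← Finset.union_sdiff_of_subset hsub, hc']
      ext z; simp
    refine ⟨c, ?_, e ▸ hψ⟩
    obtain ⟨⟨-, o, r, -, hi⟩, -⟩ := hψ
    have : c ∈ φ ∩ Metric.closedBall o r := by rw [hi, e]; simp
    exact this.1
  · rintro ⟨hab, hl, c, -, h⟩
    exact ⟨⟨Finset.card_pair hab, _, h, by intro z; simp; tauto⟩, by rwa [hdiam]⟩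

section Measurability

variable {Ω : Type*} [MeasurableSpace Ω]

theorem measurable_coord {a : Ω → Plane} (ha : Measurable a) (i : Fin 2) :
    Measurable fun ω => a ω i :=
  (PiLp.continuous_apply 2 (fun _ : Fin 2 => ℝ) i).measurable.comp ha

theorem measurable_det {a b : Ω → Plane} (ha : Measurable a) (hb : Measurable b) :
    Measurable fun ω => det (a ω) (b ω) :=
  ((measurable_coord ha 0).mul (measurable_coord hb 1)).sub
    ((measurable_coord ha 1).mul (measurable_coord hb 0))

theorem measurable_dot {a b : Ω → Plane} (ha : Measurable a) (hb : Measurable b) :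
    Measurable fun ω => dot (a ω) (b ω) :=
  ((measurable_coord ha 0).mul (measurable_coord hb 0)).add
    ((measurable_coord ha 1).mul (measurable_coord hb 1))

theorem measurable_orient {a b c : Ω → Plane} (ha : Measurable a) (hb : Measurable b)
    (hc : Measurable c) : Measurable fun ω => orient (a ω) (b ω) (c ω) :=
  measurable_det (hb.sub ha) (hc.sub ha)

theorem measurable_angle {a b c : Ω → Plane} (ha : Measurable a) (hb : Measurable b)
    (hc : Measurable c) :
    Measurable fun ω => EuclideanGeometry.angle (a ω) (b ω) (c ω) := by
  unfold EuclideanGeometry.angle InnerProductGeometry.angle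
  refine Real.measurable_arccos.comp ?_
  exact ((ha.sub hb).inner (hc.sub hb)).div ((ha.sub hb).norm.mul (hc.sub hb).norm)

theorem measurable_discPoly {a b c z : Ω → Plane} (ha : Measurable a) (hb : Measurable b)
    (hc : Measurable c) (hz : Measurable z) :
    Measurable fun ω => discPoly (a ω) (b ω) (c ω) (z ω) := by
  have a' := ha.sub hz
  have b' := hb.sub hz
  have c' := hc.sub hz
  exact (measurable_orient ha hb hc).mul ((((measurable_det b' c').mul (measurable_dot a' a')).add
    ((measurable_det c' a').mul (measurable_dot b' b'))).add
    ((measurable_det a' b').mul (measurable_dot c' c')))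

theorem measurableSet_betaDel3 {β₀ : ℝ} (h0 : 0 < β₀) {a b c : Ω → Plane} {φ : Ω → Config}
    (ha : Measurable a) (hb : Measurable b) (hc : Measurable c) (hφ : Measurable φ) :
    MeasurableSet {ω | ({a ω, b ω, c ω} : Finset Plane) ∈ betaDel3 β₀ (φ ω).1} := by
  simp only [mem_betaDel3_iff h0]
  refine (measurableSet_mem hφ ha).inter ((measurableSet_mem hφ hb).inter
    ((measurableSet_mem hφ hc).inter (MeasurableSet.inter ?_ (MeasurableSet.inter ?_ ?_))))
  · exact (measurableSet_eq_fun (measurable_orient ha hb hc) measurable_const).compl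
  · exact (measurableSet_lt measurable_const (measurable_angle hb ha hc)).inter
      ((measurableSet_lt measurable_const (measurable_angle hc hb ha)).inter
        (measurableSet_lt measurable_const (measurable_angle ha hc hb)))
  · refine measurableSet_forall_mem hφ (s := {q : Ω × Plane |
      0 ≤ discPoly (a q.1) (b q.1) (c q.1) q.2 → q.2 = a q.1 ∨ q.2 = b q.1 ∨ q.2 = c q.1}) ?_
    have m : Measurable (Prod.fst : Ω × Plane → Ω) := measurable_fst
    have n : Measurable (Prod.snd : Ω × Plane → Plane) := measurable_snd
    have e : ∀ {f : Ω → Plane}, Measurable f → MeasurableSet {q : Ω × Plane | q.2 = f q.1} :=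
      fun hf => measurableSet_eq_fun n (hf.comp m)
    have h1 : MeasurableSet {q : Ω × Plane | 0 ≤ discPoly (a q.1) (b q.1) (c q.1) q.2} :=
      measurableSet_le measurable_const
        (measurable_discPoly (ha.comp m) (hb.comp m) (hc.comp m) n)
    have h2 := h1.compl.union ((e ha).union ((e hb).union (e hc)))
    convert h2 using 1
    ext q
    simp only [mem_ofPred_eq, mem_union, mem_compl_iff, imp_iff_not_or]

theorem measurableSet_edgesIoc {β₀ s t : ℝ} (h0 : 0 < β₀) {a b : Ω → Plane} {φ : Ω → Config}
    (ha : Measurable a) (hb : Measurable b) (hφ : Measurable φ) :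
    MeasurableSet {ω | ({a ω, b ω} : Finset Plane) ∈ edgesIoc β₀ s t (φ ω).1} := by
  simp only [mem_edgesIoc_iff]
  refine (measurableSet_eq_fun ha hb).compl.inter (MeasurableSet.inter ?_ ?_)
  · exact (ha.dist hb) measurableSet_Ioc
  · exact measurableSet_exists_mem hφ
      (s := {q : Ω × Plane | ({a q.1, b q.1, q.2} : Finset Plane) ∈ betaDel3 β₀ (φ q.1).1})
      (measurableSet_betaDel3 h0 (ha.comp measurable_fst) (hb.comp measurable_fst) measurable_snd
        (hφ.comp measurable_fst))

/-! ### Counting edges measurably. -/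

/-- The lexicographic order of the plane. -/
def LexLT (a b : Plane) : Prop := a 0 < b 0 ∨ a 0 = b 0 ∧ a 1 < b 1

theorem lexLT_or {a b : Plane} (h : a ≠ b) : LexLT a b ∨ LexLT b a := by
  unfold LexLT
  rcases lt_trichotomy (a 0) (b 0) with h1 | h1 | h1
  · tauto
  · rcases lt_trichotomy (a 1) (b 1) with h2 | h2 | h2
    · tauto
    · exact absurd (PiLp.ext fun i => by fin_cases i <;> assumption) h
    · right; right; exact ⟨h1.symm, h2⟩
  · tauto

theorem LexLT.asymm {a b : Plane} (h : LexLT a b) (h' : LexLT b a) : False := by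
  unfold LexLT at *
  rcases h with h | ⟨h, h2⟩ <;> rcases h' with h' | ⟨h', h2'⟩ <;> linarith

/-- The lexicographic order selects one of the two orderings of each edge, so that edges are counted
as ordered pairs of points, accessible to iterated integrals against `pts`. -/
theorem encard_pairs (G : Set (Finset Plane)) (hG : ∀ ξ ∈ G, ξ.card = 2) :
    {q : Plane × Plane | LexLT q.1 q.2 ∧ ({q.1, q.2} : Finset Plane) ∈ G}.encard = G.encard := by
  have himg : (fun q : Plane × Plane => ({q.1, q.2} : Finset Plane)) ''
      {q : Plane × Plane | LexLT q.1 q.2 ∧ ({q.1, q.2} : Finset Plane) ∈ G} = G := by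
    ext ξ
    constructor
    · rintro ⟨q, hq, rfl⟩; exact hq.2
    · intro hξ
      obtain ⟨a, b, hab, rfl⟩ := Finset.card_eq_two.1 (hG ξ hξ)
      rcases lexLT_or hab with h | h
      · exact ⟨(a, b), ⟨h, hξ⟩, rfl⟩
      · exact ⟨(b, a), ⟨h, by rwa [Finset.pair_comm]⟩, by simp [Finset.pair_comm]⟩
  conv_rhs => rw [← himg]
  refine (InjOn.encard_image ?_).symm
  rintro ⟨a, b⟩ ⟨h, -⟩ ⟨a', b'⟩ ⟨h', -⟩ e
  simp only at e h h'
  have m1 : a ∈ ({a', b'} : Finset Plane) := by rw [← e]; simp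
  have m2 : b ∈ ({a', b'} : Finset Plane) := by rw [← e]; simp
  simp only [Finset.mem_insert, Finset.mem_singleton] at m1 m2
  rcases m1 with rfl | rfl <;> rcases m2 with rfl | rfl
  · exact (h.asymm h).elim
  · rfl
  · exact (h.asymm h').elim
  · exact (h.asymm h).elim

theorem lintegral_pts_pairs (φ : Config) (S : Set (Plane × Plane))
    (hS : ∀ q ∈ S, q.1 ∈ φ.1 ∧ q.2 ∈ φ.1) :
    ∫⁻ a, pts φ {b | (a, b) ∈ S} ∂pts φ = S.encard := by
  rw [lintegral_pts, ← ENNReal.tsum_set_one, tsum_subtype S (fun _ => (1 : ENNReal)),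
    ENNReal.summable.tsum_prod' (fun _ => ENNReal.summable),
    tsum_subtype φ.1 (fun a => pts φ {b | (a, b) ∈ S})]
  refine tsum_congr fun a => ?_
  by_cases ha : a ∈ φ.1
  · rw [indicator_of_mem ha, pts_apply, ← ENNReal.tsum_set_one,
      tsum_subtype (φ.1 ∩ {b | (a, b) ∈ S}) (fun _ => (1 : ENNReal))]
    refine tsum_congr fun b => ?_
    by_cases hb : (a, b) ∈ S
    · have hm : b ∈ φ.1 ∩ {b | (a, b) ∈ S} := ⟨(hS _ hb).2, hb⟩
      rw [indicator_of_mem hm, indicator_of_mem hb]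
    · have hm : b ∉ φ.1 ∩ {b | (a, b) ∈ S} := fun h => hb h.2
      rw [indicator_of_notMem hm, indicator_of_notMem hb]
  · rw [indicator_of_notMem ha]
    symm
    rw [ENNReal.tsum_eq_zero]
    exact fun b => indicator_of_notMem (fun h => ha (hS _ h).1) _

/-- On infinite sets both sides take the default value `0`. -/
theorem toReal_encard {α : Type*} (s : Set α) : ((s.encard : ENNReal)).toReal = s.ncard := by
  rcases s.finite_or_infinite with h | h
  · rw [← h.cast_ncard_eq]; simp
  · rw [h.ncard, h.encard_eq]; simp

theorem mem_of_mem_edgesIoc {β₀ s t : ℝ} {φ : Set Plane} {ξ : Finset Plane}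
    (h : ξ ∈ edgesIoc β₀ s t φ) {x : Plane} (hx : x ∈ ξ) : x ∈ φ := by
  obtain ⟨⟨-, ψ, ⟨⟨-, o, r, -, hi⟩, -⟩, hsub⟩, -⟩ := h
  have : x ∈ φ ∩ Metric.closedBall o r := by rw [hi]; exact hsub hx
  exact this.1

theorem measurable_ncard_edges {β₀ s t : ℝ} (h0 : 0 < β₀) {φ χ : Ω → Config} (hφ : Measurable φ)
    (hχ : Measurable χ) : Measurable fun ω =>
      ((edgesIoc β₀ s t (φ ω).1 \ edgesIoc β₀ s t (χ ω).1).ncard : ℝ) := by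
  set S : Ω → Set (Plane × Plane) := fun ω => {q | LexLT q.1 q.2 ∧ ({q.1, q.2} : Finset Plane) ∈
    edgesIoc β₀ s t (φ ω).1 \ edgesIoc β₀ s t (χ ω).1} with hS
  have e : ∀ ω, ((edgesIoc β₀ s t (φ ω).1 \ edgesIoc β₀ s t (χ ω).1).ncard : ℝ) =
      (∫⁻ a, pts (φ ω) {b | (a, b) ∈ S ω} ∂pts (φ ω)).toReal := by
    intro ω
    rw [lintegral_pts_pairs, hS, encard_pairs _ (fun ξ hξ => hξ.1.1.1), toReal_encard]
    intro q hq
    exact ⟨mem_of_mem_edgesIoc hq.2.1 (by simp), mem_of_mem_edgesIoc hq.2.1 (by simp)⟩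
  simp_rw [e]
  refine (measurable_lintegral_pts hφ (f := fun ω a => pts (φ ω) {b | (a, b) ∈ S ω}) ?_).ennreal_toReal
  refine measurable_pts_preimage (c := fun q : Ω × Plane => φ q.1) (hφ.comp measurable_fst)
    (s := {q : (Ω × Plane) × Plane | (q.1.2, q.2) ∈ S q.1.1}) ?_
  have m1 : Measurable fun q : (Ω × Plane) × Plane => q.1.1 := by fun_prop
  have m2 : Measurable fun q : (Ω × Plane) × Plane => q.1.2 := by fun_prop
  have m3 : Measurable fun q : (Ω × Plane) × Plane => q.2 := by fun_prop
  refine MeasurableSet.inter ?_ (MeasurableSet.inter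
    (measurableSet_edgesIoc h0 m2 m3 (hφ.comp m1))
    (measurableSet_edgesIoc h0 m2 m3 (hχ.comp m1)).compl)
  exact (measurableSet_lt (measurable_coord m2 0) (measurable_coord m3 0)).union
    ((measurableSet_eq_fun (measurable_coord m2 0) (measurable_coord m3 0)).inter
      (measurableSet_lt (measurable_coord m2 1) (measurable_coord m3 1)))

variable {p : ℕ} {β₀ : ℝ} (h0 : 0 < β₀) (d θ : Fin (p + 1) → ℝ)

include h0

theorem measurable_u {ψ φ : Ω → Config} (hψ : Measurable ψ) (hφ : Measurable φ)
    (k : Fin (p + 1)) : Measurable fun ω => u β₀ d (ψ ω).1 (φ ω).1 k := by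
  refine Fin.cases ?_ (fun k => ?_) k
  · simp only [u, Fin.cons_zero]
    have e : ∀ ω, (((ψ ω).1 \ (φ ω).1).ncard : ℝ) = (pts (ψ ω) {z | z ∈ (φ ω).1ᶜ}).toReal := by
      intro ω
      rw [pts_apply, toReal_encard]
      rfl
    simp_rw [e]
    exact (measurable_pts_preimage hψ (s := {q : Ω × Plane | q.2 ∈ (φ q.1).1ᶜ})
      (measurableSet_mem (hφ.comp measurable_fst) measurable_snd).compl).ennreal_toReal
  · simp only [u, Fin.cons_succ]
    have hu := measurable_union hψ hφ
    have a := measurable_ncard_edges (β₀ := β₀) (s := d k.castSucc) (t := d k.succ) h0 hu hφ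
    have b := measurable_ncard_edges (β₀ := β₀) (s := d k.castSucc) (t := d k.succ) h0 hφ hu
    exact a.sub b

theorem measurable_V {ψ φ : Ω → Config} (hψ : Measurable ψ) (hφ : Measurable φ) :
    Measurable fun ω => V β₀ d θ (ψ ω).1 (φ ω).1 :=
  Finset.measurable_fun_sum _ fun k _ => measurable_const.mul (measurable_u h0 d hψ hφ k)

end Measurability

/-! ### The Poisson process -/

theorem lintegral_poisson (Λ : Set Plane) {G : Config → ENNReal} (hG : Measurable G) :
    ∫⁻ ψ, G ψ ∂poisson Λ = ENNReal.ofReal (Real.exp (-volume.real Λ)) *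
      ∑' n : ℕ, (n.factorial : ENNReal)⁻¹ *
        ∫⁻ t, G (Config.ofTuple t) ∂Measure.pi fun _ : Fin n => volume.restrict Λ := by
  rw [poisson, lintegral_smul_measure, lintegral_sum_measure, smul_eq_mul]
  congr 2
  ext n
  rw [lintegral_smul_measure, lintegral_map hG (measurable_ofTuple n), smul_eq_mul]

/-- Only the empty configuration, the term `n = 0` of the series, is kept. -/
theorem le_lintegral_poisson (Λ : Set Plane) {G : Config → ENNReal} (hG : Measurable G) {a : ENNReal}
    (h : ∀ t : Fin 0 → Plane, a ≤ G (Config.ofTuple t)) :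
    ENNReal.ofReal (Real.exp (-volume.real Λ)) * a ≤ ∫⁻ ψ, G ψ ∂poisson Λ := by
  rw [lintegral_poisson Λ hG]
  gcongr
  refine le_trans ?_ (ENNReal.le_tsum 0)
  rw [Nat.factorial_zero, Nat.cast_one, inv_one, one_mul]
  calc a = ∫⁻ _, a ∂Measure.pi fun _ : Fin 0 => volume.restrict Λ := by simp
    _ ≤ _ := lintegral_mono h

theorem ae_poisson {Λ : Set Plane} {p : Config → Prop} (hp : MeasurableSet {ψ | p ψ})
    (h : ∀ n : ℕ, ∀ᵐ t ∂Measure.pi fun _ : Fin n => volume.restrict Λ, p (Config.ofTuple t)) :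
    ∀ᵐ ψ ∂poisson Λ, p ψ := by
  refine Measure.ae_smul_measure ?_ _
  rw [Measure.ae_sum_iff' hp]
  intro n
  refine Measure.ae_smul_measure ?_ _
  exact (ae_map_iff (measurable_ofTuple n).aemeasurable hp).2 (h n)

theorem lintegral_poisson_lt_top {Λ : Set Plane} (hb : Bornology.IsBounded Λ)
    {G : Config → ENNReal} (hG : Measurable G) {a : ℝ} (ha : 0 ≤ a)
    (h : ∀ (n : ℕ) (t : Fin n → Plane), G (Config.ofTuple t) ≤ ENNReal.ofReal (a ^ n)) :
    ∫⁻ ψ, G ψ ∂poisson Λ < ⊤ := by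
  have hfin : volume Λ < ⊤ := hb.measure_lt_top
  rw [lintegral_poisson Λ hG]
  refine ENNReal.mul_lt_top ENNReal.ofReal_lt_top ?_
  have hle : ∀ n : ℕ, (n.factorial : ENNReal)⁻¹ *
      ∫⁻ t, G (Config.ofTuple t) ∂Measure.pi (fun _ : Fin n => volume.restrict Λ) ≤
      ENNReal.ofReal ((a * volume.real Λ) ^ n / n.factorial) := by
    intro n
    have h2 : ∫⁻ t, G (Config.ofTuple t) ∂Measure.pi (fun _ : Fin n => volume.restrict Λ) ≤
        ENNReal.ofReal (a ^ n) * volume Λ ^ n := by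
      refine (lintegral_mono (h n)).trans ?_
      have : IsFiniteMeasure (volume.restrict Λ) := ⟨by simpa using hfin⟩
      rw [lintegral_const, Measure.pi_univ]
      simp
    rw [ENNReal.ofReal_div_of_pos (by positivity), mul_pow, ENNReal.ofReal_mul (by positivity),
      div_eq_mul_inv, mul_comm, ENNReal.ofReal_natCast]
    gcongr
    rw [ENNReal.ofReal_pow measureReal_nonneg, Measure.real, ENNReal.ofReal_toReal hfin.ne]
    exact h2
  refine (ENNReal.tsum_le_tsum hle).trans_lt ?_
  rw [← ENNReal.ofReal_tsum_of_nonneg (fun n => by positivity) (Real.summable_pow_div_factorial _)]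
  exact ENNReal.ofReal_lt_top

theorem isFiniteMeasure_poisson {Λ : Set Plane} (hb : Bornology.IsBounded Λ) :
    IsFiniteMeasure (poisson Λ) := by
  constructor
  have := lintegral_poisson_lt_top hb (G := fun _ => 1) measurable_const (a := 1) zero_le_one
    (fun n t => by simp)
  simpa using this

theorem ae_poisson_subset {Λ : Set Plane} (hΛ : MeasurableSet Λ) (hb : Bornology.IsBounded Λ) :
    ∀ᵐ ψ ∂poisson Λ, ψ.1 ⊆ Λ := by
  have : IsFiniteMeasure (volume.restrict Λ) := ⟨by simpa using hb.measure_lt_top⟩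
  refine ae_poisson ?_ fun n => ?_
  · exact measurableSet_forall_mem measurable_id (s := {q : Config × Plane | q.2 ∈ Λ})
      (measurable_snd hΛ)
  · have h1 : ∀ i : Fin n, ∀ᵐ t ∂Measure.pi (fun _ : Fin n => volume.restrict Λ), t i ∈ Λ :=
      fun i => (Measure.quasiMeasurePreserving_eval (fun _ : Fin n => volume.restrict Λ) i).ae
        (ae_restrict_mem hΛ)
    filter_upwards [ae_all_iff.2 h1] with t ht
    rintro _ ⟨i, rfl⟩
    exact ht i

/-- `Config.ofTuple` merges repeated entries; coincidences are negligible because single points are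
null. -/
theorem ae_pi_injective (μ : Measure Plane) [SigmaFinite μ] [NullSingletonClass μ] (n : ℕ) :
    ∀ᵐ t ∂Measure.pi (fun _ : Fin (n + 1) => μ), Injective t := by
  have h1 : ∀ i : Fin (n + 1), ∀ᵐ t ∂Measure.pi (fun _ : Fin (n + 1) => μ),
      ∀ j : Fin n, t i ≠ t (i.succAbove j) := by
    intro i
    have hmp := measurePreserving_piFinSuccAbove (fun _ : Fin (n + 1) => μ) i
    refine hmp.quasiMeasurePreserving.ae
      (p := fun q : Plane × (Fin n → Plane) => ∀ j, q.1 ≠ q.2 j) ?_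
    rw [ae_all_iff]
    intro j
    have hm : MeasurableSet {q : Plane × (Fin n → Plane) | q.1 ≠ q.2 j} :=
      (measurableSet_eq_fun (g := fun q : Plane × (Fin n → Plane) => q.2 j) measurable_fst
        ((measurable_pi_apply j).comp measurable_snd)).compl
    rw [Measure.ae_prod_iff_ae_ae hm, Measure.ae_ae_comm hm]
    exact Filter.Eventually.of_forall fun y => compl_mem_ae_iff.2 (measure_singleton (y j))
  filter_upwards [ae_all_iff.2 h1] with t ht i j hij
  by_contra hne
  obtain ⟨k, hk⟩ := Fin.exists_succAbove_eq (Ne.symm hne)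
  exact ht i k (by rw [hk, hij])

theorem lintegral_pts_ofTuple {n : ℕ} {t : Fin n → Plane} (ht : Injective t)
    (f : Plane → ENNReal) : ∫⁻ x, f x ∂pts (Config.ofTuple t) = ∑ i, f (t i) := by
  rw [lintegral_pts]
  change ∑' a : range t, f a = _
  rw [← (Equiv.ofInjective t ht).tsum_eq, tsum_fintype]
  rfl

theorem erase_ofTuple {n : ℕ} {t : Fin (n + 1) → Plane} (ht : Injective t) (i : Fin (n + 1)) :
    (Config.ofTuple t).erase (t i) = Config.ofTuple (i.removeNth t) := by
  apply Config.ext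
  ext z
  change ((∃ j, t j = z) ∧ ¬z = t i) ↔ ∃ k, t (i.succAbove k) = z
  constructor
  · rintro ⟨⟨j, rfl⟩, hj⟩
    obtain ⟨k, hk⟩ := Fin.exists_succAbove_eq (x := j) (y := i) (fun h => hj (h ▸ rfl))
    exact ⟨k, by rw [hk]⟩
  · rintro ⟨k, rfl⟩
    exact ⟨⟨_, rfl⟩, fun h => Fin.succAbove_ne i k (ht h)⟩

/-- The Mecke formula. -/
theorem mecke {Λ : Set Plane} (hb : Bornology.IsBounded Λ)
    {F : Plane → Config → ENNReal} (hF : Measurable (uncurry F)) :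
    ∫⁻ ψ, ∫⁻ x, F x (ψ.erase x) ∂pts ψ ∂poisson Λ =
      ∫⁻ ψ, (∫⁻ x in Λ, F x ψ) ∂poisson Λ := by
  have : IsFiniteMeasure (volume.restrict Λ) := ⟨by simpa using hb.measure_lt_top⟩
  have hL : Measurable fun ψ : Config => ∫⁻ x, F x (ψ.erase x) ∂pts ψ :=
    measurable_lintegral_pts measurable_id
      (hF.comp (measurable_snd.prodMk (measurable_erase measurable_snd measurable_fst)))
  have hR : Measurable fun ψ : Config => ∫⁻ x in Λ, F x ψ :=
    Measurable.lintegral_prod_left' hF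
  rw [lintegral_poisson Λ hL, lintegral_poisson Λ hR]
  congr 1
  -- The term `n = 0` on the left vanishes. The term `n + 1` on the left matches the term `n` on the
  -- right: the `n + 1` choices of the erased point turn `1 / (n + 1)!` into `1 / n!`.
  rw [tsum_eq_zero_add' ENNReal.summable]
  have hzero : ∫⁻ t, ∫⁻ x, F x ((Config.ofTuple t).erase x) ∂pts (Config.ofTuple t)
      ∂Measure.pi (fun _ : Fin 0 => volume.restrict Λ) = 0 := by
    rw [lintegral_eq_zero_of_ae_eq_zero]
    refine Filter.Eventually.of_forall fun t => ?_
    beta_reduce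
    rw [lintegral_pts_ofTuple (injective_of_subsingleton t)]
    simp
  rw [hzero, mul_zero, zero_add]
  refine tsum_congr fun n => ?_
  have hstep : ∫⁻ t, ∫⁻ x, F x ((Config.ofTuple t).erase x) ∂pts (Config.ofTuple t)
      ∂Measure.pi (fun _ : Fin (n + 1) => volume.restrict Λ) =
      (n + 1 : ℕ) * ∫⁻ t, (∫⁻ x in Λ, F x (Config.ofTuple t))
        ∂Measure.pi (fun _ : Fin n => volume.restrict Λ) := by
    have e1 : ∫⁻ t, ∫⁻ x, F x ((Config.ofTuple t).erase x) ∂pts (Config.ofTuple t)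
        ∂Measure.pi (fun _ : Fin (n + 1) => volume.restrict Λ) =
        ∫⁻ t, ∑ i, F (t i) (Config.ofTuple (i.removeNth t))
          ∂Measure.pi (fun _ : Fin (n + 1) => volume.restrict Λ) := by
      refine lintegral_congr_ae ?_
      filter_upwards [ae_pi_injective (volume.restrict Λ) n] with t ht
      rw [lintegral_pts_ofTuple ht]
      exact Finset.sum_congr rfl fun i _ => by rw [erase_ofTuple ht]
    have hG : Measurable fun q : Plane × (Fin n → Plane) => F q.1 (Config.ofTuple q.2) :=
      hF.comp (measurable_fst.prodMk ((measurable_ofTuple n).comp measurable_snd))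
    have e2 : ∀ i : Fin (n + 1), ∫⁻ t, F (t i) (Config.ofTuple (i.removeNth t))
          ∂Measure.pi (fun _ : Fin (n + 1) => volume.restrict Λ) =
        ∫⁻ t, (∫⁻ x in Λ, F x (Config.ofTuple t))
          ∂Measure.pi (fun _ : Fin n => volume.restrict Λ) := by
      intro i
      have hmp := measurePreserving_piFinSuccAbove (fun _ : Fin (n + 1) => volume.restrict Λ) i
      have h3 := hmp.lintegral_comp hG
      rw [lintegral_prod_symm' _ hG] at h3
      exact h3
    rw [e1, lintegral_finsetSum]
    · simp_rw [e2]
      simp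
    · intro i _
      exact hG.comp (MeasurableEquiv.piFinSuccAbove (fun _ : Fin (n + 1) => Plane) i).measurable
  rw [hstep, ← mul_assoc]
  congr 1
  rw [Nat.factorial_succ, Nat.cast_mul, ENNReal.mul_inv (by simp) (by simp), mul_comm, ← mul_assoc,
    ENNReal.mul_inv_cancel (by simp) (by simp), one_mul]

/-! ### The Dobrushin-Lanford-Ruelle and Georgii-Nguyen-Zessin equations -/

/-- The weight `exp(-V(ψ | φ))`. -/
def boltzmann {p : ℕ} (β₀ : ℝ) (d θ : Fin (p + 1) → ℝ) (ψ φ : Config) : ENNReal :=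
  ENNReal.ofReal (Real.exp (-V β₀ d θ ψ.1 φ.1))

section Gibbs

variable {p : ℕ} {β₀ : ℝ} (h0 : 0 < β₀) (h1 : β₀ < Real.pi / 3) (d θ : Fin (p + 1) → ℝ)
  {Λ : Set Plane} (hΛ : MeasurableSet Λ) (hb : Bornology.IsBounded Λ)

include h0

theorem measurable_boltzmann {Ω : Type*} [MeasurableSpace Ω] {ψ φ : Ω → Config}
    (hψ : Measurable ψ) (hφ : Measurable φ) :
    Measurable fun ω => boltzmann β₀ d θ (ψ ω) (φ ω) :=
  ENNReal.measurable_ofReal.comp (Real.measurable_exp.comp (measurable_V h0 d θ hψ hφ).neg)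

omit h0 in
theorem partitionFunction_eq (φ : Config) : partitionFunction β₀ d θ Λ φ =
    ∫⁻ ψ, boltzmann β₀ d θ ψ (φ.restrict Λᶜ) ∂poisson Λ := by
  simp [partitionFunction, weight, boltzmann]

theorem le_partitionFunction (φ : Config) :
    ENNReal.ofReal (Real.exp (-volume.real Λ)) ≤ partitionFunction β₀ d θ Λ φ := by
  rw [partitionFunction_eq]
  refine le_trans ?_ (le_lintegral_poisson Λ
    (measurable_boltzmann h0 d θ measurable_id measurable_const) (a := 1) fun t => ?_)
  · rw [mul_one]
  · have : (Config.ofTuple t).1 = ∅ := range_eq_empty t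
    simp [boltzmann, this, V_empty]

theorem partitionFunction_pos (φ : Config) : 0 < partitionFunction β₀ d θ Λ φ :=
  lt_of_lt_of_le (ENNReal.ofReal_pos.2 (Real.exp_pos _)) (le_partitionFunction h0 d θ φ)

include h1 hb in
theorem partitionFunction_lt_top (φ : Config) : partitionFunction β₀ d θ Λ φ < ⊤ := by
  obtain ⟨K, hK, hstab⟩ := exists_stability h0 h1 d θ
  rw [partitionFunction_eq]
  refine lintegral_poisson_lt_top hb (measurable_boltzmann h0 d θ measurable_id measurable_const)
    (a := Real.exp K) (Real.exp_pos K).le fun n t => ?_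
  refine ENNReal.ofReal_le_ofReal ?_
  rw [← Real.exp_nat_mul, Real.exp_le_exp]
  have hf : (Config.ofTuple t).1.Finite := finite_range t
  have hc : ((Config.ofTuple t).1.ncard : ℝ) ≤ n := by
    have : (range t).ncard ≤ n := by
      rw [← image_univ]
      refine (ncard_image_le finite_univ).trans ?_
      simp
    exact_mod_cast this
  have := (abs_le.1 (hstab _ (φ.restrict Λᶜ).1 hf)).1
  nlinarith

omit h0 in
theorem weight_eq (φ : Config) (Y : Set Config) : weight β₀ d θ Λ φ Y =
    ∫⁻ ψ, boltzmann β₀ d θ ψ (φ.restrict Λᶜ) * Y.indicator 1 (ψ.union (φ.restrict Λᶜ))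
      ∂poisson Λ := rfl

include hΛ in
omit h0 in
theorem measurable_resample {Ω : Type*} [MeasurableSpace Ω] {ψ φ : Ω → Config}
    (hψ : Measurable ψ) (hφ : Measurable φ) :
    Measurable fun ω => (ψ ω).union ((φ ω).restrict Λᶜ) :=
  measurable_union hψ ((measurable_restrict hΛ.compl).comp hφ)

include hΛ hb in
theorem measurable_lintegral_boltzmann {F : Config → ENNReal} (hF : Measurable F) :
    Measurable fun φ : Config => ∫⁻ ψ, boltzmann β₀ d θ ψ (φ.restrict Λᶜ) *
      F (ψ.union (φ.restrict Λᶜ)) ∂poisson Λ := by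
  have := isFiniteMeasure_poisson hb
  refine Measurable.lintegral_prod_right' (ν := poisson Λ)
    (f := fun q : Config × Config => boltzmann β₀ d θ q.2 (q.1.restrict Λᶜ) *
      F (q.2.union (q.1.restrict Λᶜ))) ?_
  exact (measurable_boltzmann h0 d θ measurable_snd
    ((measurable_restrict hΛ.compl).comp measurable_fst)).mul
    (hF.comp (measurable_resample hΛ measurable_snd measurable_fst))

include hΛ hb in
theorem measurable_partitionFunction :
    Measurable fun φ : Config => partitionFunction β₀ d θ Λ φ := by
  have := measurable_lintegral_boltzmann h0 d θ hΛ hb (F := 1) measurable_one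
  simpa [partitionFunction_eq] using this

variable {P : Measure Config} [IsProbabilityMeasure P]

include h1 hΛ hb

/-- The DLR equation is integrated over `φ`. The partition function is positive and finite, so the
exceptional value of the specification never occurs, and the bound by `1` allows passing from real
integrals back to `ENNReal`. -/
theorem IsGibbs.measure_eq (hG : IsGibbs β₀ d θ P) {Y : Set Config} (hY : MeasurableSet Y) :
    P Y = ∫⁻ φ, (partitionFunction β₀ d θ Λ φ)⁻¹ * weight β₀ d θ Λ φ Y ∂P := by
  have hspec : ∀ φ, specification β₀ d θ Λ φ Y =
      (partitionFunction β₀ d θ Λ φ)⁻¹ * weight β₀ d θ Λ φ Y := fun φ =>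
    if_pos ⟨partitionFunction_pos h0 d θ φ, partitionFunction_lt_top h0 h1 d θ hb φ⟩
  have hle : ∀ φ, specification β₀ d θ Λ φ Y ≤ 1 := by
    intro φ
    rw [hspec]
    calc (partitionFunction β₀ d θ Λ φ)⁻¹ * weight β₀ d θ Λ φ Y
        ≤ (partitionFunction β₀ d θ Λ φ)⁻¹ * partitionFunction β₀ d θ Λ φ := by
          gcongr
          rw [partitionFunction_eq, weight_eq]
          refine lintegral_mono fun ψ => ?_
          refine mul_le_of_le_one_right' ?_
          exact indicator_le_self' (fun _ _ => zero_le) _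
      _ ≤ 1 := ENNReal.inv_mul_le_one _
  have hm : Measurable fun φ => specification β₀ d θ Λ φ Y := by
    simp_rw [hspec]
    refine (measurable_partitionFunction h0 d θ hΛ hb).inv.mul ?_
    exact measurable_lintegral_boltzmann h0 d θ hΛ hb (measurable_one.indicator hY)
  have e1 := integral_congr_ae (hG Λ hΛ hb Y hY)
  rw [integral_condExp (countField_le _), integral_indicator hY,
    integral_toReal hm.aemeasurable
      (Filter.Eventually.of_forall fun φ => (hle φ).trans_lt ENNReal.one_lt_top)] at e1
  simp only [integral_const, smul_eq_mul, mul_one, measureReal_restrict_apply_univ] at e1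
  have hfin : ∫⁻ φ, specification β₀ d θ Λ φ Y ∂P ≠ ⊤ := by
    refine ne_top_of_le_ne_top ENNReal.one_ne_top ((lintegral_mono hle).trans ?_)
    simp
  have e2 := (ENNReal.toReal_eq_toReal_iff' (measure_ne_top P Y) hfin).1 e1
  simpa only [hspec] using e2

/-- The DLR equations for nonnegative functions. -/
theorem IsGibbs.lintegral_eq (hG : IsGibbs β₀ d θ P) {F : Config → ENNReal} (hF : Measurable F) :
    ∫⁻ φ, F φ ∂P = ∫⁻ φ, (partitionFunction β₀ d θ Λ φ)⁻¹ *
      ∫⁻ ψ, boltzmann β₀ d θ ψ (φ.restrict Λᶜ) * F (ψ.union (φ.restrict Λᶜ)) ∂poisson Λ ∂P := by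
  have := isFiniteMeasure_poisson hb
  set f : Config × Config → ENNReal := fun q => (partitionFunction β₀ d θ Λ q.1)⁻¹ *
    boltzmann β₀ d θ q.2 (q.1.restrict Λᶜ) with hf
  set g : Config × Config → Config := fun q => q.2.union (q.1.restrict Λᶜ) with hg
  have hbm : Measurable fun q : Config × Config => boltzmann β₀ d θ q.2 (q.1.restrict Λᶜ) :=
    measurable_boltzmann h0 d θ measurable_snd
      ((measurable_restrict hΛ.compl).comp measurable_fst)
  have hfm : Measurable f :=
    ((measurable_partitionFunction h0 d θ hΛ hb).comp measurable_fst).inv.mul hbm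
  have hgm : Measurable g := measurable_resample hΛ measurable_snd measurable_fst
  have key : ∀ G : Config → ENNReal, Measurable G →
      ∫⁻ φ, G φ ∂(((P.prod (poisson Λ)).withDensity f).map g) =
      ∫⁻ φ, (partitionFunction β₀ d θ Λ φ)⁻¹ *
        ∫⁻ ψ, boltzmann β₀ d θ ψ (φ.restrict Λᶜ) * G (ψ.union (φ.restrict Λᶜ)) ∂poisson Λ ∂P := by
    intro G hGm
    rw [lintegral_map hGm hgm, lintegral_withDensity_eq_lintegral_mul _ hfm
      (g := fun q => G (g q)) (hGm.comp hgm),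
      lintegral_prod (f * fun q => G (g q)) (hfm.mul (hGm.comp hgm)).aemeasurable]
    refine lintegral_congr fun φ => ?_
    rw [← lintegral_const_mul]
    · refine lintegral_congr fun ψ => ?_
      simp only [Pi.mul_apply, hf, hg]
      rw [mul_assoc]
    · exact (measurable_boltzmann h0 d θ measurable_id measurable_const).mul
        (hGm.comp (measurable_union measurable_id measurable_const))
  -- Agreement on events identifies `P` with the law of the resampled configuration; functions
  -- follow from this equality of measures.
  have hP : P = ((P.prod (poisson Λ)).withDensity f).map g := by
    ext Y hY
    have h2 := key (Y.indicator 1) (measurable_one.indicator hY)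
    rw [lintegral_indicator_one hY] at h2
    rw [h2, IsGibbs.measure_eq h0 h1 d θ hΛ hb hG hY]
    rfl
  rw [← key F hF, ← hP]

/-- The Georgii-Nguyen-Zessin formula. -/
theorem IsGibbs.gnz (hG : IsGibbs β₀ d θ P) {F : Plane → Config → ENNReal}
    (hF : Measurable (uncurry F)) :
    ∫⁻ φ, (∫⁻ x in Λ, F x (φ.erase x) ∂pts φ) ∂P =
      ∫⁻ φ, (∫⁻ x in Λ, boltzmann β₀ d θ (Config.single x) φ * F x φ) ∂P := by
  have hA : Measurable fun φ : Config => ∫⁻ x in Λ, F x (φ.erase x) ∂pts φ := by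
    simp_rw [← lintegral_indicator hΛ]
    refine measurable_lintegral_pts measurable_id ?_
    have : (uncurry fun (φ : Config) (x : Plane) => Λ.indicator (fun x => F x (φ.erase x)) x) =
        (Prod.snd ⁻¹' Λ).indicator fun q : Config × Plane => F q.2 (q.1.erase q.2) := by
      ext q; rfl
    rw [this]
    exact (hF.comp (measurable_snd.prodMk
      (measurable_erase measurable_snd measurable_fst))).indicator (measurable_snd hΛ)
  have hH : Measurable (uncurry fun (x : Plane) (φ : Config) =>
      boltzmann β₀ d θ (Config.single x) φ * F x φ) :=
    (measurable_boltzmann h0 d θ (measurable_single.comp measurable_fst) measurable_snd).mul hF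
  have hB : Measurable fun φ : Config => ∫⁻ x in Λ, boltzmann β₀ d θ (Config.single x) φ * F x φ :=
    Measurable.lintegral_prod_left' hH
  rw [IsGibbs.lintegral_eq h0 h1 d θ hΛ hb hG hA, IsGibbs.lintegral_eq h0 h1 d θ hΛ hb hG hB]
  refine lintegral_congr fun φ => congrArg _ ?_
  set η := φ.restrict Λᶜ with hη
  have hηΛ : ∀ x ∈ Λ, x ∉ η.1 := fun x hx h => h.2 hx
  -- Given the exterior `η`, both sides become Poisson integrals in `Λ`, and `H` is the function to
  -- which the Mecke formula is applied.
  set H : Plane → Config → ENNReal := fun x χ => boltzmann β₀ d θ χ η *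
    (boltzmann β₀ d θ (Config.single x) (χ.union η) * F x (χ.union η)) with hHdef
  have hHm : Measurable (uncurry H) := by
    have hu : Measurable fun q : Plane × Config => q.2.union η :=
      measurable_union measurable_snd measurable_const
    exact (measurable_boltzmann h0 d θ measurable_snd measurable_const).mul
      ((measurable_boltzmann h0 d θ (measurable_single.comp measurable_fst) hu).mul
        (hF.comp (measurable_fst.prodMk hu)))
  calc ∫⁻ ψ, boltzmann β₀ d θ ψ η *
        (∫⁻ x in Λ, F x ((ψ.union η).erase x) ∂pts (ψ.union η)) ∂poisson Λ
      = ∫⁻ ψ, ∫⁻ x, H x (ψ.erase x) ∂pts ψ ∂poisson Λ := by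
        refine lintegral_congr_ae ?_
        filter_upwards [ae_poisson_subset hΛ hb] with ψ hψ
        have hfin : ψ.1.Finite := by
          have := ψ.2 Λ hb
          rwa [inter_eq_left.2 hψ] at this
        have hsum : ∫⁻ x in Λ, F x ((ψ.union η).erase x) ∂pts (ψ.union η) =
            ∫⁻ x, F x ((ψ.union η).erase x) ∂pts ψ := by
          rw [← lintegral_indicator hΛ, lintegral_pts, lintegral_pts,
            tsum_subtype (ψ.union η).1 (fun x => Λ.indicator (fun x => F x ((ψ.union η).erase x)) x),
            tsum_subtype ψ.1 (fun x => F x ((ψ.union η).erase x))]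
          refine tsum_congr fun x => ?_
          by_cases hx : x ∈ ψ.1
          · have hx2 : x ∈ (ψ.union η).1 := Or.inl hx
            rw [indicator_of_mem hx2, indicator_of_mem (hψ hx), indicator_of_mem hx]
          · rw [indicator_of_notMem hx]
            by_cases hx2 : x ∈ (ψ.union η).1
            · have hxΛ : x ∉ Λ := fun h => hηΛ x h (hx2.resolve_left hx)
              rw [indicator_of_mem hx2, indicator_of_notMem hxΛ]
            · rw [indicator_of_notMem hx2]
        rw [hsum, lintegral_pts, lintegral_pts, ← ENNReal.tsum_mul_left]
        refine tsum_congr fun x => ?_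
        have hx : (x : Plane) ∈ ψ.1 := x.2
        have hx2 : (x : Plane) ∉ η.1 := hηΛ _ (hψ hx)
        have e1 : (ψ.union η).erase x = (ψ.erase x).union η := by
          apply Config.ext
          ext z
          change ((z ∈ ψ.1 ∨ z ∈ η.1) ∧ ¬z = x) ↔ ((z ∈ ψ.1 ∧ ¬z = x) ∨ z ∈ η.1)
          constructor
          · tauto
          · rintro (h | h)
            · tauto
            · exact ⟨Or.inr h, fun hz => hx2 (hz ▸ h)⟩
        -- Additivity of the energy: the weight of `ψ` is the weight of `ψ \ x` times the
        -- conditional intensity of `x`.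
        have e2 : boltzmann β₀ d θ ψ η = boltzmann β₀ d θ (ψ.erase x) η *
            boltzmann β₀ d θ (Config.single x) ((ψ.erase x).union η) := by
          have e3 : ψ.1 = {(x : Plane)} ∪ (ψ.erase x).1 := by
            rw [Config.coe_erase, union_sdiff_self, union_eq_self_of_subset_left
              (singleton_subset_iff.2 hx)]
          have e4 := V_insert h0 h1 d θ (ψ := (ψ.erase x).1) (hfin.subset sdiff_subset) η.1 x
          rw [← e3] at e4
          rw [boltzmann, e4, neg_add, Real.exp_add, ENNReal.ofReal_mul (Real.exp_pos _).le]
          rfl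
        rw [e1, e2, hHdef, mul_assoc]
    _ = ∫⁻ ψ, (∫⁻ x in Λ, H x ψ) ∂poisson Λ := mecke hb hHm
    _ = _ := by
        refine lintegral_congr fun ψ => ?_
        have hm := hH.of_uncurry_right (y := ψ.union η)
        exact lintegral_const_mul _ hm

end Gibbs

/-! ### Innovations -/

/-- Bounded, measurable, translation invariant functions of a point and a configuration that
depend only on the points at distance at most `R`. -/
structure IsLocal (R : ℝ) (F : Plane → Config → ℝ) : Prop where
  meas : Measurable (uncurry F)
  bdd : ∃ K : ℝ, 0 ≤ K ∧ ∀ x φ, |F x φ| ≤ K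
  range (x : Plane) (φ : Config) : F x φ = F x (φ.restrict (Metric.closedBall x R))
  shift : ∀ v x φ, F (x + v) (φ.translate v) = F x φ

theorem Config.restrict_restrict (φ : Config) {S T : Set Plane} (h : T ⊆ S) :
    (φ.restrict S).restrict T = φ.restrict T :=
  Config.ext (by rw [coe_restrict, coe_restrict, coe_restrict, inter_assoc, inter_eq_right.2 h])

theorem IsLocal.congr {R : ℝ} {F : Plane → Config → ℝ} (h : IsLocal R F) {x : Plane}
    {φ ψ : Config} (he : φ.restrict (Metric.closedBall x R) = ψ.restrict (Metric.closedBall x R)) :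
    F x φ = F x ψ := by
  rw [h.range x φ, h.range x ψ, he]

theorem IsLocal.mono {R R' : ℝ} {F : Plane → Config → ℝ} (h : IsLocal R F) (hR : R ≤ R') :
    IsLocal R' F :=
  ⟨h.meas, h.bdd, fun _ _ => h.congr
    (Config.restrict_restrict _ (Metric.closedBall_subset_closedBall hR)).symm, h.shift⟩

theorem IsLocal.add_smul {R : ℝ} {F G : Plane → Config → ℝ} (hF : IsLocal R F) (hG : IsLocal R G)
    (a : ℝ) : IsLocal R fun x φ => F x φ + a * G x φ := by
  obtain ⟨K, hK, hKb⟩ := hF.bdd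
  obtain ⟨L, hL, hLb⟩ := hG.bdd
  refine ⟨hF.meas.add (hG.meas.const_mul a), ⟨K + |a| * L, by positivity, fun x φ => ?_⟩,
    fun x φ => ?_, fun v x φ => ?_⟩
  · refine (abs_add_le _ _).trans ?_
    rw [abs_mul]
    gcongr
    exacts [hKb x φ, hLb x φ]
  · rw [hF.range x φ, hG.range x φ]
  · rw [hF.shift, hG.shift]

theorem IsLocal.zero (R : ℝ) : IsLocal R fun _ _ => 0 :=
  ⟨measurable_const, ⟨0, le_rfl, by simp⟩, fun _ _ => rfl, fun _ _ _ => rfl⟩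

theorem IsLocal.sum {ι : Type*} {R : ℝ} {F : ι → Plane → Config → ℝ} (hF : ∀ k, IsLocal R (F k))
    (y : ι → ℝ) (s : Finset ι) : IsLocal R fun x φ => ∑ k ∈ s, y k * F k x φ := by
  classical
  induction s using Finset.induction_on with
  | empty => simpa using IsLocal.zero R
  | insert a s ha ih =>
    have := ih.add_smul (hF a) (y a)
    simpa [Finset.sum_insert ha, add_comm] using this

open Classical in
theorem sum_dirac_apply (S : Finset Plane) (B : Set Plane) (hB : MeasurableSet B) :
    (∑ x ∈ S, Measure.dirac x) B = ((S.filter (· ∈ B)).card : ENNReal) := by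
  rw [Measure.finsetSum_apply, Finset.card_filter, Nat.cast_sum]
  refine Finset.sum_congr rfl fun x _ => ?_
  rw [Measure.dirac_apply' _ hB]
  by_cases hx : x ∈ B <;> simp [hx]

theorem restrict_pts (φ : Config) {C : Set Plane} (hb : Bornology.IsBounded C) :
    (pts φ).restrict C = ∑ x ∈ (φ.2 C hb).toFinset, Measure.dirac x := by
  classical
  ext B hB
  rw [Measure.restrict_apply hB, sum_dirac_apply _ _ hB,
    pts_apply_of_bounded φ (hb.subset inter_subset_right)]
  have : φ.1 ∩ (B ∩ C) = ((φ.2 C hb).toFinset.filter (· ∈ B) : Finset Plane) := by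
    ext z; simp only [mem_inter_iff, Finset.coe_filter, Finite.mem_toFinset, mem_ofPred_eq]; tauto
  rw [this, ncard_coe_finset]

theorem integrable_restrict_pts (φ : Config) {C : Set Plane}
    (hb : Bornology.IsBounded C) (f : Plane → ℝ) : Integrable f ((pts φ).restrict C) := by
  rw [restrict_pts φ hb]
  exact integrable_finsetSum_measure.2 fun x _ => integrable_dirac (by simp)

theorem setIntegral_pts (φ : Config) {C : Set Plane}
    (hb : Bornology.IsBounded C) (f : Plane → ℝ) :
    ∫ x in C, f x ∂pts φ = ∑ x ∈ (φ.2 C hb).toFinset, f x := by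
  rw [restrict_pts φ hb, integral_finsetSum_measure fun x _ => integrable_dirac (by simp)]
  simp

theorem abs_setIntegral_pts_le (φ : Config) {C : Set Plane}
    (hb : Bornology.IsBounded C) {f : Plane → ℝ} {K : ℝ} (hf : ∀ x, |f x| ≤ K) :
    |∫ x in C, f x ∂pts φ| ≤ K * (pts φ C).toReal := by
  rw [setIntegral_pts φ hb, pts_apply_of_bounded φ hb, ENNReal.toReal_natCast,
    ncard_eq_toFinset_card _ (φ.2 C hb), mul_comm, ← nsmul_eq_mul]
  exact (Finset.abs_sum_le_sum_abs _ _).trans (Finset.sum_le_card_nsmul _ _ _ fun x _ => hf x)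

theorem IsLocal.integrableOn_mul {D R : ℝ} {lam F : Plane → Config → ℝ} (hl : IsLocal D lam)
    (hF : IsLocal R F) {C : Set Plane} (hb : Bornology.IsBounded C) (φ : Config) :
    IntegrableOn (fun x => F x φ * lam x φ) C := by
  obtain ⟨L, hL, hle⟩ := hl.bdd
  obtain ⟨K, hK, hKb⟩ := hF.bdd
  have hm : Measurable fun x => F x φ * lam x φ :=
    (hF.meas.comp (measurable_prodMk_right (y := φ))).mul
      (hl.meas.comp (measurable_prodMk_right (y := φ)))
  have : IsFiniteMeasure (volume.restrict C) := ⟨by simpa using hb.measure_lt_top⟩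
  refine Integrable.of_bound (C := K * L) hm.aestronglyMeasurable
    (Filter.Eventually.of_forall fun x => ?_)
  rw [Real.norm_eq_abs, abs_mul]
  exact mul_le_mul (hKb x φ) (hle x φ) (abs_nonneg _) hK

/-- The innovation of `F` over the set `C` for the conditional intensity `lam`. -/
def innov (lam F : Plane → Config → ℝ) (C : Set Plane) (φ : Config) : ℝ :=
  (∫ x in C, F x φ * lam x φ) - ∫ x in C, F x (φ.erase x) ∂pts φ

/-- A stationary probability measure with the local conditional intensity `lam`. -/
structure HasIntensity (P : Measure Config) (lam : Plane → Config → ℝ) (D : ℝ) : Prop where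
  gnz : ∀ C : Set Plane, MeasurableSet C → Bornology.IsBounded C →
    ∀ F : Plane → Config → ENNReal, Measurable (uncurry F) →
      ∫⁻ φ, (∫⁻ x in C, F x (φ.erase x) ∂pts φ) ∂P =
        ∫⁻ φ, (∫⁻ x in C, ENNReal.ofReal (lam x φ) * F x φ) ∂P
  stat : IsStationary P
  loc : IsLocal D lam
  pos : ∀ x φ, 0 < lam x φ
  range_pos : 0 < D

section Innovations

variable {P : Measure Config} [IsProbabilityMeasure P] {lam : Plane → Config → ℝ} {D : ℝ}
  (hP : HasIntensity P lam D) {C : Set Plane} (hC : MeasurableSet C) (hb : Bornology.IsBounded C)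

omit [IsProbabilityMeasure P] in
include hP in
theorem exists_intensity_le : ∃ L : ℝ, 0 ≤ L ∧ ∀ x φ, lam x φ ≤ L := by
  obtain ⟨L, hL, h⟩ := hP.loc.bdd
  exact ⟨L, hL, fun x φ => (le_abs_self _).trans (h x φ)⟩

include hP hC hb

theorem lintegral_pts_lt_top : ∫⁻ φ, pts φ C ∂P < ⊤ := by
  obtain ⟨L, hL, hle⟩ := exists_intensity_le hP
  have h := hP.gnz C hC hb (fun _ _ => 1) measurable_const
  simp only [lintegral_const, Measure.restrict_apply_univ, one_mul, mul_one] at h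
  rw [h]
  calc ∫⁻ φ, (∫⁻ x in C, ENNReal.ofReal (lam x φ)) ∂P
      ≤ ∫⁻ _, (∫⁻ _ in C, ENNReal.ofReal L) ∂P :=
        lintegral_mono fun φ => lintegral_mono fun x => ENNReal.ofReal_le_ofReal (hle x φ)
    _ < ⊤ := by
      simp only [lintegral_const, Measure.restrict_apply_univ, measure_univ, mul_one]
      exact ENNReal.mul_lt_top ENNReal.ofReal_lt_top hb.measure_lt_top

/-- The square of the count is at most the sum over the points `x` of one plus the count without
`x`; the Georgii-Nguyen-Zessin formula turns this into a first moment, as the intensity is bounded.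
-/
theorem lintegral_pts_sq_lt_top : ∫⁻ φ, pts φ C ^ 2 ∂P < ⊤ := by
  obtain ⟨L, hL, hle⟩ := exists_intensity_le hP
  have hm : Measurable (uncurry fun (_ : Plane) (φ : Config) => pts φ C + 1) :=
    ((measurable_pts_apply hC).comp measurable_snd).add_const 1
  have h := hP.gnz C hC hb (fun _ φ => pts φ C + 1) hm
  have h1 : ∀ (φ : Config) (x : Plane), pts φ C ≤ pts (φ.erase x) C + 1 := by
    intro φ x
    rw [pts_apply_of_bounded φ hb, pts_apply_of_bounded _ hb]
    have h2 : φ.1 ∩ C ⊆ insert x ((φ.erase x).1 ∩ C) := by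
      intro z hz
      by_cases hzx : z = x
      · exact Or.inl hzx
      · exact Or.inr ⟨⟨hz.1, hzx⟩, hz.2⟩
    have h3 := ncard_le_ncard h2 (((φ.erase x).2 C hb).insert x)
    have h4 := ncard_insert_le x ((φ.erase x).1 ∩ C)
    exact_mod_cast h3.trans h4
  calc ∫⁻ φ, pts φ C ^ 2 ∂P
      ≤ ∫⁻ φ, (∫⁻ x in C, (pts (φ.erase x) C + 1) ∂pts φ) ∂P := by
        refine lintegral_mono fun φ => ?_
        calc pts φ C ^ 2 = ∫⁻ _ in C, pts φ C ∂pts φ := by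
              rw [lintegral_const, Measure.restrict_apply_univ, sq]
          _ ≤ _ := lintegral_mono fun x => h1 φ x
    _ = _ := h
    _ ≤ ∫⁻ φ, ENNReal.ofReal L * volume C * (pts φ C + 1) ∂P := by
        refine lintegral_mono fun φ => ?_
        calc ∫⁻ x in C, ENNReal.ofReal (lam x φ) * (pts φ C + 1)
            ≤ ∫⁻ _ in C, ENNReal.ofReal L * (pts φ C + 1) := by
              refine lintegral_mono fun x => ?_
              gcongr
              exact hle x φ
          _ = _ := by
              rw [lintegral_const, Measure.restrict_apply_univ]; ring
    _ < ⊤ := by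
        rw [lintegral_const_mul _ ((measurable_pts_apply hC).add_const 1),
          lintegral_add_right _ measurable_const]
        simp only [lintegral_const, measure_univ, mul_one]
        exact ENNReal.mul_lt_top (ENNReal.mul_lt_top ENNReal.ofReal_lt_top hb.measure_lt_top)
          (ENNReal.add_lt_top.2 ⟨lintegral_pts_lt_top hP hC hb, ENNReal.one_lt_top⟩)

theorem memLp_count : MemLp (fun φ => (pts φ C).toReal) 2 P := by
  have hm : Measurable fun φ : Config => (pts φ C).toReal :=
    (measurable_pts_apply hC).ennreal_toReal
  rw [memLp_two_iff_integrable_sq hm.aestronglyMeasurable]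
  refine ⟨(hm.pow_const 2).aestronglyMeasurable, ?_⟩
  rw [hasFiniteIntegral_iff_ofReal (Filter.Eventually.of_forall fun φ => sq_nonneg _)]
  refine lt_of_le_of_lt (lintegral_mono fun φ => ?_) (lintegral_pts_sq_lt_top hP hC hb)
  rw [ENNReal.ofReal_pow ENNReal.toReal_nonneg, ENNReal.ofReal_toReal (pts_lt_top φ hb).ne]

omit [IsProbabilityMeasure P] hb in
theorem measurable_innov {R : ℝ} {F : Plane → Config → ℝ} (hF : IsLocal R F) :
    Measurable (innov lam F C) := by
  refine Measurable.sub ?_ ?_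
  · exact (hF.meas.mul hP.loc.meas).stronglyMeasurable.integral_prod_left'.measurable
  · simp_rw [← integral_indicator hC]
    refine (stronglyMeasurable_integral_pts measurable_id ?_).measurable
    have : (uncurry fun (φ : Config) (x : Plane) => C.indicator (fun x => F x (φ.erase x)) x) =
        (Prod.snd ⁻¹' C).indicator fun q : Config × Plane => F q.2 (q.1.erase q.2) := by
      ext q; rfl
    rw [this]
    exact (hF.meas.comp (measurable_snd.prodMk
      (measurable_erase measurable_snd measurable_fst))).indicator (measurable_snd hC)

theorem memLp_innov {R : ℝ} {F : Plane → Config → ℝ} (hF : IsLocal R F) :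
    MemLp (innov lam F C) 2 P := by
  obtain ⟨L, hL, hle⟩ := hP.loc.bdd
  obtain ⟨K, hK, hKb⟩ := hF.bdd
  have hN := ((memLp_count hP hC hb).const_mul K).add
    (memLp_const (μ := P) (p := 2) (K * L * volume.real C))
  refine hN.of_le (measurable_innov hP hC hF).aestronglyMeasurable
    (Filter.Eventually.of_forall fun φ => ?_)
  have h1 : |∫ x in C, F x φ * lam x φ| ≤ K * L * volume.real C := by
    have := norm_setIntegral_le_of_norm_le_const (μ := volume) (s := C) (C := K * L)
      (f := fun x => F x φ * lam x φ) hb.measure_lt_top (fun x _ => by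
        rw [Real.norm_eq_abs, abs_mul]
        exact mul_le_mul (hKb x φ) (hle x φ) (abs_nonneg _) hK)
    rwa [Real.norm_eq_abs] at this
  have h2 := abs_setIntegral_pts_le φ hb (f := fun x => F x (φ.erase x)) (K := K)
    fun x => hKb x _
  have h3 : 0 ≤ K * (pts φ C).toReal + K * L * volume.real C := by positivity
  simp only [Pi.add_apply, Real.norm_eq_abs]
  rw [abs_of_nonneg h3]
  exact (abs_sub _ _).trans (by linarith)

/-- The signed Georgii-Nguyen-Zessin formula on the product space. -/
theorem gnz_measure :
    ((P ⊗ₘ ptsKernel.restrict hC).map fun q => (q.1.erase q.2, q.2)) =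
      (P.prod (volume.restrict C)).withDensity fun q => ENNReal.ofReal (lam q.2 q.1) := by
  have hs : Measurable fun q : Config × Plane => (q.1.erase q.2, q.2) :=
    (measurable_erase measurable_snd measurable_fst).prodMk measurable_snd
  have hl : Measurable fun q : Config × Plane => ENNReal.ofReal (lam q.2 q.1) :=
    ENNReal.measurable_ofReal.comp (hP.loc.meas.comp measurable_swap)
  have : IsFiniteMeasure (volume.restrict C) := ⟨by simpa using hb.measure_lt_top⟩
  ext A hA
  have hind : Measurable (A.indicator (1 : Config × Plane → ENNReal)) :=
    measurable_one.indicator hA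
  have h := hP.gnz C hC hb (fun x φ => A.indicator 1 (φ, x)) (hind.comp measurable_swap)
  rw [← lintegral_indicator_one hA, ← lintegral_indicator_one hA, lintegral_map hind hs,
    Measure.lintegral_compProd (f := fun q : Config × Plane => A.indicator 1 (q.1.erase q.2, q.2)) (hind.comp hs),
    lintegral_withDensity_eq_lintegral_mul _ hl hind,
    lintegral_prod _ (hl.mul hind).aemeasurable]
  exact h

/-- Integration by parts: the innovation is the adjoint of the difference operator. -/
theorem innov_duality {R : ℝ} {g : Plane → Config → ℝ} (hg : IsLocal R g) {T : Config → ℝ}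
    (hT : Measurable T) (hT2 : MemLp T 2 P) :
    Integrable (fun q : Config × Plane => g q.2 q.1 * lam q.2 q.1 *
      (T q.1 - T (q.1.insert q.2))) (P.prod (volume.restrict C)) ∧
    ∫ φ, innov lam g C φ * T φ ∂P = ∫ q, g q.2 q.1 * lam q.2 q.1 *
      (T q.1 - T (q.1.insert q.2)) ∂(P.prod (volume.restrict C)) := by
  obtain ⟨L, hL, hle⟩ := hP.loc.bdd
  obtain ⟨K, hK, hKb⟩ := hg.bdd
  have : IsFiniteMeasure (volume.restrict C) := ⟨by simpa using hb.measure_lt_top⟩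
  have hs : Measurable fun q : Config × Plane => (q.1.erase q.2, q.2) :=
    (measurable_erase measurable_snd measurable_fst).prodMk measurable_snd
  have hl : Measurable fun q : Config × Plane => lam q.2 q.1 := hP.loc.meas.comp measurable_swap
  have hgm : Measurable fun q : Config × Plane => g q.2 q.1 := hg.meas.comp measurable_swap
  -- Inserting `x` in the argument of `T` is undone by erasing: at a point of `φ`, the value `F (φ \
  -- x, x)` is `g x (φ \ x) * T φ`, so the sum in the innovation times `T` is a sum of values of
  -- `F`.
  set F : Config × Plane → ℝ := fun q => g q.2 q.1 * T (q.1.insert q.2) with hFdef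
  have hF : Measurable F :=
    hgm.mul (hT.comp (measurable_insert measurable_snd measurable_fst))
  have hFs : ∀ φ : Config, ∀ x ∈ φ.1, F (φ.erase x, x) = g x (φ.erase x) * T φ := by
    intro φ x hx
    simp only [hFdef, Config.insert_erase hx]
  have haemem : ∀ φ : Config, ∀ᵐ x ∂(ptsKernel.restrict hC φ), x ∈ φ.1 := by
    intro φ
    rw [Kernel.restrict_apply, ptsKernel_apply]
    refine ae_restrict_of_ae ?_
    rw [ae_iff]
    change pts φ φ.1ᶜ = 0
    rw [pts_eq_zero_iff]
    exact fun z hz hz' => hz' hz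
  have hT1 : Integrable T P := hT2.integrable (by norm_num)
  -- integrability on the point side
  have hI1 : Integrable (fun q : Config × Plane => F (q.1.erase q.2, q.2))
      (P ⊗ₘ ptsKernel.restrict hC) := by
    rw [Measure.integrable_compProd_iff (f := fun q : Config × Plane => F (q.1.erase q.2, q.2))
      (hF.comp hs).aestronglyMeasurable]
    refine ⟨Filter.Eventually.of_forall fun φ => ?_, ?_⟩
    · rw [Kernel.restrict_apply, ptsKernel_apply]
      exact integrable_restrict_pts φ hb _
    · have hdom : Integrable (fun φ => (K * (pts φ C).toReal) * |T φ|) P :=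
        ((memLp_count hP hC hb).const_mul K).integrable_mul hT2.abs
      refine hdom.mono' ?_ (Filter.Eventually.of_forall fun φ => ?_)
      · exact ((hF.comp hs).norm.stronglyMeasurable.integral_kernel_prod_right').aestronglyMeasurable
      · have e : ∫ x, ‖F (φ.erase x, x)‖ ∂(ptsKernel.restrict hC φ) =
            ∫ x in C, |g x (φ.erase x) * T φ| ∂pts φ := by
          refine integral_congr_ae ?_
          filter_upwards [haemem φ] with x hx
          rw [hFs φ x hx, Real.norm_eq_abs]
        rw [e, Real.norm_eq_abs]
        refine (abs_setIntegral_pts_le φ hb (K := K * |T φ|) fun x => ?_).trans_eq (by ring)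
        rw [abs_abs, abs_mul]
        exact mul_le_mul_of_nonneg_right (hKb _ _) (abs_nonneg _)
  have hI2 : Integrable F ((P ⊗ₘ ptsKernel.restrict hC).map fun q => (q.1.erase q.2, q.2)) :=
    (integrable_map_measure hF.aestronglyMeasurable hs.aemeasurable).2 hI1
  have hGNZ := gnz_measure hP hC hb
  have hI3 : Integrable (fun q : Config × Plane => lam q.2 q.1 * F q)
      (P.prod (volume.restrict C)) := by
    rw [hGNZ] at hI2
    have := (integrable_withDensity_iff_integrable_smul' (hl.ennreal_ofReal)
      (Filter.Eventually.of_forall fun q => ENNReal.ofReal_lt_top)).1 hI2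
    refine this.congr (Filter.Eventually.of_forall fun q => ?_)
    simp only [smul_eq_mul, ENNReal.toReal_ofReal (hP.pos q.2 q.1).le]
  have hE : ∫ φ, (∫ x in C, g x (φ.erase x) ∂pts φ) * T φ ∂P =
      ∫ q, lam q.2 q.1 * F q ∂(P.prod (volume.restrict C)) := by
    calc ∫ φ, (∫ x in C, g x (φ.erase x) ∂pts φ) * T φ ∂P
        = ∫ φ, ∫ x, F (φ.erase x, x) ∂(ptsKernel.restrict hC φ) ∂P := by
          refine integral_congr_ae (Filter.Eventually.of_forall fun φ => ?_)
          change (∫ x in C, g x (φ.erase x) ∂pts φ) * T φ = _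
          rw [← integral_mul_const]
          refine integral_congr_ae ?_
          filter_upwards [haemem φ] with x hx
          rw [hFs φ x hx]
      _ = ∫ q, F (q.1.erase q.2, q.2) ∂(P ⊗ₘ ptsKernel.restrict hC) :=
          (Measure.integral_compProd hI1).symm
      _ = ∫ q, F q ∂((P ⊗ₘ ptsKernel.restrict hC).map fun q => (q.1.erase q.2, q.2)) :=
          (integral_map hs.aemeasurable hF.aestronglyMeasurable).symm
      _ = _ := by
          rw [hGNZ, integral_withDensity_eq_integral_toReal_smul hl.ennreal_ofReal
            (Filter.Eventually.of_forall fun q => ENNReal.ofReal_lt_top)]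
          refine integral_congr_ae (Filter.Eventually.of_forall fun q => ?_)
          simp only [smul_eq_mul, ENNReal.toReal_ofReal (hP.pos q.2 q.1).le]
  have hI4 : Integrable (fun q : Config × Plane => g q.2 q.1 * lam q.2 q.1 * T q.1)
      (P.prod (volume.restrict C)) := by
    refine (hT1.comp_fst (volume.restrict C)).bdd_mul (c := K * L)
      (hgm.mul hl).aestronglyMeasurable (Filter.Eventually.of_forall fun q => ?_)
    rw [Real.norm_eq_abs, abs_mul]
    exact mul_le_mul (hKb _ _) (hle _ _) (abs_nonneg _) hK
  have hE2 : ∫ φ, (∫ x in C, g x φ * lam x φ) * T φ ∂P =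
      ∫ q, g q.2 q.1 * lam q.2 q.1 * T q.1 ∂(P.prod (volume.restrict C)) := by
    rw [integral_prod _ hI4]
    refine integral_congr_ae (Filter.Eventually.of_forall fun φ => ?_)
    exact (integral_mul_const (T φ) fun x => g x φ * lam x φ).symm
  have hsplit : (fun q : Config × Plane => g q.2 q.1 * lam q.2 q.1 * (T q.1 - T (q.1.insert q.2)))
      = fun q => g q.2 q.1 * lam q.2 q.1 * T q.1 - lam q.2 q.1 * F q := by
    ext q; simp only [hFdef]; ring
  rw [hsplit]
  refine ⟨hI4.sub hI3, ?_⟩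
  rw [integral_sub hI4 hI3, ← hE, ← hE2, ← integral_sub]
  · refine integral_congr_ae (Filter.Eventually.of_forall fun φ => ?_)
    simp only [innov]; ring
  · have := hI4.integral_prod_left
    refine this.congr (Filter.Eventually.of_forall fun φ => ?_)
    exact integral_mul_const (T φ) fun x => g x φ * lam x φ
  · have := MeasureTheory.Integrable.integral_compProd (a := ()) (κ := Kernel.const Unit P)
      (η := Kernel.prodMkLeft Unit (ptsKernel.restrict hC)) hI1
    rw [Kernel.const_apply] at this
    refine this.congr (Filter.Eventually.of_forall fun φ => ?_)
    change _ = (∫ x in C, g x (φ.erase x) ∂pts φ) * T φ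
    rw [← integral_mul_const]
    refine integral_congr_ae ?_
    filter_upwards [haemem φ] with x hx
    rw [hFs φ x hx]

end Innovations

/-! ### Summable covariances on the lattice -/

/-- The box of the lattice points with sup norm at most `n`. -/
abbrev box (n : ℤ) : Finset (Fin 2 → ℤ) := Finset.Icc (fun _ => -n) (fun _ => n)

theorem mem_box {n : ℤ} {i : Fin 2 → ℤ} : i ∈ box n ↔ ∀ j, |i j| ≤ n := by
  simp only [box, Finset.mem_Icc, Pi.le_def, ← forall_and, abs_le]

theorem card_box {n : ℤ} (hn : 0 ≤ n) : ((box n).card : ℝ) = (2 * n + 1) ^ 2 := by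
  rw [box, Pi.card_Icc]
  simp only [Int.card_Icc, Finset.prod_const, Finset.card_univ, Fintype.card_fin]
  have : (((n + 1 - -n).toNat : ℤ) : ℝ) = 2 * n + 1 := by
    rw [Int.toNat_of_nonneg (by omega)]; push_cast; ring
  push_cast at this ⊢
  rw [this]

theorem sum_box_eq_of_le {c : (Fin 2 → ℤ) → ℝ} {m n : ℤ} (hmn : m ≤ n)
    (hc : ∀ i ∉ box m, c i = 0) : ∑ i ∈ box n, c i = ∑ i ∈ box m, c i := by
  symm
  refine Finset.sum_subset (fun i hi => mem_box.2 fun j => ?_) fun i _ hi => hc i hi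
  exact (mem_box.1 hi j).trans hmn

theorem sum_box_neg (c : (Fin 2 → ℤ) → ℝ) (n : ℤ) :
    ∑ i ∈ box n, c (-i) = ∑ i ∈ box n, c i := by
  refine Finset.sum_nbij' (fun i => -i) (fun i => -i) ?_ ?_ ?_ ?_ ?_ <;>
    simp only [mem_box, Pi.neg_apply, abs_neg, neg_neg, imp_self, implies_true]

/-- A function with finite support on the lattice has a nonnegative sum if it is a positive
semidefinite kernel on boxes. -/
theorem sum_nonneg_of_box_nonneg {c : (Fin 2 → ℤ) → ℝ} {M : ℤ} (hM : 0 ≤ M)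
    (hc : ∀ i ∉ box M, c i = 0)
    (hpos : ∀ n : ℤ, 0 ≤ ∑ i ∈ box n, ∑ j ∈ box n, c (j - i)) : 0 ≤ ∑ i ∈ box M, c i := by
  classical
  by_contra! hS
  set S := ∑ i ∈ box M, c i with hSdef
  set A := ∑ i ∈ box M, |c i| with hA
  have hA0 : 0 ≤ A := Finset.sum_nonneg fun _ _ => abs_nonneg _
  have habs : |S| ≤ A := Finset.abs_sum_le_sum_abs _ _
  -- the sum of a row
  have hrow : ∀ (n : ℤ) (i : Fin 2 → ℤ), ∑ j ∈ box n, c (j - i) =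
      ∑ k ∈ (box M).filter fun k => i + k ∈ box n, c k := by
    intro n i
    rw [← Finset.sum_filter_of_ne (p := fun j => j - i ∈ box M) (fun j _ hj => by
      by_contra h; exact hj (hc _ h))]
    refine Finset.sum_nbij' (fun j => j - i) (fun k => i + k) ?_ ?_ ?_ ?_ ?_
    · intro j hj
      rw [Finset.mem_filter] at hj ⊢
      exact ⟨hj.2, by simpa using hj.1⟩
    · intro k hk
      rw [Finset.mem_filter] at hk ⊢
      exact ⟨hk.2, by simpa using hk.1⟩
    · intro j _; simp
    · intro k _; simp
    · intro j _; rfl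
  have hrow_le : ∀ (n : ℤ) (i : Fin 2 → ℤ), ∑ j ∈ box n, c (j - i) ≤ A := by
    intro n i
    rw [hrow]
    refine (le_abs_self _).trans ((Finset.abs_sum_le_sum_abs _ _).trans ?_)
    exact Finset.sum_le_sum_of_subset_of_nonneg (Finset.filter_subset _ _)
      fun _ _ _ => abs_nonneg _
  have hrow_in : ∀ (t : ℤ) (i : Fin 2 → ℤ), i ∈ box t → ∑ j ∈ box (t + M), c (j - i) = S := by
    intro t i hi
    rw [hrow, Finset.filter_true_of_mem]
    intro k hk
    refine mem_box.2 fun j => (abs_add_le _ _).trans ?_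
    exact add_le_add (mem_box.1 hi j) (mem_box.1 hk j)
  -- In the box of size `t + M`, every row indexed by the inner box sums to `S` and the others to at
  -- most `A`. The margin contributes `(8 t M + 4 M² + 4 M) A`, which a negative `S`, weighted
  -- quadratically in `t`, eventually outweighs.
  have key : ∀ t : ℤ, 0 ≤ t →
      0 ≤ (2 * (t : ℝ) + 1) ^ 2 * S + ((2 * (t + M) + 1) ^ 2 - (2 * (t : ℝ) + 1) ^ 2) * A := by
    intro t ht
    have hsub : box t ⊆ box (t + M) := fun i hi =>
      mem_box.2 fun j => (mem_box.1 hi j).trans (by omega)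
    have h := hpos (t + M)
    rw [← Finset.sum_sdiff hsub, Finset.sum_congr rfl (hrow_in t), Finset.sum_const,
      nsmul_eq_mul, card_box ht] at h
    have h2 : ∑ i ∈ box (t + M) \ box t, ∑ j ∈ box (t + M), c (j - i) ≤
        ((box (t + M) \ box t).card : ℝ) * A := by
      rw [← nsmul_eq_mul]
      exact Finset.sum_le_card_nsmul _ _ _ fun i _ => hrow_le _ i
    rw [Finset.cast_card_sdiff hsub, card_box ht, card_box (by omega)] at h2
    push_cast at h2
    linarith
  obtain ⟨N, hN⟩ := exists_nat_gt ((4 * (M : ℝ) ^ 2 + 4 * M) * A / (-S))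
  rw [div_lt_iff₀ (by linarith)] at hN
  have h := key N (by positivity)
  have hM' : (0 : ℝ) ≤ M := by exact_mod_cast hM
  have hN' : (0 : ℝ) ≤ N := by positivity
  push_cast at h
  nlinarith [mul_nonneg (mul_nonneg hM' hN') hA0, mul_nonneg (mul_nonneg hM' hM') hA0,
    mul_nonneg hN' hN', mul_nonneg hM' hA0, mul_lt_mul_of_pos_left hN (by linarith : (0:ℝ) < 2 * N + 1)]

/-! ### Cells -/

/-- The translation vector of the cell `i`. -/
def cellVec (Dt : ℝ) (i : Fin 2 → ℤ) : Plane := WithLp.toLp 2 fun j => Dt * (i j : ℝ)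

theorem isClosed_cell (Dt : ℝ) (i : Fin 2 → ℤ) : IsClosed (cell Dt i) := by
  have : cell Dt i = ⋂ j, {z : Plane | Dt * ((i j : ℝ) - 1 / 2) ≤ z j ∧
      z j ≤ Dt * ((i j : ℝ) + 1 / 2)} := by
    ext z; simp [cell]
  rw [this]
  refine isClosed_iInter fun j => ?_
  have hc : Continuous fun z : Plane => z j := by fun_prop
  exact (isClosed_le continuous_const hc).inter (isClosed_le hc continuous_const)

theorem measurableSet_cell (Dt : ℝ) (i : Fin 2 → ℤ) : MeasurableSet (cell Dt i) :=
  (isClosed_cell Dt i).measurableSet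

theorem preimage_cell (Dt : ℝ) (i j : Fin 2 → ℤ) :
    (fun x => x + cellVec Dt i) ⁻¹' cell Dt j = cell Dt (j - i) := by
  ext z
  simp only [cell, cellVec, mem_preimage, mem_ofPred_eq, PiLp.add_apply, Pi.sub_apply,
    Int.cast_sub]
  refine forall_congr' fun k => ?_
  constructor <;> rintro ⟨h1, h2⟩ <;> constructor <;> linarith

theorem isBounded_cell (Dt : ℝ) (i : Fin 2 → ℤ) : Bornology.IsBounded (cell Dt i) := by
  have : cell Dt i ⊆ (WithLp.ofLp) ⁻¹' (Icc (fun j => Dt * ((i j : ℝ) - 1 / 2))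
      (fun j => Dt * ((i j : ℝ) + 1 / 2))) := fun z hz => ⟨fun j => (hz j).1, fun j => (hz j).2⟩
  refine Bornology.IsBounded.subset ?_ this
  exact (PiLp.antilipschitzWith_ofLp 2 _).isBounded_preimage (Metric.isBounded_Icc _ _)

theorem abs_sub_le_dist (x y : Plane) (j : Fin 2) : |x j - y j| ≤ dist x y := by
  rw [← Real.dist_eq]
  have := PiLp.lipschitzWith_ofLp 2 (fun _ : Fin 2 => ℝ)
  rw [EuclideanSpace.dist_eq]
  refine Real.le_sqrt_of_sq_le ?_
  exact Finset.single_le_sum (f := fun j => dist (x j) (y j) ^ 2)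
    (fun _ _ => sq_nonneg _) (Finset.mem_univ j)

/-- Some coordinate of `i` has absolute value at least `⌊R / Dt⌋ + 2`. Adjacent cells touch, so one
unit is lost, and the gap in that coordinate is at least `Dt (⌊R / Dt⌋ + 1) > R`. -/
theorem lt_dist_of_notMem_box {R Dt : ℝ} (hDt : 0 < Dt) {i : Fin 2 → ℤ}
    (hi : i ∉ box (⌊R / Dt⌋ + 1)) {x z : Plane} (hx : x ∈ cell Dt 0) (hz : z ∈ cell Dt i) :
    R < dist z x := by
  rw [mem_box] at hi
  push Not at hi
  obtain ⟨j, hj⟩ := hi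
  have h1 := hx j
  have h2 := hz j
  simp only [Pi.zero_apply, Int.cast_zero] at h1
  refine lt_of_lt_of_le ?_ (abs_sub_le_dist z x j)
  have h3 : R / Dt < ⌊R / Dt⌋ + 1 := Int.lt_floor_add_one _
  rw [div_lt_iff₀ hDt] at h3
  have h4 : ((⌊R / Dt⌋ + 2 : ℤ) : ℝ) ≤ |(i j : ℝ)| := by
    rw [← Int.cast_abs]; exact_mod_cast (by omega)
  push_cast at h4
  rcases le_or_gt 0 (i j : ℝ) with h | h
  · rw [abs_of_nonneg h] at h4
    refine lt_of_lt_of_le ?_ (le_abs_self _)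
    nlinarith
  · rw [abs_of_neg h] at h4
    refine lt_of_lt_of_le ?_ (neg_le_abs _)
    nlinarith

theorem exists_mem_cell {Dt : ℝ} (hDt : 0 < Dt) (z : Plane) : ∃ i, z ∈ cell Dt i := by
  refine ⟨fun j => ⌊z j / Dt + 1 / 2⌋, fun j => ?_⟩
  have h1 := Int.floor_le (z j / Dt + 1 / 2)
  have h2 := (Int.lt_floor_add_one (z j / Dt + 1 / 2)).le
  have e : Dt * (z j / Dt) = z j := by field_simp
  have h1' := mul_le_mul_of_nonneg_left h1 hDt.le
  have h2' := mul_le_mul_of_nonneg_left h2 hDt.le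
  constructor <;> nlinarith

theorem exists_mem_box_of_dist_le {R Dt : ℝ} (hDt : 0 < Dt) {x z : Plane} (hx : x ∈ cell Dt 0)
    (hz : dist z x ≤ R) : ∃ i ∈ box (⌊R / Dt⌋ + 1), z ∈ cell Dt i := by
  obtain ⟨i, hi⟩ := exists_mem_cell hDt z
  refine ⟨i, ?_, hi⟩
  by_contra h
  exact (lt_dist_of_notMem_box hDt h hx hi).not_ge hz

/-! ### Stationarity, locality and linearity of the innovations -/

theorem pts_translate (v : Plane) (φ : Config) :
    pts (φ.translate v) = (pts φ).map fun x => x + v := by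
  ext B hB
  rw [Measure.map_apply (measurable_add_const v) hB, pts_apply, pts_apply]
  · have : (φ.translate v).1 ∩ B = (fun x => x + v) '' (φ.1 ∩ (fun x => x + v) ⁻¹' B) := by
      rw [Config.coe_translate, image_inter_preimage]
    rw [this, (add_left_injective v).encard_image]

theorem Config.translate_erase (v x : Plane) (φ : Config) :
    (φ.translate v).erase (x + v) = (φ.erase x).translate v := by
  refine Config.ext ?_
  rw [coe_erase, coe_translate, coe_translate, coe_erase, image_sdiff (add_left_injective v),
    image_singleton]

theorem Config.erase_insert_of_ne {x z : Plane} (h : x ≠ z) (φ : Config) :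
    (φ.insert x).erase z = (φ.erase z).insert x := by
  refine Config.ext ?_
  rw [Config.coe_erase, Config.coe_insert, Config.coe_insert, Config.coe_erase,
    singleton_union, singleton_union, insert_sdiff_singleton_comm h]

section

variable {P : Measure Config} [IsProbabilityMeasure P] {lam : Plane → Config → ℝ} {D R : ℝ}

theorem innov_translate (hl : IsLocal D lam) {F : Plane → Config → ℝ} (hF : IsLocal R F)
    (C : Set Plane) (v : Plane) (φ : Config) :
    innov lam F C (φ.translate v) = innov lam F ((fun x => x + v) ⁻¹' C) φ := by
  have he : MeasurableEmbedding fun x : Plane => x + v :=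
    (MeasurableEquiv.addRight v).measurableEmbedding
  rw [innov, innov, pts_translate, he.setIntegral_map]
  congr 1
  · rw [← (measurePreserving_add_right volume v).setIntegral_preimage_emb he]
    simp only [hF.shift, hl.shift]
  · simp only [Config.translate_erase, hF.shift]

theorem restrict_insert_of_lt_dist {x z : Plane} (h : R < dist z x) (φ : Config) :
    (φ.insert x).restrict (Metric.closedBall z R) = φ.restrict (Metric.closedBall z R) := by
  refine Config.ext ?_
  rw [Config.coe_restrict, Config.coe_restrict, Config.coe_insert, singleton_union,
    insert_inter_of_notMem]
  rw [Metric.mem_closedBall, dist_comm]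
  exact not_le.2 h

theorem innov_insert_of_lt_dist (hR : 0 < R) (hl : IsLocal R lam) {F : Plane → Config → ℝ}
    (hF : IsLocal R F) {C : Set Plane} (hC : MeasurableSet C) (hb : Bornology.IsBounded C)
    {x : Plane} (hx : ∀ z ∈ C, R < dist z x) (φ : Config) :
    innov lam F C (φ.insert x) = innov lam F C φ := by
  have hxC : x ∉ C := fun h => (hx x h).not_ge (by simpa using hR.le)
  have hset : (φ.insert x).1 ∩ C = φ.1 ∩ C := by
    rw [Config.coe_insert, singleton_union,
    insert_inter_of_notMem hxC]
  rw [innov, innov, setIntegral_pts _ hb, setIntegral_pts _ hb]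
  congr 1
  · refine setIntegral_congr_fun hC fun z hz => ?_
    have h := restrict_insert_of_lt_dist (hx z hz) φ
    simp only [hF.congr h, hl.congr h]
  · have hfin : ((φ.insert x).2 C hb).toFinset = (φ.2 C hb).toFinset := by
      ext z; simp only [Finite.mem_toFinset, hset]
    rw [hfin]
    refine Finset.sum_congr rfl fun z hz => ?_
    rw [Finite.mem_toFinset] at hz
    refine hF.congr ?_
    have hne : x ≠ z := fun h => hxC (h ▸ hz.2)
    rw [Config.erase_insert_of_ne hne, restrict_insert_of_lt_dist (hx z hz.2)]

variable (hP : HasIntensity P lam D)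

include hP

omit [IsProbabilityMeasure P] in
theorem innov_add_smul {F G : Plane → Config → ℝ} (hF : IsLocal R F) (hG : IsLocal R G) (a : ℝ)
    {C : Set Plane} (hb : Bornology.IsBounded C) (φ : Config) :
    innov lam (fun x φ => F x φ + a * G x φ) C φ = innov lam F C φ + a * innov lam G C φ := by
  have h1 := hP.loc.integrableOn_mul hF hb φ
  have h2 := hP.loc.integrableOn_mul hG hb φ
  have e1 : ∫ x in C, (F x φ + a * G x φ) * lam x φ =
      (∫ x in C, F x φ * lam x φ) + a * ∫ x in C, G x φ * lam x φ := by
    rw [← integral_const_mul, ← integral_add h1 (h2.const_mul a)]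
    exact integral_congr_ae (Filter.Eventually.of_forall fun x => by ring)
  simp only [innov]
  rw [e1, setIntegral_pts _ hb, setIntegral_pts _ hb, setIntegral_pts _ hb,
    Finset.sum_add_distrib, ← Finset.mul_sum]
  ring

omit [IsProbabilityMeasure P] in
theorem innov_sum {ι : Type*} {F : ι → Plane → Config → ℝ} (hF : ∀ k, IsLocal R (F k))
    (y : ι → ℝ) (s : Finset ι) {C : Set Plane}
    (hb : Bornology.IsBounded C) (φ : Config) :
    innov lam (fun x φ => ∑ k ∈ s, y k * F k x φ) C φ = ∑ k ∈ s, y k * innov lam (F k) C φ := by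
  classical
  induction s using Finset.induction_on with
  | empty => simp [innov]
  | insert a s ha ih =>
    have := innov_add_smul hP (IsLocal.sum hF y s) (hF a) (y a) hb φ
    simp only [Finset.sum_insert ha]
    simp only [add_comm (y a * _)]
    rw [this, ih]

end

/-! ### Covariances of innovations -/

/-- The expectation of the product of the innovations of `F` over the central cell and of `G` over
the cell `i`. -/
def innovCov (P : Measure Config) (lam : Plane → Config → ℝ) (Dt : ℝ) (F G : Plane → Config → ℝ)
    (i : Fin 2 → ℤ) : ℝ :=
  ∫ φ, innov lam F (cell Dt 0) φ * innov lam G (cell Dt i) φ ∂P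

section

variable {P : Measure Config} [IsProbabilityMeasure P] {lam : Plane → Config → ℝ} {D R Dt : ℝ}
  (hP : HasIntensity P lam D)

include hP

theorem memLp_innov_cell {F : Plane → Config → ℝ} (hF : IsLocal R F) (i : Fin 2 → ℤ) :
    MemLp (innov lam F (cell Dt i)) 2 P :=
  memLp_innov hP (measurableSet_cell Dt i) (isBounded_cell Dt i) hF

theorem integrable_innov_mul {F G : Plane → Config → ℝ} (hF : IsLocal R F) (hG : IsLocal R G)
    (i j : Fin 2 → ℤ) :
    Integrable (fun φ => innov lam F (cell Dt i) φ * innov lam G (cell Dt j) φ) P :=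
  (memLp_innov_cell hP hF i).integrable_mul (memLp_innov_cell hP hG j)

-- Translation by the centre of the cell `i` preserves `P` and moves this cell to the central one.
omit [IsProbabilityMeasure P] in
theorem integral_innov_mul {F G : Plane → Config → ℝ} (hF : IsLocal R F) (hG : IsLocal R G)
    (i j : Fin 2 → ℤ) :
    ∫ φ, innov lam F (cell Dt i) φ * innov lam G (cell Dt j) φ ∂P =
      innovCov P lam Dt F G (j - i) := by
  have hm : Measurable fun φ => innov lam F (cell Dt i) φ * innov lam G (cell Dt j) φ :=
    (measurable_innov hP (measurableSet_cell Dt i) hF).mul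
      (measurable_innov hP (measurableSet_cell Dt j) hG)
  have hmp := hP.stat (cellVec Dt i)
  rw [← hmp.map_eq, integral_map hmp.measurable.aemeasurable hm.aestronglyMeasurable, innovCov]
  simp only [innov_translate hP.loc hF, innov_translate hP.loc hG, preimage_cell, sub_self,
    hmp.map_eq]

omit [IsProbabilityMeasure P] in
theorem innovCov_neg {F G : Plane → Config → ℝ} (hF : IsLocal R F) (hG : IsLocal R G)
    (i : Fin 2 → ℤ) : innovCov P lam Dt F G (-i) = innovCov P lam Dt G F i := by
  rw [← zero_sub i, ← integral_innov_mul hP hF hG, innovCov]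
  simp only [mul_comm]

theorem innovCov_add_smul_right {F G H : Plane → Config → ℝ} (hF : IsLocal R F)
    (hG : IsLocal R G) (hH : IsLocal R H) (a : ℝ) (i : Fin 2 → ℤ) :
    innovCov P lam Dt F (fun x φ => G x φ + a * H x φ) i =
      innovCov P lam Dt F G i + a * innovCov P lam Dt F H i := by
  simp only [innovCov,
    innov_add_smul hP hG hH a (isBounded_cell Dt i)]
  rw [← integral_const_mul, ← integral_add (integrable_innov_mul hP hF hG 0 i)
    ((integrable_innov_mul hP hF hH 0 i).const_mul a)]
  exact integral_congr_ae (Filter.Eventually.of_forall fun x => by ring)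

theorem innovCov_sum {ι : Type*} {F G : ι → Plane → Config → ℝ} (hF : ∀ k, IsLocal R (F k))
    (hG : ∀ k, IsLocal R (G k)) (y z : ι → ℝ) (s t : Finset ι) (i : Fin 2 → ℤ) :
    innovCov P lam Dt (fun x φ => ∑ k ∈ s, y k * F k x φ) (fun x φ => ∑ k ∈ t, z k * G k x φ) i =
      ∑ k ∈ s, ∑ l ∈ t, y k * z l * innovCov P lam Dt (F k) (G l) i := by
  simp only [innovCov, innov_sum hP hF y s (isBounded_cell Dt 0),
    innov_sum hP hG z t (isBounded_cell Dt i), Finset.sum_mul_sum]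
  have hI : ∀ k l, Integrable (fun φ => y k * innov lam (F k) (cell Dt 0) φ *
      (z l * innov lam (G l) (cell Dt i) φ)) P := fun k l =>
    ((integrable_innov_mul hP (hF k) (hG l) 0 i).const_mul (y k * z l)).congr
      (Filter.Eventually.of_forall fun φ => by simp only; ring)
  rw [integral_finsetSum _ fun k _ => integrable_finsetSum _ fun l _ => hI k l]
  refine Finset.sum_congr rfl fun k _ => ?_
  rw [integral_finsetSum _ fun l _ => hI k l]
  refine Finset.sum_congr rfl fun l _ => ?_
  rw [← integral_const_mul]
  exact integral_congr_ae (Filter.Eventually.of_forall fun φ => by ring)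

omit [IsProbabilityMeasure P] hP in
theorem ae_snd_mem {C : Set Plane} (hC : MeasurableSet C) :
    ∀ᵐ q ∂P.prod (volume.restrict C), q.2 ∈ C :=
  Measure.quasiMeasurePreserving_snd.ae (ae_restrict_mem hC)

/-- Duality expresses the covariance through the effect of a new point of the central cell on the
innovation over the cell `i`, and this cell is out of reach. -/
theorem innovCov_eq_zero (hDt : 0 < Dt) (hDR : D ≤ R) {F G : Plane → Config → ℝ}
    (hF : IsLocal R F) (hG : IsLocal R G) {i : Fin 2 → ℤ} (hi : i ∉ box (⌊R / Dt⌋ + 1)) :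
    innovCov P lam Dt F G i = 0 := by
  rw [innovCov, (innov_duality hP (measurableSet_cell Dt 0) (isBounded_cell Dt 0) hF
    (measurable_innov hP (measurableSet_cell Dt i) hG) (memLp_innov_cell hP hG i)).2]
  refine integral_eq_zero_of_ae ?_
  filter_upwards [ae_snd_mem (measurableSet_cell Dt 0)] with q hq
  rw [innov_insert_of_lt_dist (hP.range_pos.trans_le hDR) (hP.loc.mono hDR) hG
    (measurableSet_cell Dt i) (isBounded_cell Dt i)
    fun z hz => lt_dist_of_notMem_box hDt hi hq hz, sub_self, mul_zero, Pi.zero_apply]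

/-- The asymptotic covariance of innovations is positive semidefinite. -/
theorem sum_innovCov_self_nonneg (hDt : 0 < Dt) (hDR : D ≤ R) {F : Plane → Config → ℝ}
    (hF : IsLocal R F) : 0 ≤ ∑ i ∈ box (⌊R / Dt⌋ + 1), innovCov P lam Dt F F i := by
  have hR := hP.range_pos.trans_le hDR
  refine sum_nonneg_of_box_nonneg (by positivity)
    (fun i hi => innovCov_eq_zero hP hDt hDR hF hF hi) fun n => ?_
  -- By stationarity the double sum is the second moment of the innovation summed over the box.
  have : ∑ i ∈ box n, ∑ j ∈ box n, innovCov P lam Dt F F (j - i) =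
      ∫ φ, (∑ i ∈ box n, innov lam F (cell Dt i) φ) ^ 2 ∂P := by
    simp only [sq, Finset.sum_mul_sum]
    rw [integral_finsetSum _ fun i _ => integrable_finsetSum _ fun j _ =>
      integrable_innov_mul hP hF hF i j]
    refine Finset.sum_congr rfl fun i _ => ?_
    rw [integral_finsetSum _ fun j _ => integrable_innov_mul hP hF hF i j]
    exact Finset.sum_congr rfl fun j _ => (integral_innov_mul hP hF hF i j).symm
  rw [this]
  exact integral_nonneg fun φ => sq_nonneg _

/-- If the asymptotic variance of the innovations of `h` vanishes, then so does its asymptotic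
covariance with the innovations of any local function. -/
theorem integral_difference_eq_zero (hDt : 0 < Dt) (hDR : D ≤ R) {h g : Plane → Config → ℝ}
    (hh : IsLocal D h) (hg : IsLocal R g)
    (h0 : ∑ i ∈ box (⌊D / Dt⌋ + 1), innovCov P lam Dt h h i ≤ 0) :
    Integrable (fun q : Config × Plane => g q.2 q.1 * lam q.2 q.1 *
      ∑ i ∈ box (⌊R / Dt⌋ + 1), (innov lam h (cell Dt i) q.1 -
        innov lam h (cell Dt i) (q.1.insert q.2))) (P.prod (volume.restrict (cell Dt 0))) ∧
    ∫ q : Config × Plane, g q.2 q.1 * lam q.2 q.1 *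
      ∑ i ∈ box (⌊R / Dt⌋ + 1), (innov lam h (cell Dt i) q.1 -
        innov lam h (cell Dt i) (q.1.insert q.2)) ∂(P.prod (volume.restrict (cell Dt 0))) = 0 := by
  have hhR := hh.mono hDR
  have hbox : ⌊D / Dt⌋ + 1 ≤ ⌊R / Dt⌋ + 1 := by gcongr
  -- Covariances of `h` vanish outside the smaller box, so the box may be enlarged to suit the range
  -- `R` of `g`.
  rw [← sum_box_eq_of_le hbox fun i hi => innovCov_eq_zero hP hDt le_rfl hh hh hi] at h0
  set M := ⌊R / Dt⌋ + 1
  set B : (Plane → Config → ℝ) → (Plane → Config → ℝ) → ℝ :=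
    fun F G => ∑ i ∈ box M, innovCov P lam Dt F G i with hB
  have hadd : ∀ (F G H : Plane → Config → ℝ), IsLocal R F → IsLocal R G → IsLocal R H → ∀ a,
      B F (fun x φ => G x φ + a * H x φ) = B F G + a * B F H := by
    intro F G H hF hG hH a
    simp only [hB, innovCov_add_smul_right hP hF hG hH, Finset.sum_add_distrib, Finset.mul_sum]
  have hsymm : ∀ (F G : Plane → Config → ℝ), IsLocal R F → IsLocal R G → B F G = B G F := by
    intro F G hF hG
    simp only [hB]
    rw [← sum_box_neg]
    exact Finset.sum_congr rfl fun i _ => innovCov_neg hP hF hG i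
  have hquad : ∀ a : ℝ, 0 ≤ B h h + 2 * a * B g h + a ^ 2 * B g g := by
    intro a
    have hF := hhR.add_smul hg a
    have h1 : 0 ≤ B _ _ := sum_innovCov_self_nonneg hP hDt hDR hF
    rw [hadd _ _ _ hF hhR hg, hsymm _ _ hF hhR, hsymm _ _ hF hg, hadd _ _ _ hhR hhR hg,
      hadd _ _ _ hg hhR hg, hsymm _ _ hhR hg] at h1
    linarith
  have hzero : B g h = 0 := by
    by_contra hne
    have hgg : 0 ≤ B g g := sum_innovCov_self_nonneg hP hDt hDR hg
    -- Cauchy-Schwarz for the semidefinite form `B`; the denominator `B g g + 1` instead of `B g g`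
    -- also covers the degenerate case `B g g = 0`.
    have h1 := hquad (-(B g h) / (B g g + 1))
    have h2 : 0 < B g h ^ 2 := by positivity
    have h3 : 0 < B g g + 1 := by linarith
    have e : 2 * (-(B g h) / (B g g + 1)) * B g h + (-(B g h) / (B g g + 1)) ^ 2 * B g g =
        -(B g h ^ 2 * (B g g + 2)) / (B g g + 1) ^ 2 := by field_simp; ring
    have h4 : -(B g h ^ 2 * (B g g + 2)) / (B g g + 1) ^ 2 < 0 :=
      div_neg_of_neg_of_pos (by nlinarith) (by positivity)
    have h5 : B h h ≤ 0 := h0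
    linarith
  have hT : Measurable fun φ => ∑ i ∈ box M, innov lam h (cell Dt i) φ :=
    Finset.measurable_fun_sum _ fun i _ => measurable_innov hP (measurableSet_cell Dt i) hhR
  have hT2 : MemLp (fun φ => ∑ i ∈ box M, innov lam h (cell Dt i) φ) 2 P :=
    memLp_finsetSum _ fun i _ => memLp_innov_cell hP hhR i
  obtain ⟨hI, hE⟩ := innov_duality hP (measurableSet_cell Dt 0) (isBounded_cell Dt 0) hg hT hT2
  simp only [← Finset.sum_sub_distrib] at hI hE
  refine ⟨hI, hE.symm.trans ?_⟩
  rw [← hzero]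
  simp only [hB, innovCov, Finset.mul_sum]
  exact integral_finsetSum _ fun i _ => integrable_innov_mul hP hg hhR 0 i

end

/-! ### The pseudo-score as an innovation -/

section

variable {p : ℕ} (β₀ : ℝ) (d θ : Fin (p + 1) → ℝ)

/-- The increment of the `k`-th coordinate of the energy when a point is added. -/
def incr (k : Fin (p + 1)) (x : Plane) (φ : Config) : ℝ := u β₀ d {x} φ.1 k

/-- The conditional intensity of the model. -/
def intensity (x : Plane) (φ : Config) : ℝ := Real.exp (-V β₀ d θ {x} φ.1)

theorem score_eq (Dt : ℝ) (i : Fin 2 → ℤ) (φ : Config) (k : Fin (p + 1)) :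
    score β₀ d θ Dt i φ k = innov (intensity β₀ d θ) (incr β₀ d k) (cell Dt i) φ := by
  have hb := isBounded_cell Dt i
  rw [score, innov, setIntegral_pts _ hb]
  congr 1
  exact finsum_mem_eq_finite_toFinset_sum _ (φ.2 _ hb)

variable {β₀} (h0 : 0 < β₀) (h1 : β₀ < Real.pi / 3) {D : ℝ} (hR : IsRange β₀ d D)

include h0 h1 hR

theorem isLocal_incr (k : Fin (p + 1)) : IsLocal D (incr β₀ d k) := by
  obtain ⟨K, hK, hb⟩ := exists_bound_u h0 h1 d
  refine ⟨?_, ⟨K, hK.le, fun x φ => hb x φ.1 k⟩, fun x φ => ?_, fun v x φ => ?_⟩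
  · exact measurable_u h0 d (ψ := fun q : Plane × Config => Config.single q.1)
      (φ := fun q : Plane × Config => q.2) (measurable_single.comp measurable_fst)
      measurable_snd k
  · exact hR.u_eq x φ k
  · exact congrFun (u_shift_point β₀ d x φ.1 v) k

theorem isLocal_intensity : IsLocal D (intensity β₀ d θ) := by
  have hI := isLocal_incr d h0 h1 hR
  obtain ⟨K, hK, hb⟩ := exists_bound_V h0 h1 d θ
  refine ⟨?_, ⟨Real.exp K, (Real.exp_pos K).le, fun x φ => ?_⟩, fun x φ => ?_, fun v x φ => ?_⟩
  · exact (measurable_V h0 d θ (ψ := fun q : Plane × Config => Config.single q.1)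
      (φ := fun q : Plane × Config => q.2) (measurable_single.comp measurable_fst)
      measurable_snd).neg.exp
  · rw [intensity, abs_of_pos (Real.exp_pos _)]
    exact Real.exp_le_exp.2 ((neg_le_abs _).trans (hb x φ.1))
  · simp only [intensity, V]
    congr 2
    exact Finset.sum_congr rfl fun k _ => congrArg _ ((hI k).range x φ)
  · simp only [intensity, V]
    congr 2
    exact Finset.sum_congr rfl fun k _ => congrArg _ ((hI k).shift v x φ)

theorem hasIntensity (hD : 0 < D) {P : Measure Config} [IsProbabilityMeasure P]
    (hstat : IsStationary P) (hG : IsGibbs β₀ d θ P) :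
    HasIntensity P (intensity β₀ d θ) D where
  gnz _ hC hb _ hF := IsGibbs.gnz h0 h1 d θ hC hb hG hF
  stat := hstat
  loc := isLocal_intensity d θ h0 h1 hR
  pos _ _ := Real.exp_pos _
  range_pos := hD

end

/-! ### Configurations with few points -/

section

variable {P : Measure Config} [IsProbabilityMeasure P] {lam : Plane → Config → ℝ} {D : ℝ}
  (hP : HasIntensity P lam D) {B : Set Plane} (hB : MeasurableSet B)
  (hb : Bornology.IsBounded B)

include hP hB hb

/-- A bounded set is empty with positive probability. -/
theorem void_pos : P {φ | pts φ B = 0} ≠ 0 := by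
  intro h0
  have hm := measurable_pts_apply hB
  have hS : ∀ n : ℕ, MeasurableSet {φ : Config | pts φ B = n} := fun n =>
    hm (measurableSet_singleton _)
  -- If counts equal to `n` have probability zero, the Georgii-Nguyen-Zessin formula excludes counts
  -- equal to `n + 1`, since erasing a point leads back to `n`. All counts would then be impossible.
  have key : ∀ n : ℕ, P {φ | pts φ B = n} = 0 := by
    intro n
    induction n with
    | zero => simpa using h0
    | succ n ih =>
      have h := hP.gnz B hB hb (fun _ φ => {φ | pts φ B = n}.indicator 1 φ)
        ((measurable_one.indicator (hS n)).comp measurable_snd)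
      have hz : ∫⁻ φ, (∫⁻ x in B, ENNReal.ofReal (lam x φ) *
          {φ : Config | pts φ B = n}.indicator 1 φ) ∂P = 0 := by
        rw [lintegral_eq_zero_iff']
        · have : ∀ᵐ φ ∂P, φ ∉ {φ : Config | pts φ B = n} := measure_eq_zero_iff_ae_notMem.1 ih
          filter_upwards [this] with φ hφ
          refine (lintegral_congr fun x => ?_).trans lintegral_zero
          rw [indicator_of_notMem (by exact hφ), mul_zero]
        · refine Measurable.aemeasurable (Measurable.lintegral_prod_left'
            (f := fun q : Plane × Config => ENNReal.ofReal (lam q.1 q.2) *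
              {φ : Config | pts φ B = n}.indicator 1 q.2) ?_)
          exact (ENNReal.measurable_ofReal.comp hP.loc.meas).mul
            ((measurable_one.indicator (hS n)).comp measurable_snd)
      rw [hz] at h
      refine le_antisymm ?_ zero_le
      rw [← h, ← lintegral_indicator_one (hS (n + 1))]
      refine lintegral_mono fun φ => ?_
      by_cases hφ : φ ∈ {φ : Config | pts φ B = ((n + 1 : ℕ) : ENNReal)}
      · have hc : pts φ B = ((n + 1 : ℕ) : ENNReal) := hφ
        rw [indicator_of_mem hφ, Pi.one_apply]
        calc (1 : ENNReal) ≤ pts φ B := by rw [hc]; exact_mod_cast Nat.le_add_left 1 n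
          _ = ∫⁻ _ in B, 1 ∂pts φ := by simp
          _ ≤ _ := by
            rw [restrict_pts φ hb, lintegral_finsetSum_measure, lintegral_finsetSum_measure]
            refine Finset.sum_le_sum fun x hx => ?_
            rw [Finite.mem_toFinset] at hx
            rw [lintegral_dirac, lintegral_dirac, indicator_of_mem, Pi.one_apply]
            change pts (φ.erase x) B = n
            rw [pts_apply_of_bounded _ hb] at hc ⊢
            have e : (φ.erase x).1 ∩ B = (φ.1 ∩ B) \ {x} := by
              rw [Config.coe_erase, inter_sdiff_right_comm]
            have hc' : (φ.1 ∩ B).ncard = n + 1 := by exact_mod_cast hc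
            rw [e, ncard_sdiff_singleton_of_mem hx, hc', Nat.add_sub_cancel]
      · rw [indicator_of_notMem hφ]; exact zero_le
  have hall : (univ : Set Config) ⊆ ⋃ n : ℕ, {φ | pts φ B = n} := fun φ _ =>
    mem_iUnion.2 ⟨_, pts_apply_of_bounded φ hb⟩
  have := measure_mono_null hall (measure_iUnion_null key)
  simp at this

/-- With positive probability, a bounded set contains exactly one point, and this point lies in a
given set of positive area. -/
theorem single_pos {A : Set Plane} (hA : MeasurableSet A) (hAB : A ⊆ B) (hA0 : volume A ≠ 0) :
    P {φ | ∃ a ∈ φ.1, a ∈ A ∧ ∀ z ∈ φ.1, z ∈ B → z = a} ≠ 0 := by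
  intro h
  have hS : MeasurableSet {φ : Config | pts φ B = 0} :=
    measurable_pts_apply hB (measurableSet_singleton _)
  have hg := hP.gnz A hA (hb.subset hAB) (fun _ φ => {φ | pts φ B = 0}.indicator 1 φ)
    ((measurable_one.indicator hS).comp measurable_snd)
  -- A point of `A` whose removal empties `B` is the only point of `B`. If this were almost surely
  -- impossible, the other side of the formula would vanish, although the intensity is positive, `A`
  -- has positive area and `B` may be empty.
  have hz : ∫⁻ φ, (∫⁻ x in A, {φ | pts φ B = 0}.indicator 1 (φ.erase x) ∂pts φ) ∂P = 0 := by
    have hnot : ∀ᵐ φ ∂P, φ ∉ {φ : Config | ∃ a ∈ φ.1, a ∈ A ∧ ∀ z ∈ φ.1, z ∈ B → z = a} :=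
      measure_eq_zero_iff_ae_notMem.1 h
    refine (lintegral_congr_ae ?_).trans lintegral_zero
    filter_upwards [hnot] with φ hφ
    rw [restrict_pts φ (hb.subset hAB), lintegral_finsetSum_measure]
    refine Finset.sum_eq_zero fun x hx => ?_
    rw [Finite.mem_toFinset] at hx
    rw [lintegral_dirac, indicator_of_notMem]
    intro he
    refine hφ ⟨x, hx.1, hx.2, fun z hz hzB => ?_⟩
    by_contra hne
    exact (pts_eq_zero_iff _ _).1 he z ⟨hz, hne⟩ hzB
  rw [hz] at hg
  have hlm : Measurable fun q : Plane × Config => ENNReal.ofReal (lam q.1 q.2) *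
      {φ : Config | pts φ B = 0}.indicator 1 q.2 :=
    (ENNReal.measurable_ofReal.comp hP.loc.meas).mul
      ((measurable_one.indicator hS).comp measurable_snd)
  have h2 := (lintegral_eq_zero_iff' (Measurable.lintegral_prod_left' hlm).aemeasurable).1 hg.symm
  refine void_pos hP hB hb (measure_mono_null ?_ (ae_iff.1 h2))
  intro φ hφ hzero
  simp only [indicator_of_mem hφ, Pi.one_apply, mul_one, Pi.zero_apply] at hzero
  have hm : Measurable fun x => ENNReal.ofReal (lam x φ) :=
    ENNReal.measurable_ofReal.comp (hP.loc.meas.comp (measurable_prodMk_right (y := φ)))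
  have h3 := (lintegral_eq_zero_iff hm).1 hzero
  have h4 : ∀ᵐ x ∂(volume.restrict A), False := by
    filter_upwards [h3] with x hx
    exact (ENNReal.ofReal_pos.2 (hP.pos x φ)).ne' hx
  rw [ae_iff] at h4
  simp at h4
  exact hA0 h4

end

/-! ### Ratios of the sides of fat triangles -/

theorem angle_eq_pi_div_three {a b c : Plane} (h1 : dist b a = 1) (h2 : dist c a = 1)
    (h3 : dist b c = 1) : EuclideanGeometry.angle b a c = Real.pi / 3 := by
  rw [EuclideanGeometry.angle, InnerProductGeometry.angle,
    real_inner_eq_norm_mul_self_add_norm_mul_self_sub_norm_sub_mul_self_div_two]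
  refine Real.arccos_eq_of_eq_cos (by linarith [Real.pi_nonneg]) (by linarith [Real.pi_nonneg]) ?_
  simp only [vsub_sub_vsub_cancel_right, ← dist_eq_norm_vsub, h1, h2, h3, Real.cos_pi_div_three]
  norm_num

theorem exists_equilateral : ∃ a b c : Plane, dist a b = 1 ∧ dist a c = 1 ∧ dist b c = 1 ∧
    orient a b c ≠ 0 := by
  have h3 : √3 ^ 2 = 3 := Real.sq_sqrt (by norm_num)
  refine ⟨!₂[0, 0], !₂[1, 0], !₂[1 / 2, √3 / 2], ?_, ?_, ?_, ?_⟩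
  · simp [EuclideanSpace.dist_eq, Real.dist_eq]
  · rw [EuclideanSpace.dist_eq, Real.sqrt_eq_one]
    simp [Real.dist_eq, div_pow, h3]; norm_num
  · rw [EuclideanSpace.dist_eq, Real.sqrt_eq_one]
    simp [Real.dist_eq, div_pow, h3]; norm_num
  · simp [orient, det]

/-- Law of sines in determinant form: twice the area is at least `sin β₀` times `|z b| |a b|` and at
most `|a z| |b z|`. -/
theorem AnglesGT.sin_mul_dist_le {β₀ : ℝ} (h0 : 0 < β₀) {a b z : Plane} (ho : orient a b z ≠ 0)
    (h : AnglesGT β₀ a b z) : Real.sin β₀ * dist a b ≤ dist a z := by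
  obtain ⟨hab, haz, hbz⟩ := orient_ne_imp ho
  have e1 := abs_det_le (a - z) (b - z)
  have e2 : det (a - z) (b - z) = orient a b z := by
    simp only [orient, det, PiLp.sub_apply]; ring
  rw [e2, ← dist_eq_norm, ← dist_eq_norm] at e1
  have key : Real.sin β₀ * (dist z b * dist a b) ≤ |orient a b z| := by
    rcases lt_or_gt_of_ne ho with hlt | hgt
    · have hs := orient_swap a b z
      have := (h.swap.isFat h0 haz hab hbz.symm (by linarith)).sc
      rw [hs] at this
      rw [abs_of_neg hlt]
      linarith [mul_comm (dist z b) (dist a b)]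
    · have := (h.isFat h0 hab haz hbz hgt).sb
      rwa [abs_of_pos hgt]
  have hpos : 0 < dist b z := dist_pos.2 hbz
  rw [dist_comm z b] at key
  nlinarith

/-- The ratios of two sides of a triangle with all angles larger than `β₀` form a bounded set;
the supremum is at least one, and is approached. -/
theorem exists_side_ratio {β₀ : ℝ} (h0 : 0 < β₀) (h1 : β₀ < Real.pi / 3) : ∃ M : ℝ, 1 ≤ M ∧
    (∀ a b z : Plane, orient a b z ≠ 0 → AnglesGT β₀ a b z → dist a b ≤ M * dist a z) ∧
    ∀ r < M, ∃ a b z : Plane, orient a b z ≠ 0 ∧ AnglesGT β₀ a b z ∧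
      r * dist a z < dist a b := by
  set Q : Set ℝ := {r | ∃ a b z : Plane, orient a b z ≠ 0 ∧ AnglesGT β₀ a b z ∧
    r = dist a b / dist a z} with hQ
  have hs := sin_pos_of_lt h0 h1
  have hbdd : BddAbove Q := by
    refine ⟨1 / Real.sin β₀, ?_⟩
    rintro _ ⟨a, b, z, ho, h, rfl⟩
    have haz : 0 < dist a z := dist_pos.2 (orient_ne_imp ho).2.1
    rw [div_le_div_iff₀ haz hs]
    linarith [h.sin_mul_dist_le h0 ho]
  -- The equilateral triangle is admissible because `β₀ < π / 3`.
  have hone : (1 : ℝ) ∈ Q := by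
    obtain ⟨a, b, c, hab, hac, hbc, ho⟩ := exists_equilateral
    have hba := (dist_comm b a).trans hab
    have hca := (dist_comm c a).trans hac
    have hcb := (dist_comm c b).trans hbc
    refine ⟨a, b, c, ho, ⟨?_, ?_, ?_⟩, by rw [hab, hac, div_one]⟩
    · rwa [angle_eq_pi_div_three hba hca hbc]
    · rwa [angle_eq_pi_div_three hcb hab hca]
    · rwa [angle_eq_pi_div_three hac hbc hab]
  refine ⟨sSup Q, le_csSup hbdd hone, fun a b z ho h => ?_, fun r hr => ?_⟩
  · have haz : 0 < dist a z := dist_pos.2 (orient_ne_imp ho).2.1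
    rw [← div_le_iff₀ haz]
    exact le_csSup hbdd ⟨a, b, z, ho, h, rfl⟩
  · obtain ⟨_, ⟨a, b, z, ho, h, rfl⟩, hlt⟩ := exists_lt_of_lt_csSup ⟨1, hone⟩ hr
    have haz : 0 < dist a z := dist_pos.2 (orient_ne_imp ho).2.1
    exact ⟨a, b, z, ho, h, (lt_div_iff₀ haz).1 hlt⟩

theorem AnglesGT.smul {β₀ c : ℝ} (hc : c ≠ 0) {a b z : Plane} (h : AnglesGT β₀ a b z) :
    AnglesGT β₀ 0 (c • (b - a)) (c • (z - a)) := by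
  have e : ∀ x y w : Plane, EuclideanGeometry.angle (c • (x - a)) (c • (y - a)) (c • (w - a)) =
      EuclideanGeometry.angle x y w := by
    intro x y w
    simp only [EuclideanGeometry.angle, vsub_eq_sub, ← smul_sub, sub_sub_sub_cancel_right]
    exact InnerProductGeometry.angle_smul_smul hc _ _
  have ha : (0 : Plane) = c • (a - a) := by simp
  rw [ha]
  exact ⟨by rw [e]; exact h.1, by rw [e]; exact h.2.1, by rw [e]; exact h.2.2⟩

theorem anglesGT_translate {β₀ : ℝ} {x a z : Plane} :
    AnglesGT β₀ 0 (a - x) (z - x) ↔ AnglesGT β₀ x a z := by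
  have e : ∀ p q r : Plane, EuclideanGeometry.angle (p - x) (q - x) (r - x) =
      EuclideanGeometry.angle p q r := by
    intro p q r
    simp only [EuclideanGeometry.angle, vsub_eq_sub, sub_sub_sub_cancel_right]
  rw [← sub_self x]
  simp only [AnglesGT, e]

theorem orient_translate (x a z : Plane) : orient 0 (a - x) (z - x) = orient x a z := by
  simp only [orient, sub_zero]

theorem continuous_orient : Continuous fun q : Plane × Plane => orient 0 q.1 q.2 := by
  simp only [orient, det, sub_zero]
  fun_prop

/-- If `s < t`, there is an open set of bases all of whose fat triangles have sides longer than
`s` and such that an open set of fat triangles has a side of length at most `t`. -/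
theorem exists_base {β₀ : ℝ} (h0 : 0 < β₀) (h1 : β₀ < Real.pi / 3) {s t : ℝ} (hs : 0 ≤ s)
    (hst : s < t) : ∃ w₀ z₀ : Plane, ∃ ε > 0, ∀ x a : Plane, a - x ∈ Metric.ball w₀ ε → a ≠ x ∧
      (∀ z, orient x a z ≠ 0 → AnglesGT β₀ x a z →
        s < dist x a ∧ s < dist x z ∧ s < dist a z) ∧
      ∀ z, z - x ∈ Metric.ball z₀ ε → orient x a z ≠ 0 ∧ AnglesGT β₀ x a z ∧ dist x z ≤ t := by
  obtain ⟨M, hM1, hMle, hMlt⟩ := exists_side_ratio h0 h1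
  have ht : 0 < t := hs.trans_lt hst
  have hMpos : 0 < M := by linarith
  -- As `s < t`, the ratio `M s / t` is below the supremum `M`. A nearly extremal triangle can be
  -- scaled so that its base exceeds `M s` while another side stays below `t`.
  obtain ⟨a, b, z, ho, hA, hr⟩ := hMlt (M * s / t) (by rw [div_lt_iff₀ ht]; nlinarith)
  obtain ⟨hab, haz, hbz⟩ := orient_ne_imp ho
  have hdz : 0 < dist a z := dist_pos.2 haz
  have hdb : 0 < dist a b := dist_pos.2 hab
  -- the scale of the model triangle
  obtain ⟨c, hc1, hc2⟩ : ∃ c, M * s / dist a b < c ∧ c < t / dist a z := by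
    refine exists_between ?_
    rw [div_lt_div_iff₀ hdb hdz]
    have : M * s / t * dist a z * t < dist a b * t := mul_lt_mul_of_pos_right hr ht
    have e : M * s / t * dist a z * t = M * s * dist a z := by field_simp
    linarith
  have hcpos : 0 < c := lt_of_le_of_lt (by positivity) hc1
  rw [div_lt_iff₀ hdb] at hc1
  rw [lt_div_iff₀ hdz] at hc2
  set w₀ := c • (b - a)
  set z₀ := c • (z - a)
  have hw : ‖w₀‖ = c * dist a b := by
    rw [norm_smul, Real.norm_of_nonneg hcpos.le, dist_comm, dist_eq_norm]
  have hz : ‖z₀‖ = c * dist a z := by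
    rw [norm_smul, Real.norm_of_nonneg hcpos.le, dist_comm, dist_eq_norm]
  have ho' : orient 0 w₀ z₀ ≠ 0 := by
    have : orient 0 w₀ z₀ = c ^ 2 * orient a b z := by
      simp only [orient, det, w₀, z₀, PiLp.sub_apply, PiLp.smul_apply, PiLp.zero_apply,
        smul_eq_mul]
      ring
    rw [this]; positivity
  have hA' : AnglesGT β₀ 0 w₀ z₀ := hA.smul hcpos.ne'
  obtain ⟨h0w, h0z, hwz⟩ := orient_ne_imp ho'
  have hang : ∀ {f g h : Plane × Plane → Plane}, Continuous f → Continuous g → Continuous h →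
      f (w₀, z₀) ≠ g (w₀, z₀) → h (w₀, z₀) ≠ g (w₀, z₀) →
      β₀ < EuclideanGeometry.angle (f (w₀, z₀)) (g (w₀, z₀)) (h (w₀, z₀)) →
      ∀ᶠ q in nhds (w₀, z₀), β₀ < EuclideanGeometry.angle (f q) (g q) (h q) := by
    intro f g h hf hg hh hfg hhg hlt
    have hc : ContinuousAt (fun q => EuclideanGeometry.angle (f q) (g q) (h q)) (w₀, z₀) :=
      ContinuousAt.comp (g := fun y : Plane × Plane × Plane =>
        EuclideanGeometry.angle y.1 y.2.1 y.2.2) (f := fun q => (f q, g q, h q))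
        (EuclideanGeometry.continuousAt_angle hfg hhg)
        (hf.prodMk (hg.prodMk hh)).continuousAt
    exact hc.eventually (lt_mem_nhds hlt)
  have hev : ∀ᶠ q : Plane × Plane in nhds (w₀, z₀), orient 0 q.1 q.2 ≠ 0 ∧
      AnglesGT β₀ 0 q.1 q.2 ∧ M * s < ‖q.1‖ ∧ ‖q.2‖ < t := by
    refine (continuous_orient.continuousAt.eventually_ne ho').and
      (((hang continuous_fst continuous_const continuous_snd h0w.symm h0z.symm hA'.1).and
        ((hang continuous_snd continuous_fst continuous_const hwz.symm h0w hA'.2.1).and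
          (hang continuous_const continuous_snd continuous_fst h0z hwz hA'.2.2))).and ?_)
    have c1 : Continuous fun q : Plane × Plane => ‖q.1‖ := continuous_fst.norm
    have c2 : Continuous fun q : Plane × Plane => ‖q.2‖ := continuous_snd.norm
    exact (c1.continuousAt.eventually (lt_mem_nhds (by simpa [hw] using hc1))).and
      (c2.continuousAt.eventually (gt_mem_nhds (by simpa [hz] using hc2)))
  obtain ⟨ε, hε, hball⟩ := Metric.eventually_nhds_iff_ball.1 hev
  have hprod : ∀ w ∈ Metric.ball w₀ ε, ∀ y ∈ Metric.ball z₀ ε, orient 0 w y ≠ 0 ∧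
      AnglesGT β₀ 0 w y ∧ M * s < ‖w‖ ∧ ‖y‖ < t := fun w hw y hy =>
    hball (w, y) (by rw [← ball_prod_same]; exact ⟨hw, hy⟩)
  refine ⟨w₀, z₀, ε, hε, fun x a ha => ?_⟩
  have hself := hprod _ ha z₀ (Metric.mem_ball_self hε)
  have hbase : M * s < dist x a := by
    rw [dist_comm, dist_eq_norm]; exact hself.2.2.1
  refine ⟨fun h => hself.1 (by rw [h, sub_self]; simp [orient, det]), fun y hoy hAy => ?_,
    fun y hy => ?_⟩
  -- The base exceeds `M s` and no other side is shorter than the base divided by `M`, so all sides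
  -- exceed `s`.
  · have e1 := hMle x a y hoy hAy
    have e2 := hMle a x y (by
      have q1 := orient_rotate a x y
      have q2 := orient_swap x a y
      intro h; apply hoy; linarith) (hAy.swap.rotate.rotate)
    rw [dist_comm a x] at e2
    exact ⟨by nlinarith, lt_of_mul_lt_mul_left (hbase.trans_le e1) hMpos.le,
      lt_of_mul_lt_mul_left (hbase.trans_le e2) hMpos.le⟩
  · have h := hprod _ ha _ hy
    rw [orient_translate, anglesGT_translate] at h
    refine ⟨h.1, h.2.1, ?_⟩
    rw [dist_comm, dist_eq_norm]; exact h.2.2.2.le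

/-! ### Increments in configurations with few points -/

open Classical in
theorem edgesIoc_eq_empty {β₀ s t : ℝ} {φ : Set Plane} {a b : Plane} (h : φ ⊆ {a, b}) :
    edgesIoc β₀ s t φ = ∅ := by
  rw [eq_empty_iff_forall_notMem]
  rintro ξ ⟨⟨-, ψ, ⟨⟨hc, o, r, -, hi⟩, -⟩, -⟩, -⟩
  have hsub : ψ ⊆ {a, b} := by
    intro y hy
    have hy' : y ∈ φ ∩ Metric.closedBall o r := by rw [hi]; exact hy
    simpa using h hy'.1
  have := (Finset.card_le_card hsub).trans Finset.card_le_two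
  omega

theorem eq_of_mem_betaDel3_triple {β₀ : ℝ} {x a z : Plane} {ψ : Finset Plane}
    (h : ψ ∈ betaDel3 β₀ {z, a, x}) : ψ = {z, a, x} := by
  obtain ⟨⟨hc, o, r, -, hi⟩, -⟩ := h
  refine Finset.eq_of_subset_of_card_le ?_ (Finset.card_le_three.trans hc.ge)
  intro y hy
  have : y ∈ ({z, a, x} : Set Plane) ∩ Metric.closedBall o r := by rw [hi]; exact hy
  simpa using this.1

section

variable {p : ℕ} {β₀ : ℝ} {d : Fin (p + 1) → ℝ}

/-- At most two points carry no triangle, so only the point count changes. -/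
theorem u_of_subset_singleton {z x : Plane} {φ : Set Plane} (hz : z ∉ φ) (hφ : φ ⊆ {x})
    (k : Fin (p + 1)) : u β₀ d {z} φ k = (Pi.single 0 1 : Fin (p + 1) → ℝ) k := by
  refine Fin.cases ?_ (fun k => ?_) k
  · have : ({z} : Set Plane) \ φ = {z} := by simpa using hz
    simp [u, this]
  · have e1 : edgesIoc β₀ (d k.castSucc) (d k.succ) ({z} ∪ φ) = ∅ :=
      edgesIoc_eq_empty (a := z) (b := x) (by
        rw [singleton_union]; exact insert_subset_insert hφ)
    have e2 : edgesIoc β₀ (d k.castSucc) (d k.succ) φ = ∅ :=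
      edgesIoc_eq_empty (a := x) (b := x) (by simpa using hφ)
    simp only [u, Fin.cons_succ, e1, e2]
    simp

theorem u_pair {z a x : Plane} (k : Fin p) : u β₀ d {z} {a, x} k.succ =
    (edgesIoc β₀ (d k.castSucc) (d k.succ) {z, a, x}).ncard := by
  simp only [u, Fin.cons_succ, singleton_union]
  rw [edgesIoc_eq_empty (φ := {a, x}) (a := a) (b := x) le_rfl]
  simp

theorem finite_edges_triple {s t : ℝ} {z a x : Plane} :
    (edgesIoc β₀ s t ({z, a, x} : Set Plane)).Finite := by
  classical
  refine (Finset.finite_toSet (({z, a, x} : Finset Plane).powerset)).subset fun ξ hξ => ?_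
  rw [Finset.mem_coe, Finset.mem_powerset]
  intro y hy
  simpa using mem_of_mem_edgesIoc hξ hy

/-- An edge of a triangle whose sides are longer than `s` is longer than `s`. -/
theorem edgesIoc_triple_eq_empty (h0 : 0 < β₀) {s t r : ℝ} (hts : t ≤ s) {z a x : Plane}
    (hsides : orient x a z ≠ 0 → AnglesGT β₀ x a z → s < dist x a ∧ s < dist x z ∧ s < dist a z) :
    edgesIoc β₀ r t ({z, a, x} : Set Plane) = ∅ := by
  classical
  rw [eq_empty_iff_forall_notMem]
  intro ξ hξ
  obtain ⟨⟨hc, ψ, hψ, hsub⟩, hlen⟩ := id hξ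
  have hψe := eq_of_mem_betaDel3_triple hψ
  have hperm : ({z, a, x} : Finset Plane) = {x, a, z} := by ext; simp; tauto
  rw [hψe, hperm, mem_betaDel3_iff h0] at hψ
  obtain ⟨h1, h2, h3⟩ := hsides hψ.2.2.2.1 hψ.2.2.2.2.1
  obtain ⟨b, c, hbc, rfl⟩ := Finset.card_eq_two.1 hc
  rw [Finset.coe_pair, Metric.diam_pair] at hlen
  have hb : b ∈ ({x, a, z} : Finset Plane) := by rw [← hperm, ← hψe]; exact hsub (by simp)
  have hc' : c ∈ ({x, a, z} : Finset Plane) := by rw [← hperm, ← hψe]; exact hsub (by simp)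
  simp only [Finset.mem_insert, Finset.mem_singleton] at hb hc'
  have h1' := dist_comm x a
  have h2' := dist_comm x z
  have h3' := dist_comm a z
  rcases hb with rfl | rfl | rfl <;> rcases hc' with rfl | rfl | rfl <;>
    first
    | exact hbc rfl
    | linarith [hlen.2]

theorem mem_edgesIoc_triple (h0 : 0 < β₀) {s t : ℝ} {z a x : Plane} (ho : orient x a z ≠ 0)
    (hA : AnglesGT β₀ x a z) (hl : dist x z ∈ Ioc s t) :
    ({x, z} : Finset Plane) ∈ edgesIoc β₀ s t ({z, a, x} : Set Plane) := by
  rw [mem_edgesIoc_iff]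
  refine ⟨(orient_ne_imp ho).2.1, hl, a, by simp, ?_⟩
  have hperm : ({x, z, a} : Finset Plane) = {x, a, z} := by ext; simp; tauto
  rw [hperm, mem_betaDel3_iff h0]
  refine ⟨by simp, by simp, by simp, ho, hA, fun y hy _ => ?_⟩
  simp only [mem_insert_iff, mem_singleton_iff] at hy
  tauto

end

/-- The linear combination of the increments with coefficients `y`. -/
def combIncr {p : ℕ} (β₀ : ℝ) (d y : Fin (p + 1) → ℝ) (x : Plane) (φ : Config) : ℝ :=
  ∑ k, y k * incr β₀ d k x φ

section

variable {p : ℕ} {β₀ : ℝ} (d θ y : Fin (p + 1) → ℝ) (h0 : 0 < β₀) (h1 : β₀ < Real.pi / 3)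
  {D : ℝ} (hR : IsRange β₀ d D)

include h0 h1 hR in
theorem isLocal_combIncr : IsLocal D (combIncr β₀ d y) :=
  IsLocal.sum (isLocal_incr d h0 h1 hR) y Finset.univ

include hR

theorem incr_of_subset_singleton {z x : Plane} {φ : Config} (hz : z ∉ φ.1)
    (hφ : φ.1 ∩ Metric.closedBall z D ⊆ {x}) (k : Fin (p + 1)) :
    incr β₀ d k z φ = (Pi.single 0 1 : Fin (p + 1) → ℝ) k := by
  rw [incr, hR.u_eq]
  exact u_of_subset_singleton (fun h => hz h.1) hφ k

theorem combIncr_of_subset_singleton {z x : Plane} {φ : Config} (hz : z ∉ φ.1)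
    (hφ : φ.1 ∩ Metric.closedBall z D ⊆ {x}) : combIncr β₀ d y z φ = y 0 := by
  simp only [combIncr, incr_of_subset_singleton d hR hz hφ]
  simp [Pi.single_apply]

theorem intensity_of_subset_singleton {z x : Plane} {φ : Config} (hz : z ∉ φ.1)
    (hφ : φ.1 ∩ Metric.closedBall z D ⊆ {x}) : intensity β₀ d θ z φ = Real.exp (-θ 0) := by
  have h := combIncr_of_subset_singleton d θ hR hz hφ
  rw [intensity, ← h]
  rfl

include h0 h1

open Classical in
/-- The effect of adding a point on an innovation, near which there is at most one point. -/
theorem innov_sub_innov_insert (hD : 0 < D) {x a : Plane} {φ : Config} (hx : x ∉ φ.1)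
    (hφ : φ.1 ∩ Metric.closedBall x (2 * D) ⊆ {a}) {C : Set Plane}
    (hb : Bornology.IsBounded C) :
    innov (intensity β₀ d θ) (combIncr β₀ d y) C φ -
      innov (intensity β₀ d θ) (combIncr β₀ d y) C (φ.insert x) =
    (∫ z in C, (combIncr β₀ d y z φ * intensity β₀ d θ z φ -
      combIncr β₀ d y z (φ.insert x) * intensity β₀ d θ z (φ.insert x))) +
      if x ∈ C then y 0 else 0 := by
  have hh := isLocal_combIncr d y h0 h1 hR
  have hl := isLocal_intensity d θ h0 h1 hR
  have hint : ∀ φ : Config, IntegrableOn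
      (fun z => combIncr β₀ d y z φ * intensity β₀ d θ z φ) C := hl.integrableOn_mul hh hb
  -- A point `z` farther than `D` from `x` does not see it. A closer one sees no other point of `φ`,
  -- because it is the unique point within `2 D` of `x`; with at most `x` in view, its increment is
  -- `y 0` in either case.
  have hterm : ∀ z ∈ φ.1, combIncr β₀ d y z ((φ.insert x).erase z) =
      combIncr β₀ d y z (φ.erase z) := by
    intro z hz
    have hne : x ≠ z := fun h => hx (h ▸ hz)
    rw [Config.erase_insert_of_ne hne]
    rcases lt_or_ge D (dist z x) with hlt | hle
    · exact hh.congr (restrict_insert_of_lt_dist hlt _)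
    · have hclose : ∀ b ∈ φ.1, dist b z ≤ D → b = z := by
        intro b hbm hbz
        have hd := dist_triangle b z x
        have e1 : b ∈ ({a} : Set Plane) := hφ ⟨hbm, Metric.mem_closedBall.2 (by linarith)⟩
        have e2 : z ∈ ({a} : Set Plane) := hφ ⟨hz, Metric.mem_closedBall.2 (by linarith)⟩
        exact e1.trans e2.symm
      have hz1 : z ∉ (φ.erase z).1 := fun h => h.2 rfl
      have hz2 : z ∉ ((φ.erase z).insert x).1 := by
        rw [Config.coe_insert]
        rintro (h | h)
        · exact hne h.symm
        · exact hz1 h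
      rw [combIncr_of_subset_singleton d y hR hz1 (x := x),
        combIncr_of_subset_singleton d y hR hz2 (x := x)]
      · rw [Config.coe_insert]
        rintro b ⟨h | h, hbz⟩
        · exact h
        · exact absurd (hclose b h.1 hbz) h.2
      · rintro b ⟨h, hbz⟩
        exact absurd (hclose b h.1 hbz) h.2
  have hself : combIncr β₀ d y x ((φ.insert x).erase x) = y 0 := by
    rw [Config.erase_insert hx]
    exact combIncr_of_subset_singleton d y hR hx
      ((inter_subset_inter_right _ (Metric.closedBall_subset_closedBall (by linarith))).trans hφ)
  rw [innov, innov, setIntegral_pts _ hb, setIntegral_pts _ hb,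
    integral_sub (hint φ) (hint (φ.insert x))]
  have hS : ∑ z ∈ (φ.2 C hb).toFinset, combIncr β₀ d y z ((φ.insert x).erase z) =
      ∑ z ∈ (φ.2 C hb).toFinset, combIncr β₀ d y z (φ.erase z) :=
    Finset.sum_congr rfl fun z hz => hterm z ((Finite.mem_toFinset _).1 hz).1
  split_ifs with hxC
  · have hfin : ((φ.insert x).2 C hb).toFinset = insert x (φ.2 C hb).toFinset := by
      ext z
      rw [Finite.mem_toFinset, Finset.mem_insert, Finite.mem_toFinset, Config.coe_insert,
        singleton_union, insert_inter_of_mem hxC, mem_insert_iff]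
    rw [hfin, Finset.sum_insert (fun h => hx ((Finite.mem_toFinset _).1 h).1), hself, hS]
    ring
  · have hfin : ((φ.insert x).2 C hb).toFinset = (φ.2 C hb).toFinset := by
      ext z
      rw [Finite.mem_toFinset, Finite.mem_toFinset, Config.coe_insert,
        singleton_union, insert_inter_of_notMem hxC]
    rw [hfin, hS]
    ring

/-- The change of the integrand of an innovation when a point is added near at most one point. -/
theorem integrand_sub_integrand_insert {x a z : Plane} {φ : Config}
    (hφ : φ.1 ∩ Metric.closedBall x (2 * D) ⊆ {a}) (hz : z ∉ φ.1) :
    combIncr β₀ d y z φ * intensity β₀ d θ z φ -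
      combIncr β₀ d y z (φ.insert x) * intensity β₀ d θ z (φ.insert x) =
    if dist z x ≤ D then y 0 * Real.exp (-θ 0) -
      combIncr β₀ d y z (φ.insert x) * intensity β₀ d θ z (φ.insert x) else 0 := by
  split_ifs with hle
  · have hsub : φ.1 ∩ Metric.closedBall z D ⊆ {a} := by
      rintro b ⟨hb, hbz⟩
      have hd := dist_triangle b z x
      rw [Metric.mem_closedBall] at hbz
      exact hφ ⟨hb, Metric.mem_closedBall.2 (by linarith)⟩
    rw [combIncr_of_subset_singleton d y hR hz hsub,
      intensity_of_subset_singleton d θ hR hz hsub]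
  · have hr := restrict_insert_of_lt_dist (not_le.1 hle) φ
    rw [(isLocal_combIncr d y h0 h1 hR).congr hr, (isLocal_intensity d θ h0 h1 hR).congr hr,
      sub_self]

end

/-! ### Nondegeneracy -/

theorem isLocal_indicator {R : ℝ} {S : Set (Plane × Config)} (hS : MeasurableSet S)
    (hr : ∀ x φ, (x, φ) ∈ S ↔ (x, φ.restrict (Metric.closedBall x R)) ∈ S)
    (hv : ∀ v x φ, (x + v, Config.translate v φ) ∈ S ↔ (x, φ) ∈ S) :
    IsLocal R fun x φ => S.indicator 1 (x, φ) := by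
  classical
  refine ⟨measurable_one.indicator hS, ⟨1, zero_le_one, fun x φ => ?_⟩, fun x φ => ?_,
    fun v x φ => ?_⟩
  · by_cases h : (x, φ) ∈ S <;> simp [h]
  · simp only [indicator_apply, hr x φ, Pi.one_apply]
  · simp only [indicator_apply, hv v x φ, Pi.one_apply]

theorem volume_config (φ : Config) : volume φ.1 = 0 := φ.countable.measure_zero _

theorem ball_subset_cell (Dt : ℝ) : Metric.ball (0 : Plane) (Dt / 2) ⊆ cell Dt 0 := by
  intro z hz j
  have h := (abs_sub_le_dist z 0 j).trans_lt (Metric.mem_ball.1 hz)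
  simp only [PiLp.zero_apply, sub_zero] at h
  have := abs_lt.1 h
  simp only [Pi.zero_apply, Int.cast_zero]
  constructor <;> linarith [this.1, this.2]

section

variable {P : Measure Config} [IsProbabilityMeasure P] {lam : Plane → Config → ℝ} {D R Dt : ℝ}
  (hP : HasIntensity P lam D)

include hP in
/-- If the asymptotic variance of the innovations of `h` vanishes, then a local event on which
adding a point changes the sum of the innovations in a fixed direction is negligible. -/
theorem prod_eq_zero_of_forall_pos (hDt : 0 < Dt) (hDR : D ≤ R) {h : Plane → Config → ℝ}
    (hh : IsLocal D h) (h0 : ∑ i ∈ box (⌊D / Dt⌋ + 1), innovCov P lam Dt h h i ≤ 0)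
    {S : Set (Plane × Config)} (hS : IsLocal R fun x φ => S.indicator 1 (x, φ)) (s : ℝ)
    (hpos : ∀ φ, ∀ x ∈ cell Dt 0, (x, φ) ∈ S → 0 < s * ∑ i ∈ box (⌊R / Dt⌋ + 1),
      (innov lam h (cell Dt i) φ - innov lam h (cell Dt i) (φ.insert x))) :
    (P.prod (volume.restrict (cell Dt 0))) {q | (q.2, q.1) ∈ S} = 0 := by
  obtain ⟨hI, hE⟩ := integral_difference_eq_zero hP hDt hDR hh hS h0
  -- The test function is the indicator of the event: its integral against the change of the
  -- innovations is zero, whereas the sign on the event is strict.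
  have hnn : 0 ≤ᵐ[P.prod (volume.restrict (cell Dt 0))] fun q : Config × Plane =>
      s * (S.indicator 1 (q.2, q.1) * lam q.2 q.1 * ∑ i ∈ box (⌊R / Dt⌋ + 1),
        (innov lam h (cell Dt i) q.1 - innov lam h (cell Dt i) (q.1.insert q.2))) := by
    filter_upwards [ae_snd_mem (measurableSet_cell Dt 0)] with q hq
    by_cases hqS : (q.2, q.1) ∈ S
    · rw [indicator_of_mem hqS, Pi.one_apply, one_mul, Pi.zero_apply, mul_left_comm]
      exact (mul_pos (hP.pos _ _) (hpos q.1 q.2 hq hqS)).le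
    · simp [indicator_of_notMem hqS]
  have hz : ∫ q : Config × Plane, s * (S.indicator 1 (q.2, q.1) * lam q.2 q.1 *
      ∑ i ∈ box (⌊R / Dt⌋ + 1), (innov lam h (cell Dt i) q.1 -
        innov lam h (cell Dt i) (q.1.insert q.2))) ∂(P.prod (volume.restrict (cell Dt 0))) = 0 := by
    rw [integral_const_mul, hE, mul_zero]
  rw [integral_eq_zero_iff_of_nonneg_ae hnn (hI.const_mul s)] at hz
  have hnot : ∀ᵐ q ∂(P.prod (volume.restrict (cell Dt 0))), ¬ (q.2, q.1) ∈ S := by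
    filter_upwards [hz, ae_snd_mem (measurableSet_cell Dt 0)] with q hq hc hqS
    rw [indicator_of_mem hqS, Pi.one_apply, one_mul, Pi.zero_apply, mul_left_comm] at hq
    exact (mul_pos (hP.pos _ _) (hpos q.1 q.2 hc hqS)).ne' hq
  rw [ae_iff] at hnot
  simpa using hnot

-- The product of `E` with a small ball in the central cell has positive measure and lies in the
-- local event, so it suffices to find one `E` that works for all `x` in the ball.
omit [IsProbabilityMeasure P] in
theorem prod_ne_zero {E : Set Config} (hE : P E ≠ 0) {r : ℝ} (hr : 0 < r) (hrD : r ≤ Dt / 2)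
    {S : Set (Plane × Config)} (hS : ∀ φ ∈ E, ∀ x ∈ Metric.ball (0 : Plane) r, (x, φ) ∈ S) :
    (P.prod (volume.restrict (cell Dt 0))) {q | (q.2, q.1) ∈ S} ≠ 0 := by
  intro h
  have h2 : (P.prod (volume.restrict (cell Dt 0))) (E ×ˢ Metric.ball (0 : Plane) r) = 0 :=
    measure_mono_null (fun q hq => hS q.1 hq.1 q.2 hq.2) h
  rw [Measure.prod_prod, mul_eq_zero, Measure.restrict_apply Metric.isOpen_ball.measurableSet,
    inter_eq_left.2 ((Metric.ball_subset_ball hrD).trans (ball_subset_cell Dt))] at h2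
  rcases h2 with h2 | h2
  · exact hE h2
  · exact (Metric.measure_ball_pos volume _ hr).ne' h2

end

/-! ### Positive variance when the coefficient of the point count is nonzero. -/

section

variable {p : ℕ} {β₀ : ℝ} (d θ y : Fin (p + 1) → ℝ) (h0 : 0 < β₀) (h1 : β₀ < Real.pi / 3)
  {D : ℝ} (hR : IsRange β₀ d D) (hD : 0 < D) {P : Measure Config} [IsProbabilityMeasure P]
  (hP : HasIntensity P (intensity β₀ d θ) D) {Dt : ℝ} (hDt : 0 < Dt)

include h0 h1 hR hD hP hDt

/-- The test event is that no point lies within `2 D` of `x`. Inserting `x` then creates no triangle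
in view of any other location, so the integrals do not change and the only effect is the term of `x`
itself. -/
theorem sum_innovCov_pos_of_zero_ne (hy : y 0 ≠ 0) :
    0 < ∑ i ∈ box (⌊D / Dt⌋ + 1),
      innovCov P (intensity β₀ d θ) Dt (combIncr β₀ d y) (combIncr β₀ d y) i := by
  classical
  by_contra! hle
  have hh := isLocal_combIncr d y h0 h1 hR
  set S : Set (Plane × Config) := {q | ∀ a ∈ q.2.1, 2 * D < dist a q.1} with hSdef
  have hSm : MeasurableSet S := measurableSet_forall_mem (c := fun q : Plane × Config => q.2)
    measurable_snd (s := {r : (Plane × Config) × Plane | 2 * D < dist r.2 r.1.1})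
    (measurableSet_lt measurable_const
      (measurable_snd.dist (measurable_fst.comp measurable_fst)))
  have hS : IsLocal (2 * D) fun x φ => S.indicator 1 (x, φ) := by
    refine isLocal_indicator hSm (fun x φ => ⟨fun h a ha => h a ha.1, fun h a ha => ?_⟩)
      fun v x φ => ⟨fun h a ha => ?_, ?_⟩
    · by_contra hn
      exact hn (h a ⟨ha, Metric.mem_closedBall.2 (not_lt.1 hn)⟩)
    · simpa using h (a + v) (mem_image_of_mem _ ha)
    · rintro h _ ⟨a, ha, rfl⟩
      simpa using h a ha
  refine prod_ne_zero (P := P) (Dt := Dt) (S := S) (void_pos hP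
    (B := Metric.closedBall 0 (Dt / 2 + 2 * D)) Metric.isClosed_closedBall.measurableSet
    Metric.isBounded_closedBall) (half_pos hDt) le_rfl ?_
    (prod_eq_zero_of_forall_pos hP hDt (by linarith) hh hle hS (y 0) ?_)
  · intro φ hφ x hx a ha
    have h2 := (pts_eq_zero_iff _ _).1 hφ a ha
    rw [Metric.mem_closedBall, not_le] at h2
    have := dist_triangle a x 0
    rw [Metric.mem_ball] at hx
    change 2 * D < dist a x
    linarith
  · intro φ x hx hxS
    have hxφ : x ∉ φ.1 := fun h => by
      have := hxS x h
      simp only [dist_self] at this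
      linarith
    have hnear : φ.1 ∩ Metric.closedBall x (2 * D) ⊆ {x} := fun a ha =>
      absurd (hxS a ha.1) (not_lt.2 (Metric.mem_closedBall.1 ha.2))
    have hdiff : ∀ i, innov (intensity β₀ d θ) (combIncr β₀ d y) (cell Dt i) φ -
        innov (intensity β₀ d θ) (combIncr β₀ d y) (cell Dt i) (φ.insert x) =
          if x ∈ cell Dt i then y 0 else 0 := by
      intro i
      rw [innov_sub_innov_insert d θ y h0 h1 hR hD hxφ hnear
        (isBounded_cell Dt i), integral_eq_zero_of_ae, zero_add]
      refine ae_restrict_of_ae ?_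
      have hae : ∀ᵐ z : Plane, z ∉ (φ.insert x).1 :=
        measure_eq_zero_iff_ae_notMem.1 (volume_config _)
      filter_upwards [hae] with z hz
      have hz' : z ∉ φ.1 := fun h => hz (by rw [Config.coe_insert]; exact Or.inr h)
      rw [integrand_sub_integrand_insert d θ y h0 h1 hR hnear hz', Pi.zero_apply]
      split_ifs with hzx
      · have hsub : (φ.insert x).1 ∩ Metric.closedBall z D ⊆ {x} := by
          rw [Config.coe_insert]
          rintro b ⟨hb | hb, hbz⟩
          · exact hb
          · have ht := dist_triangle b z x
            rw [Metric.mem_closedBall] at hbz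
            exact hnear ⟨hb, Metric.mem_closedBall.2 (by linarith)⟩
        rw [combIncr_of_subset_singleton d y hR hz hsub,
          intensity_of_subset_singleton d θ hR hz hsub, sub_self]
      · rfl
    -- Cells are closed and several may contain `x`; each of them contributes `y 0 ^ 2`, and the
    -- central cell is one of them.
    simp only [hdiff, Finset.mul_sum, mul_ite, mul_zero]
    refine Finset.sum_pos' (fun i _ => ?_) ⟨0, mem_box.2 fun j => ?_, ?_⟩
    · split_ifs
      · exact mul_self_nonneg _
      · exact le_rfl
    · simp only [Pi.zero_apply, abs_zero]
      positivity
    · rw [if_pos hx]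
      exact mul_self_pos.2 hy

end

/-! ### Positive variance when only edge coefficients are nonzero. -/

section

variable {p : ℕ} {β₀ : ℝ} (d θ y : Fin (p + 1) → ℝ) (h0 : 0 < β₀) (h1 : β₀ < Real.pi / 3)
  {D : ℝ} (hR : IsRange β₀ d D)

/-- The configurations in which a neighbourhood of radius `R` of `x` contains exactly one point,
and the position of this point relatively to `x` lies in the ball with centre `w` and radius
`ε`. -/
def lonelyNeighbour (R ε : ℝ) (w : Plane) : Set (Plane × Config) :=
  {q | ∃ a ∈ q.2.1, a - q.1 ∈ Metric.ball w ε ∧ ∀ b ∈ q.2.1, dist b q.1 ≤ R → b = a}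

/-- The bound `‖w‖ + ε ≤ R` guarantees that the required neighbour itself is visible within distance
`R`. -/
theorem isLocal_lonelyNeighbour {R ε : ℝ} {w : Plane} (hR : ‖w‖ + ε ≤ R) :
    IsLocal R fun x φ => (lonelyNeighbour R ε w).indicator 1 (x, φ) := by
  have hdist : ∀ {a x : Plane}, a - x ∈ Metric.ball w ε → dist a x ≤ R := by
    intro a x h
    rw [Metric.mem_ball, dist_eq_norm] at h
    rw [dist_eq_norm]
    have := norm_sub_norm_le (a - x) w
    linarith
  refine isLocal_indicator ?_ (fun x φ => ⟨?_, ?_⟩) fun v x φ => ⟨?_, ?_⟩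
  · refine measurableSet_exists_mem (c := fun q : Plane × Config => q.2) measurable_snd
      (s := {r : (Plane × Config) × Plane | r.2 - r.1.1 ∈ Metric.ball w ε ∧
        ∀ b ∈ r.1.2.1, dist b r.1.1 ≤ R → b = r.2}) (MeasurableSet.inter ?_ ?_)
    · exact (measurable_snd.sub (measurable_fst.comp measurable_fst))
        Metric.isOpen_ball.measurableSet
    · have m1 : Measurable fun t : ((Plane × Config) × Plane) × Plane => t.1.1.1 := by fun_prop
      have m2 : Measurable fun t : ((Plane × Config) × Plane) × Plane => t.1.2 := by fun_prop
      have m3 : Measurable fun t : ((Plane × Config) × Plane) × Plane => t.2 := by fun_prop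
      refine measurableSet_forall_mem (c := fun r : (Plane × Config) × Plane => r.1.2)
        (measurable_snd.comp measurable_fst)
        (s := {t : ((Plane × Config) × Plane) × Plane | dist t.2 t.1.1.1 ≤ R → t.2 = t.1.2}) ?_
      simp only [imp_iff_not_or]
      exact (measurableSet_le (m3.dist m1) measurable_const).compl.union
        (measurableSet_eq_fun m3 m2)
  · rintro ⟨a, ha, haw, hun⟩
    exact ⟨a, ⟨ha, Metric.mem_closedBall.2 (hdist haw)⟩, haw, fun b hb => hun b hb.1⟩
  · rintro ⟨a, ha, haw, hun⟩
    exact ⟨a, ha.1, haw, fun b hb hbx => hun b ⟨hb, Metric.mem_closedBall.2 hbx⟩ hbx⟩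
  · rintro ⟨_, ⟨a, ha, rfl⟩, haw, hun⟩
    refine ⟨a, ha, by simpa using haw, fun b hb hbx => ?_⟩
    simpa using hun (b + v) (mem_image_of_mem _ hb) (by simpa using hbx)
  · rintro ⟨a, ha, haw, hun⟩
    refine ⟨a + v, mem_image_of_mem _ ha, by simpa using haw, ?_⟩
    rintro _ ⟨b, hb, rfl⟩ hbx
    simpa using hun b hb (by simpa using hbx)

include h0 in
/-- A linear combination of the increments when the new point `z` sees the two points `a` and
`x`, and the coefficients vanish except for the class `k` and for shorter classes. -/
theorem sum_u_pair (hd : StrictMono d) {k : Fin p} (hy0 : y 0 = 0)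
    (hyk : ∀ j, k.succ < j → y j = 0) {z a x : Plane}
    (hsides : orient x a z ≠ 0 → AnglesGT β₀ x a z →
      d k.castSucc < dist x a ∧ d k.castSucc < dist x z ∧ d k.castSucc < dist a z) :
    ∑ j, y j * u β₀ d {z} {a, x} j = y k.succ *
      (edgesIoc β₀ (d k.castSucc) (d k.succ) ({z, a, x} : Set Plane)).ncard := by
  rw [Finset.sum_eq_single k.succ]
  · rw [u_pair]
  · intro j _ hj
    rcases lt_or_gt_of_ne hj with hlt | hgt
    · induction j using Fin.cases with
      | zero => rw [hy0, zero_mul]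
      | succ j =>
        rw [u_pair, edgesIoc_triple_eq_empty h0 (hd.monotone ?_) hsides]
        · simp
        · rw [Fin.succ_lt_succ_iff] at hlt
          rw [Fin.le_iff_val_le_val]
          simpa using hlt
    · rw [hyk j hgt, zero_mul]
  · intro h; exact absurd (Finset.mem_univ _) h

include hR in
/-- Points at a distance larger than the range do not see each other. -/
theorem dist_le_of_edges_nonempty {k : Fin p} {z a x : Plane} (hza : z ≠ a) (hzx : z ≠ x)
    (h : (edgesIoc β₀ (d k.castSucc) (d k.succ) ({z, a, x} : Set Plane)).Nonempty) :
    dist z x ≤ D := by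
  by_contra hlt
  have hz : z ∉ ((Config.single a).insert x).1 := by
    rw [Config.coe_insert, Config.coe_single]
    rintro (h | h)
    exacts [hzx h, hza h]
  have hsub : ((Config.single a).insert x).1 ∩ Metric.closedBall z D ⊆ {a} := by
    rw [Config.coe_insert, Config.coe_single]
    rintro b ⟨hb | hb, hbz⟩
    · rw [mem_singleton_iff.1 hb, Metric.mem_closedBall, dist_comm] at hbz
      exact absurd hbz hlt
    · exact hb
  have e := incr_of_subset_singleton d hR hz hsub k.succ
  rw [incr, Config.coe_insert, Config.coe_single, union_comm, singleton_union, u_pair,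
    Pi.single_eq_of_ne (Fin.succ_ne_zero k), Nat.cast_eq_zero,
    ncard_eq_zero finite_edges_triple] at e
  rw [e] at h
  exact not_nonempty_empty h

-- Within distance `D` of `z` everything is within `2 D` of `x`, where `φ ∪ x` consists of `a` and
-- `x` only.
include h0 h1 hR in
theorem combIncr_insert_eq {x a z : Plane} {φ : Config} (ha : a ∈ φ.1)
    (hφ : φ.1 ∩ Metric.closedBall x (2 * D) ⊆ {a}) (hz : dist z x ≤ D) :
    combIncr β₀ d y z (φ.insert x) = ∑ j, y j * u β₀ d {z} {a, x} j := by
  have hc : (φ.insert x).restrict (Metric.closedBall z D) =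
      ((Config.single a).insert x).restrict (Metric.closedBall z D) := by
    refine Config.ext ?_
    rw [Config.coe_restrict, Config.coe_restrict, Config.coe_insert, Config.coe_insert,
      Config.coe_single]
    ext b
    constructor
    · rintro ⟨hb | hb, hbz⟩
      · exact ⟨Or.inl hb, hbz⟩
      · have ht := dist_triangle b z x
        have hbz' := Metric.mem_closedBall.1 hbz
        exact ⟨Or.inr (hφ ⟨hb, Metric.mem_closedBall.2 (by linarith)⟩), hbz⟩
    · rintro ⟨hb | hb, hbz⟩
      · exact ⟨Or.inl hb, hbz⟩
      · exact ⟨Or.inr (by rw [mem_singleton_iff.1 hb]; exact ha), hbz⟩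
  rw [(isLocal_combIncr d y h0 h1 hR).congr hc, combIncr]
  simp only [incr, Config.coe_insert, Config.coe_single, union_comm {x} {a}, singleton_union]

variable (hD : 0 < D) {P : Measure Config} [IsProbabilityMeasure P]
  (hP : HasIntensity P (intensity β₀ d θ) D) {Dt : ℝ} (hDt : 0 < Dt)

-- Since `y 0 = 0`, inserting `x` acts only through the integrals, where the triangle `z a x` may
-- appear. Its sides are too long for the shorter classes, and longer classes have coefficient zero,
-- so `-y k.succ` times the change is the integral of `y k.succ ^ 2` times the number of edges of
-- class `k` and the intensity.
include h0 h1 hR hD hDt in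
theorem sum_innov_sub_pos (hd : StrictMono d) {k : Fin p} (hy0 : y 0 = 0) (hyne : y k.succ ≠ 0)
    (hyk : ∀ j, k.succ < j → y j = 0) {x a z₀ : Plane} {φ : Config} {ε R : ℝ} (hε : 0 < ε)
    (hDR : D ≤ R) (hx : x ∈ cell Dt 0) (hxφ : x ∉ φ.1) (ha : a ∈ φ.1)
    (hφ : φ.1 ∩ Metric.closedBall x (2 * D) ⊆ {a})
    (hsides : ∀ z, orient x a z ≠ 0 → AnglesGT β₀ x a z →
      d k.castSucc < dist x a ∧ d k.castSucc < dist x z ∧ d k.castSucc < dist a z)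
    (hz₀ : ∀ z, z - x ∈ Metric.ball z₀ ε →
      orient x a z ≠ 0 ∧ AnglesGT β₀ x a z ∧ dist x z ≤ d k.succ) :
    0 < -y k.succ * ∑ i ∈ box (⌊R / Dt⌋ + 1),
      (innov (intensity β₀ d θ) (combIncr β₀ d y) (cell Dt i) φ -
        innov (intensity β₀ d θ) (combIncr β₀ d y) (cell Dt i) (φ.insert x)) := by
  classical
  have hh := isLocal_combIncr d y h0 h1 hR
  have hl := isLocal_intensity d θ h0 h1 hR
  set F : Plane → ℝ := fun z => -y k.succ * (combIncr β₀ d y z φ * intensity β₀ d θ z φ -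
      combIncr β₀ d y z (φ.insert x) * intensity β₀ d θ z (φ.insert x)) with hF
  have hdiff : ∀ i, -y k.succ * (innov (intensity β₀ d θ) (combIncr β₀ d y) (cell Dt i) φ -
      innov (intensity β₀ d θ) (combIncr β₀ d y) (cell Dt i) (φ.insert x)) =
        ∫ z in cell Dt i, F z := by
    intro i
    rw [innov_sub_innov_insert d θ y h0 h1 hR hD hxφ hφ
      (isBounded_cell Dt i), hy0, ite_self, add_zero, ← integral_const_mul]
  have hFint : ∀ i, IntegrableOn F (cell Dt i) := fun i =>
    ((hl.integrableOn_mul hh (isBounded_cell Dt i) φ).sub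
      (hl.integrableOn_mul hh (isBounded_cell Dt i) (φ.insert x))).const_mul _
  have hae : ∀ᵐ z : Plane, z ∉ (φ.insert x).1 :=
    measure_eq_zero_iff_ae_notMem.1 (volume_config _)
  have hFz : ∀ z, z ∉ (φ.insert x).1 → F z = if dist z x ≤ D then y k.succ ^ 2 *
      (edgesIoc β₀ (d k.castSucc) (d k.succ) ({z, a, x} : Set Plane)).ncard *
        intensity β₀ d θ z (φ.insert x) else 0 := by
    intro z hz
    have hz' : z ∉ φ.1 := fun h => hz (by rw [Config.coe_insert]; exact Or.inr h)
    simp only [hF]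
    rw [integrand_sub_integrand_insert d θ y h0 h1 hR hφ hz', hy0, zero_mul, zero_sub]
    split_ifs with hzx
    · rw [combIncr_insert_eq d y h0 h1 hR ha hφ hzx, sum_u_pair d y h0 hd hy0 hyk (hsides z)]
      ring
    · rw [mul_zero]
  have hFnn : ∀ᵐ z : Plane, 0 ≤ F z := by
    filter_upwards [hae] with z hz
    rw [hFz z hz]
    split_ifs
    · exact mul_nonneg (by positivity) (Real.exp_pos _).le
    · exact le_rfl
  have hFpos : ∀ᵐ z : Plane, z ∈ Metric.ball (z₀ + x) ε → 0 < F z ∧ dist z x ≤ D := by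
    filter_upwards [hae] with z hz hzb
    have hzx : z ≠ x := fun h => hz (by rw [Config.coe_insert]; exact Or.inl h)
    have hza : z ≠ a := fun h => hz (by
      rw [Config.coe_insert]; exact Or.inr (by rw [h]; exact ha))
    have hzb' : z - x ∈ Metric.ball z₀ ε := by
      rw [Metric.mem_ball, dist_eq_norm] at hzb ⊢
      rwa [sub_sub, add_comm x z₀]
    obtain ⟨ho, hA, hlen⟩ := hz₀ z hzb'
    have hne : (edgesIoc β₀ (d k.castSucc) (d k.succ) ({z, a, x} : Set Plane)).Nonempty :=
      ⟨_, mem_edgesIoc_triple h0 ho hA ⟨(hsides z ho hA).2.1, hlen⟩⟩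
    have hclose := dist_le_of_edges_nonempty d hR hza hzx hne
    refine ⟨?_, hclose⟩
    rw [hFz z hz, if_pos hclose]
    have hcard := (ncard_pos finite_edges_triple).2 hne
    exact mul_pos (by positivity) (Real.exp_pos _)
  rw [Finset.mul_sum]
  simp only [hdiff]
  -- Otherwise `F`, almost everywhere nonnegative, would vanish almost everywhere on every cell of
  -- the box. These cells cover the points within `R` of `x`, whereas `F` is positive almost
  -- everywhere on the ball of good apexes.
  by_contra hle
  have hnn : ∀ i ∈ box (⌊R / Dt⌋ + 1), 0 ≤ ∫ z in cell Dt i, F z := fun i _ =>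
    setIntegral_nonneg_of_ae hFnn
  have hzero := (Finset.sum_eq_zero_iff_of_nonneg hnn).1
    (le_antisymm (not_lt.1 hle) (Finset.sum_nonneg hnn))
  have hvan : ∀ i ∈ box (⌊R / Dt⌋ + 1), ∀ᵐ z : Plane, z ∈ cell Dt i → F z = 0 := by
    intro i hi
    have h := (setIntegral_eq_zero_iff_of_nonneg_ae (ae_restrict_of_ae hFnn) (hFint i)).1
      (hzero i hi)
    exact (ae_restrict_iff' (measurableSet_cell Dt i)).1 h
  have hnull : ∀ᵐ z : Plane, z ∉ Metric.ball (z₀ + x) ε := by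
    have hall := (Finset.eventually_all (box (⌊R / Dt⌋ + 1))).2 hvan
    filter_upwards [hall, hFpos] with z hz hp hb
    obtain ⟨hpos, hclose⟩ := hp hb
    obtain ⟨i, hi, hzi⟩ := exists_mem_box_of_dist_le hDt hx (hclose.trans hDR)
    exact hpos.ne' (hz i hi hzi)
  exact (Metric.measure_ball_pos volume (z₀ + x) hε).ne' (measure_eq_zero_iff_ae_notMem.2 hnull)

include h0 h1 hR hD hP hDt

/-- The test event is a single neighbour in the position supplied by `exists_base` for the class `]d
k.castSucc, d k.succ]`. The assumption `d 0 = 0` makes the lower threshold nonnegative, as that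
lemma requires. -/
theorem sum_innovCov_pos_of_succ_ne (hd : StrictMono d) (hd0 : d 0 = 0) {k : Fin p}
    (hy0 : y 0 = 0) (hyne : y k.succ ≠ 0) (hyk : ∀ j, k.succ < j → y j = 0) :
    0 < ∑ i ∈ box (⌊D / Dt⌋ + 1),
      innovCov P (intensity β₀ d θ) Dt (combIncr β₀ d y) (combIncr β₀ d y) i := by
  by_contra! hle
  have hh := isLocal_combIncr d y h0 h1 hR
  obtain ⟨w, z₀, ε, hε, hbase⟩ := exists_base h0 h1 (s := d k.castSucc) (t := d k.succ)
    (by rw [← hd0]; exact hd.monotone (Fin.zero_le _)) (hd Fin.castSucc_lt_succ)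
  -- The first bound makes the neighbour unique within `2 D` of `x`; the second one makes it
  -- visible.
  set R := max (2 * D) (‖w‖ + ε)
  have hR1 : 2 * D ≤ R := le_max_left _ _
  have hR2 : ‖w‖ + ε ≤ R := le_max_right _ _
  -- The tolerance `ε` is shared between the position of the neighbour and that of `x`; the other
  -- bound keeps `x` in the central cell.
  have hδ : 0 < min (Dt / 2) (ε / 2) := lt_min (half_pos hDt) (half_pos hε)
  set δ := min (Dt / 2) (ε / 2)
  have hδ1 : δ ≤ Dt / 2 := min_le_left _ _
  have hδ2 : δ ≤ ε / 2 := min_le_right _ _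
  refine prod_ne_zero (P := P) (Dt := Dt) (S := lonelyNeighbour R ε w) (single_pos hP
    (B := Metric.closedBall 0 (δ + R)) Metric.isClosed_closedBall.measurableSet
    Metric.isBounded_closedBall (A := Metric.ball w (ε / 2)) Metric.isOpen_ball.measurableSet ?_
    (Metric.measure_ball_pos volume w (half_pos hε)).ne') hδ hδ1 ?_
    (prod_eq_zero_of_forall_pos hP hDt (by linarith) hh hle (isLocal_lonelyNeighbour hR2)
      (-y k.succ) ?_)
  · intro b hb
    rw [Metric.mem_ball, dist_eq_norm] at hb
    rw [Metric.mem_closedBall, dist_zero_right]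
    have := norm_sub_norm_le b w
    linarith
  · rintro φ ⟨a, ha, haw, hun⟩ x hx
    rw [Metric.mem_ball, dist_zero_right] at hx
    refine ⟨a, ha, ?_, fun b hb hbx => hun b hb ?_⟩
    · rw [Metric.mem_ball, dist_eq_norm] at haw ⊢
      have e : a - x - w = a - w - x := by abel
      change ‖a - x - w‖ < ε
      rw [e]
      have := norm_sub_le (a - w) x
      linarith
    · have ht := dist_triangle b x 0
      rw [dist_zero_right x] at ht
      exact Metric.mem_closedBall.2 (by linarith)
  · rintro φ x hx ⟨a, ha, haw, hun⟩
    obtain ⟨hax, hsides, hz⟩ := hbase x a haw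
    refine sum_innov_sub_pos d θ y h0 h1 hR hD hDt hd hy0 hyne hyk hε (by linarith) hx ?_ ha ?_
      hsides hz
    · intro hxφ
      exact hax (hun x hxφ (by rw [dist_self]; linarith)).symm
    · rintro b ⟨hb, hbx⟩
      exact hun b hb ((Metric.mem_closedBall.1 hbx).trans hR1)

/-- The asymptotic covariance of the increments is nondegenerate. -/
theorem sum_innovCov_combIncr_pos (hd : StrictMono d) (hd0 : d 0 = 0) (hy : y ≠ 0) :
    0 < ∑ i ∈ box (⌊D / Dt⌋ + 1),
      innovCov P (intensity β₀ d θ) Dt (combIncr β₀ d y) (combIncr β₀ d y) i := by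
  classical
  by_cases hy0 : y 0 = 0
  · obtain ⟨j, hj⟩ := Function.ne_iff.1 hy
    -- The largest index is chosen because a base can exclude the shorter length classes but not the
    -- longer ones.
    obtain ⟨K, hK, hmax⟩ := Finset.exists_max_image (Finset.univ.filter fun j => y j ≠ 0) id
      ⟨j, by simpa using hj⟩
    have hKne : y K ≠ 0 := by simpa using hK
    obtain ⟨k, rfl⟩ := Fin.exists_succ_eq.2 (show K ≠ 0 by rintro rfl; exact hKne hy0)
    refine sum_innovCov_pos_of_succ_ne d θ y h0 h1 hR hD hP hDt hd hd0 hy0 hKne fun i hi => ?_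
    by_contra hne
    exact (hmax i (by simpa using hne)).not_gt hi
  · exact sum_innovCov_pos_of_zero_ne d θ y h0 h1 hR hD hP hDt hy0

end

/-! ### The covariance matrix and its quadratic form. -/

section

variable {p : ℕ} {β₀ : ℝ} {d θ : Fin (p + 1) → ℝ} (h0 : 0 < β₀) (h1 : β₀ < Real.pi / 3)
  {D : ℝ} (hR : IsRange β₀ d D) {P : Measure Config} [IsProbabilityMeasure P]
  (hP : HasIntensity P (intensity β₀ d θ) D) {Dt : ℝ}

omit [IsProbabilityMeasure P] in
theorem covMatrix_apply (k l : Fin (p + 1)) : covMatrix β₀ d θ P D Dt k l = (Dt ^ 2)⁻¹ *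
    ∑ i ∈ box (⌊D / Dt⌋ + 1),
      innovCov P (intensity β₀ d θ) Dt (incr β₀ d k) (incr β₀ d l) i := by
  simp only [covMatrix, Matrix.of_apply, score_eq, innovCov]

include h0 h1 hR hP

omit [IsProbabilityMeasure P] in
theorem isSymm_covMatrix : (covMatrix β₀ d θ P D Dt).IsSymm := by
  refine Matrix.IsSymm.ext fun k l => ?_
  rw [covMatrix_apply, covMatrix_apply, ← sum_box_neg]
  congr 1
  exact Finset.sum_congr rfl fun i _ =>
    innovCov_neg hP (isLocal_incr d h0 h1 hR l) (isLocal_incr d h0 h1 hR k) i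

/-- Innovations are linear in the function, so the quadratic form at `y` is the asymptotic variance
of the single innovation of `combIncr β₀ d y`. -/
theorem dotProduct_covMatrix_mulVec (y : Fin (p + 1) → ℝ) :
    dotProduct y ((covMatrix β₀ d θ P D Dt).mulVec y) = (Dt ^ 2)⁻¹ * ∑ i ∈ box (⌊D / Dt⌋ + 1),
      innovCov P (intensity β₀ d θ) Dt (combIncr β₀ d y) (combIncr β₀ d y) i := by
  have hI := isLocal_incr d h0 h1 hR
  have e : ∀ i, innovCov P (intensity β₀ d θ) Dt (combIncr β₀ d y) (combIncr β₀ d y) i =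
      ∑ k, ∑ l, y k * y l * innovCov P (intensity β₀ d θ) Dt (incr β₀ d k) (incr β₀ d l) i :=
    fun i => innovCov_sum hP hI hI y y Finset.univ Finset.univ i
  simp only [dotProduct, Matrix.mulVec, covMatrix_apply, e, Finset.mul_sum, Finset.sum_mul]
  rw [Finset.sum_comm]
  conv_rhs => rw [Finset.sum_comm]
  rw [Finset.sum_comm]
  refine Finset.sum_congr rfl fun k _ => ?_
  conv_rhs => rw [Finset.sum_comm]
  refine Finset.sum_congr rfl fun l _ => Finset.sum_congr rfl fun i _ => ?_
  ring

theorem posDef_covMatrix (hD : 0 < D) (hDt : 0 < Dt) (hd : StrictMono d) (hd0 : d 0 = 0) :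
    (covMatrix β₀ d θ P D Dt).PosDef := by
  refine Matrix.PosDef.of_dotProduct_mulVec_pos ?_ fun y hy => ?_
  · rw [Matrix.IsHermitian, Matrix.conjTranspose_eq_transpose_of_trivial]
    exact isSymm_covMatrix h0 h1 hR hP
  · rw [star_trivial, dotProduct_covMatrix_mulVec h0 h1 hR hP]
    exact mul_pos (by positivity) (sum_innovCov_combIncr_pos d θ y h0 h1 hR hD hP hDt hd hd0 hy)

end

end BetaDelaunay

end

theorem proposition4 (p : ℕ) (β₀ : ℝ) (hβ₀ : 0 < β₀) (hβ₀' : β₀ < Real.pi / 3)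
    (d : Fin (p + 1) → ℝ) (hd₀ : d 0 = 0) (hd : StrictMono d)
    (θ : Fin (p + 1) → ℝ)
    (P : MeasureTheory.Measure BetaDelaunay.Config) [MeasureTheory.IsProbabilityMeasure P]
    (hstat : BetaDelaunay.IsStationary P) (hGibbs : BetaDelaunay.IsGibbs β₀ d θ P) :
    (∃ D : ℝ, 0 < D ∧ BetaDelaunay.IsRange β₀ d D) ∧
    ∀ D : ℝ, 0 < D → BetaDelaunay.IsRange β₀ d D → ∀ Dt : ℝ, 0 < Dt →
      (∀ (i : Fin 2 → ℤ) (φ : BetaDelaunay.Config) (k : Fin (p + 1)),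
        MeasureTheory.IntegrableOn (BetaDelaunay.scoreIntegrand β₀ d θ φ k)
          (BetaDelaunay.cell Dt i)) ∧
      (∀ (i : Fin 2 → ℤ) (k l : Fin (p + 1)),
        MeasureTheory.Integrable (fun φ =>
          BetaDelaunay.score β₀ d θ Dt 0 φ k * BetaDelaunay.score β₀ d θ Dt i φ l) P) ∧
      (BetaDelaunay.covMatrix β₀ d θ P D Dt).IsSymm ∧
      (BetaDelaunay.covMatrix β₀ d θ P D Dt).PosDef := by
  refine ⟨BetaDelaunay.exists_range hβ₀ hβ₀' d hd, fun D hD hR Dt hDt => ?_⟩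
  have hP := BetaDelaunay.hasIntensity d θ hβ₀ hβ₀' hR hD hstat hGibbs
  have hI := BetaDelaunay.isLocal_incr d hβ₀ hβ₀' hR
  refine ⟨fun i φ k => hP.loc.integrableOn_mul (hI k) (BetaDelaunay.isBounded_cell Dt i) φ,
    fun i k l => ?_, BetaDelaunay.isSymm_covMatrix hβ₀ hβ₀' hR hP,
    BetaDelaunay.posDef_covMatrix hβ₀ hβ₀' hR hP hD hDt hd hd₀⟩
  simp only [BetaDelaunay.score_eq]
  exact BetaDelaunay.integrable_innov_mul hP (hI k) (hI l) 0 i
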